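/- For $n\in\mathbb N$ let $q=n^3$ and $m=n\lceil\log_2 q\rceil+2n$ (asymptotic statements are in $n\to\infty$). For $z\in\mathbb Z_q$ let $|z|$ be the absolute value of the representative of $z$ of least absolute value, and for $x,y\in\mathbb Z_q^m$ let $\|x-y\|_\infty=\max_i|x_i-y_i|$ and $B(x,\varepsilon)=\{y:\|x-y\|_\infty\le\varepsilon\}$. Let $\chi$ be the discrete Gaussian with standard deviation parameter $\sigma=q/n^2$ (the probability of $x\in\mathbb Z$ is proportional to $e^{-x^2/(2\sigma^2)}$) truncated to $|x|\le q/(2n)$ and reduced modulo $q$. A function is negligible if it decays faster than every inverse polynomial in $n$; all algorithms get $1^n$ as input, and "efficient" means (probabilistic) polynomial time. *LWE assumption.* For every efficient distinguisher $\mathsf D$, with $A\leftarrow\mathbb Z_q^{n\times m}$, $s\leftarrow\mathbb Z_q^n$, $e\leftarrow\chi^m$, $r\leftarrow\mathbb Z_q^m$, the difference $\big|\Pr[\mathsf D(A,s^TA+e^T)=1]-\Pr[\mathsf D(A,r^T)=1]\big|$ is negligible. *Trapdoor sampler.* An efficient algorithm $\mathsf{TrapSamp}$ that outputs pairs $(A,T)$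 with $A\in\mathbb Z_q^{n\times m}$, $T\in\mathbb Z_q^{m\times n\lceil\log_2 q\rceil}$ such that always $AT=0\bmod q$ and $T$ has only zero-one entries, and such that, for some $c>0$ and all large $n$, the distribution of $A$ has total variation distance less than $2^{-cn}$ from uniform, and $T$ always has a column with an odd number of ones and at least one zero. *Task.* Given $A$, let $D_0$ and $D_1$ be the uniform distributions on $\{s^TA:s\in\mathbb Z_q^n\}$ and on $\{s^TA+\lfloor q/2\rfloor\cdot\mathbf 1^T:s\in\mathbb Z_q^n\}$. *Trapdoor classifier.* $\mathsf R_T(y)=0$ if all entries $z_j$ of $z=y^TT\bmod q$ satisfy $|z_j|\le q/4$, and $\mathsf R_T(y)=1$ otherwise. **Theorem.** Trapdoor samplers exist. For every trapdoor sampler $\mathsf{TrapSamp}$, the learning task $(D_0,D_1)$ given by $(A,T)\leftarrow\mathsf{TrapSamp}(1^n)$ has the following properties. 1. (Learnability) There are an efficient learner and a polynomial $k$ such that, from $k(n)$ independent samples from each of $D_0$ and $D_1$, the learner outputs, except with negligible probability over $A$, the samples and its coins, the description of a deterministic polynomial-time classifier $h$ with $\Pr_{x\leftarrow D_b}[h(x)=b]\ge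 0.99$ for both $b\in\{0,1\}$. 2. (Existence of an efficient robust classifier) $\mathsf R_T(y)$ can be computed from $T$ and $y$ in polynomial time. For all large $n$, every $(A,T)$ that $\mathsf{TrapSamp}$ can output, and both $b\in\{0,1\}$, $$\Pr_{x\leftarrow D_b}\big[\mathsf R_T(\tilde x)=b\text{ for all }\tilde x\in B(x,q/4m)\big]\ge 0.99 .$$ 3. (Unlearnability of a robust classifier) Consider the perturbation $\mathsf P(x)=x+e$ with $e\leftarrow\chi^m$; up to a negligible statistical error it is computed by a polynomial-size randomized algorithm. Under the LWE assumption, no efficiently learned classifier classifies the perturbed samples better than chance: for every polynomial $k$, every efficient learner $\mathsf L$, which outputs a description $h$ from $k(n)$ independent samples from each of $D_0$ and $D_1$, and every efficient randomized evaluator $\mathsf R$ of descriptions, there is a negligible $\nu$ such that $$\Pr\big[\mathsf R(h,x+e)=b\big]\le\tfrac12+\nu(n),$$ where $(A,T)\leftarrow\mathsf{TrapSamp}(1^n)$, $h\leftarrow\mathsf L$, $b\leftarrow\{0,1\}$, $x\leftarrow D_b$, $e\leftarrow\chi^m$. -/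

import Mathlib

open Filter Topology

/-! ### Algorithms and running time -/

/-- The data on which programs operate: natural numbers and pairs. -/
inductive Data : Type
  | num (k : ℕ) : Data
  | pair (a b : Data) : Data
  deriving DecidableEq

namespace Data

/-- The length of a datum. Numbers are written in unary, so `num n` is the usual input `1ⁿ`. -/
def size : Data → ℕ
  | num k => k + 1
  | pair a b => size a + size b + 1

def toNat : Data → ℕ
  | num k => k
  | pair _ _ => 0

def fst : Data → Data
  | num _ => num 0
  | pair a _ => a

def snd : Data → Data
  | num _ => num 0
  | pair _ b => b

def isNum : Data → Data
  | num _ => num 1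
  | pair _ _ => num 0

/-- Finite lists, as nested pairs closed by `num 0`. -/
def ofList : List Data → Data
  | [] => num 0
  | a :: l => pair a (ofList l)

/-- A bit, or a class label; `false` is the label `0` and `true` the label `1`. -/
def ofBool (b : Bool) : Data := num b.toNat

/-- A vector over `ℤ/q`, as the list of its representatives in `{0, …, q - 1}`. -/
def ofVec {q k : ℕ} (v : Fin k → ZMod q) : Data :=
  ofList (List.ofFn fun i => num (v i).val)

/-- A matrix over `ℤ/q`, as the list of its rows. -/
def ofMat {q k l : ℕ} (A : Matrix (Fin k) (Fin l) (ZMod q)) : Data :=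
  ofList (List.ofFn fun i => ofVec (A i))

/-- A finite sequence of vectors over `ℤ/q`. -/
def ofVecs {q k l : ℕ} (v : Fin k → Fin l → ZMod q) : Data :=
  ofList (List.ofFn fun i => ofVec (v i))

def ofBits {k : ℕ} (r : Fin k → Bool) : Data :=
  ofList (List.ofFn fun i => ofBool (r i))

end Data

/-- Programs. The binary operations act on a pair of numbers; `seq f g` runs `f` and then `g`;
`fork f g` runs both on the same input and pairs the results; `cond c f g` branches on whether `c`
returns a nonzero number; `loop f` applied to `pair (num k) x` runs `f` on `x` repeatedly,
`k` times. As only programs with a polynomial bound on their running time are considered, and such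
a bound can be computed from the input beforehand, bounded loops are no restriction. -/
inductive Prog : Type
  | id : Prog
  | const (k : ℕ) : Prog
  | fst : Prog
  | snd : Prog
  | isNum : Prog
  | add : Prog
  | sub : Prog
  | mul : Prog
  | div : Prog
  | seq (f g : Prog) : Prog
  | fork (f g : Prog) : Prog
  | cond (c f g : Prog) : Prog
  | loop (f : Prog) : Prog

namespace Prog

/-- The result of a program. -/
def eval : Prog → Data → Data
  | id, x => x
  | const k, _ => .num k
  | fst, x => x.fst
  | snd, x => x.snd
  | isNum, x => x.isNum
  | add, x => .num (x.fst.toNat + x.snd.toNat)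
  | sub, x => .num (x.fst.toNat - x.snd.toNat)
  | mul, x => .num (x.fst.toNat * x.snd.toNat)
  | div, x => .num (x.fst.toNat / x.snd.toNat)
  | seq f g, x => eval g (eval f x)
  | fork f g, x => .pair (eval f x) (eval g x)
  | cond c f g, x => if (eval c x).toNat = 0 then eval g x else eval f x
  | loop f, x => (eval f)^[x.fst.toNat] x.snd

/-- The running time of a program. A basic operation costs the length of its input plus the length
of its output. -/
def cost : Prog → Data → ℕ
  | seq f g, x => 1 + cost f x + cost g (eval f x)
  | fork f g, x => 1 + cost f x + cost g x
  | cond c f g, x =>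
      1 + cost c x + (if (eval c x).toNat = 0 then cost g x else cost f x)
  | loop f, x =>
      x.size + ∑ i ∈ Finset.range x.fst.toNat, (1 + cost f ((eval f)^[i] x.snd))
  | f, x => x.size + (eval f x).size

/-- The running time is bounded by a polynomial in the length of the input, on every input. -/
def PolyTime (p : Prog) : Prop :=
  ∃ P : Polynomial ℕ, ∀ x : Data, p.cost x ≤ P.eval x.size

end Prog

/-- Probabilistic polynomial-time algorithms: polynomial-time programs that also receive a tape of
fair coin tosses, whose length is a polynomial in the security parameter. -/
structure PPT where
  prog : Prog
  coins : Polynomial ℕ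
  polyTime : prog.PolyTime

/-- The output distribution on input `x` for security parameter `n`. -/
noncomputable def PPT.run (M : PPT) (n : ℕ) (x : Data) : PMF Data :=
  (PMF.uniformOfFintype (Fin (M.coins.eval n) → Bool)).map fun r =>
    M.prog.eval (.pair x (.ofBits r))

/-! ### Probability -/

noncomputable def prob {α : Type} (p : PMF α) (S : Set α) : ℝ := (p.toOuterMeasure S).toReal

/-- The law of `k` independent samples from `p`. -/
noncomputable def iid {α : Type} [Fintype α] (p : PMF α) (k : ℕ) : PMF (Fin k → α) :=
  PMF.ofFintype (fun v => ∏ i, p (v i)) (by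
    classical
    have h := Finset.prod_univ_sum (fun _ : Fin k => (Finset.univ : Finset α)) (fun _ a => p a)
    have h1 : ∑ a, p a = 1 := by rw [← tsum_fintype (L := .unconditional α)]; exact p.tsum_coe
    rw [Fintype.piFinset_univ] at h
    rw [← h]
    simp [h1])

/-- Total variation distance. -/
noncomputable def statDist {α : Type} [Fintype α] (p p' : PMF α) : ℝ :=
  2⁻¹ * ∑ a, |(p a).toReal - (p' a).toReal|

def Negligible (ν : ℕ → ℝ) : Prop :=
  Asymptotics.SuperpolynomialDecay atTop (fun n : ℕ => (n : ℝ)) ν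

/-- The weight of `x` for the discrete Gaussian with parameter `σ` truncated to `[-B, B]`. -/
noncomputable def gaussianWeight (σ : ℝ) (B : ℕ) (x : ℤ) : ENNReal :=
  if |x| ≤ (B : ℤ) then ENNReal.ofReal (Real.exp (-(x : ℝ) ^ 2 / (2 * σ ^ 2))) else 0

/-- The discrete Gaussian on `ℤ` with parameter `σ`, conditioned on `[-B, B]`: the probability of
`x` is proportional to `exp (-x² / (2σ²))`. -/
noncomputable def truncatedGaussian (σ : ℝ) (B : ℕ) : PMF ℤ :=
  PMF.normalize (gaussianWeight σ B)
    (by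
      have h : gaussianWeight σ B 0 ≠ 0 := by simp [gaussianWeight]
      exact fun h0 => h (ENNReal.tsum_eq_zero.1 h0 0))
    (by
      rw [tsum_eq_sum (s := Finset.Icc (-(B : ℤ)) B)]
      · refine ENNReal.sum_ne_top.2 fun x _ => ?_
        unfold gaussianWeight
        split_ifs <;> simp
      · intro x hx
        rw [gaussianWeight, if_neg]
        rwa [Finset.mem_Icc, ← abs_le] at hx)

/-! ### The parameters -/

/-- The modulus `q = n³`, with the convention `q = 1` for `n = 0`. -/
def modulus (n : ℕ) : ℕ := max 1 (n ^ 3)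

instance (n : ℕ) : NeZero (modulus n) := ⟨by unfold modulus; positivity⟩

/-- The number `n ⌈log₂ q⌉` of columns of a trapdoor. -/
def trapCols (n : ℕ) : ℕ := n * Nat.clog 2 (modulus n)

/-- The dimension `m = n ⌈log₂ q⌉ + 2n`. -/
def dim (n : ℕ) : ℕ := trapCols n + 2 * n

abbrev Vec (n : ℕ) : Type := Fin (dim n) → ZMod (modulus n)

abbrev LatticeMatrix (n : ℕ) : Type := Matrix (Fin n) (Fin (dim n)) (ZMod (modulus n))

abbrev TrapdoorMatrix (n : ℕ) : Type :=
  Matrix (Fin (dim n)) (Fin (trapCols n)) (ZMod (modulus n))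

/-- The error distribution `χ`: the discrete Gaussian with standard deviation `q / n²` truncated
to `[-q/(2n), q/(2n)]`, reduced modulo `q`. -/
noncomputable def noise (n : ℕ) : PMF (ZMod (modulus n)) :=
  (truncatedGaussian ((modulus n : ℝ) / (n : ℝ) ^ 2) (modulus n / (2 * n))).map
    (fun x : ℤ => (x : ZMod (modulus n)))

/-- The noise vector `χᵐ`. -/
noncomputable def noiseVec (n : ℕ) : PMF (Vec n) := iid (noise n) (dim n)

/-! ### Learning with errors -/

/-- An LWE sample `(A, sᵀA + eᵀ)`. -/
noncomputable def lweSample (n : ℕ) : PMF (LatticeMatrix n × Vec n) := do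
  let A ← PMF.uniformOfFintype (LatticeMatrix n)
  let s ← PMF.uniformOfFintype (Fin n → ZMod (modulus n))
  let e ← noiseVec n
  pure (A, Matrix.vecMul s A + e)

noncomputable def uniformSample (n : ℕ) : PMF (LatticeMatrix n × Vec n) :=
  PMF.uniformOfFintype _

/-- The probability that the distinguisher `D` outputs `1`. -/
noncomputable def acceptProb (D : PPT) (n : ℕ) (p : PMF (LatticeMatrix n × Vec n)) : ℝ :=
  prob (p.bind fun z => D.run n (.pair (.num n) (.pair (.ofMat z.1) (.ofVec z.2)))) {.num 1}

/-- The LWE assumption, for the modulus, dimension and error distribution fixed above. -/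
def LWEAssumption : Prop :=
  ∀ D : PPT, Negligible fun n =>
    |acceptProb D n (lweSample n) - acceptProb D n (uniformSample n)|

/-! ### Trapdoor sampling -/

/-- Probabilistic polynomial-time trapdoor samplers: on input `1ⁿ` they output `(A, T)` with
`A T = 0` such that `T` has only zero-one entries, and, for large `n`, `A` is statistically close
to uniform, and `T` has a column with an odd number of ones and at least one zero. -/
structure IsTrapdoorSampler (TS : (n : ℕ) → PMF (LatticeMatrix n × TrapdoorMatrix n)) : Prop where
  efficient : ∃ M : PPT, ∀ n,
    M.run n (.num n) = (TS n).map fun z => .pair (.ofMat z.1) (.ofMat z.2)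
  mul_eq_zero : ∀ n, ∀ z ∈ (TS n).support, z.1 * z.2 = 0
  zero_one : ∀ n, ∀ z ∈ (TS n).support, ∀ i j, z.2 i j = 0 ∨ z.2 i j = 1
  close_to_uniform : ∃ c : ℝ, 0 < c ∧ ∀ᶠ n : ℕ in atTop,
    statDist ((TS n).map Prod.fst) (PMF.uniformOfFintype (LatticeMatrix n)) < 2 ^ (-(c * n))
  odd_column : ∀ᶠ n : ℕ in atTop, ∀ z ∈ (TS n).support, ∃ j,
    Odd (Finset.univ.filter fun i => z.2 i j = 1).card ∧ ∃ i, z.2 i j = 0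

/-! ### The classification task -/

/-- `D_b`: the uniform distribution on `{sᵀA : s}` for `b = 0` and on `{sᵀA + ⌊q/2⌋ · 1ᵀ : s}`
for `b = 1`. -/
noncomputable def classDist {n : ℕ} (A : LatticeMatrix n) (b : Bool) : PMF (Vec n) :=
  PMF.uniformOfFinset
    (Finset.univ.image fun s : Fin n → ZMod (modulus n) =>
      Matrix.vecMul s A + (if b then (fun _ => ((modulus n / 2 : ℕ) : ZMod (modulus n))) else 0 : Vec n))
    (Finset.univ_nonempty.image _)

/-- `‖x - y‖_∞`, where `ℤ/q` is embedded in `ℤ` by representatives of least absolute value. -/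
def linfDist {q k : ℕ} (x y : Fin k → ZMod q) : ℕ :=
  Finset.univ.sup fun i => (x i - y i).valMinAbs.natAbs

/-- `R` is an `ε`-robust classifier for the distributions `D false`, `D true`. -/
def IsRobust {q k : ℕ} (D : Bool → PMF (Fin k → ZMod q)) (ε : ℝ)
    (R : (Fin k → ZMod q) → Bool) : Prop :=
  ∀ b, 99 / 100 ≤ prob (D b) {x | ∀ y, (linfDist x y : ℝ) ≤ ε → R y = b}

/-- The trapdoor classifier `R_T`: on input `y` compute `z = yᵀT mod q`, and output `0` if all
entries of `z` lie in `[-q/4, q/4]`, and `1` otherwise. -/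
def trapdoorClassifier {n : ℕ} (T : TrapdoorMatrix n) (y : Vec n) : Bool :=
  !decide (∀ j, 4 * (Matrix.vecMul y T j).valMinAbs.natAbs ≤ modulus n)

/-- The learner `L` on input `1ⁿ`, `k` samples from `D_0` and `k` samples from `D_1`. It outputs
(the description of) a classifier. -/
noncomputable def train (L : PPT) (k : ℕ) {n : ℕ} (A : LatticeMatrix n) : PMF Data := do
  let S₀ ← iid (classDist A false) k
  let S₁ ← iid (classDist A true) k
  L.run n (.pair (.num n) (.pair (.ofVecs S₀) (.ofVecs S₁)))

/-- The deterministic classifier with description `h`, evaluated by `R`, outputs the right label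
with probability at least `0.99` on each of the two distributions. -/
def ClassifiesWell (R : Prog) {n : ℕ} (A : LatticeMatrix n) (h : Data) : Prop :=
  ∀ b, 99 / 100 ≤
    prob (classDist A b) {x | R.eval (.pair (.num n) (.pair h (.ofVec x))) = .ofBool b}

/-- The task together with the learned classifier. -/
noncomputable def learningExperiment
    (TS : (n : ℕ) → PMF (LatticeMatrix n × TrapdoorMatrix n))
    (k : Polynomial ℕ) (L : PPT) (n : ℕ) : PMF (LatticeMatrix n × Data) := do
  let z ← TS n
  let h ← train L (k.eval n) z.1
  pure (z.1, h)

/-- The task is sampled, `L` learns a classifier `h` from samples, a sample `x` from `D_b` for a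
random label `b` is perturbed to `x + e` with `e ← χᵐ`, and `h`, evaluated by the probabilistic
algorithm `R`, guesses the label. The outcome is whether the guess is correct. -/
noncomputable def noisyExperiment
    (TS : (n : ℕ) → PMF (LatticeMatrix n × TrapdoorMatrix n))
    (k : Polynomial ℕ) (L R : PPT) (n : ℕ) : PMF Bool := do
  let z ← TS n
  let h ← train L (k.eval n) z.1
  let b ← PMF.uniformOfFintype Bool
  let x ← classDist z.1 b
  let e ← noiseVec n
  let b' ← R.run n (.pair (.num n) (.pair h (.ofVec (x + e))))
  pure (decide (b' = .ofBool b))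

/-- The perturbation `x ↦ x + e`, `e ← χᵐ`, is carried out, up to a negligible statistical error,
by a polynomial-size algorithm: a polynomial-time one with polynomially long advice. -/
def NoisePolynomialSize : Prop :=
  ∃ (P : PPT) (advice : ℕ → Data) (B : Polynomial ℕ) (out : (n : ℕ) → Vec n → PMF (Vec n))
    (ν : ℕ → ℝ), Negligible ν ∧ ∀ n, (advice n).size ≤ B.eval n ∧ ∀ x : Vec n,
      P.run n (.pair (.num n) (.pair (advice n) (.ofVec x))) = (out n x).map .ofVec ∧
      statDist (out n x) ((noiseVec n).map fun e => x + e) ≤ ν n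

/-!
There are three things to prove beside the existence of a sampler, and they are of different kinds.

*Robustness.* If `x = sᵀA` or `x = sᵀA + ⌊q/2⌋ · 1ᵀ`, then `A T = 0` gives `xᵀT = 0` or
`xᵀT = ⌊q/2⌋ · 1ᵀT`. A perturbation of size `q/4m` moves an entry of `xᵀT` by at most `q/4`, and by
at most `(m - 1) q/4m` in a column that contains a zero. In a column with an odd number of ones, the
entry of `⌊q/2⌋ · 1ᵀT` is within `m/2` of `q/2`, and `2m² < q` for large `n`
(`ZMod.le_absMin_half_mul_odd`, `trapdoorClassifier_of_linfDist_le`, `eventually_isRobust`).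

*Learnability.* Samples of `D_0` with uniform secrets span the whole row space of `A`, except with
exponentially small probability: by counting characters, random elements of a finite abelian group
generate it (`card_closure_ne_top_le`). The learned classifier tests whether a vector is in the span
of the samples. As `q` is not prime, the elimination uses the Euclidean algorithm in each coordinate;
it acts on integer lifts of that coordinate and starts from the pivot `(q, 0)` (`memSpan_ofVecs`).
That the second class is disjoint from the row space follows from the correctness of the trapdoor
classifier (`vecMul_ne_classShift`).

*Unlearnability.* A perturbed sample of class `b` is an LWE sample `sᵀA + eᵀ` displaced by
`b ⌊q/2⌋ · 1ᵀ`. Given `(A, y)`, a distinguisher makes its own training samples from `A`, runs the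
learner, displaces `y` by a random class and accepts if the learned classifier recognizes the class
(`exists_distinguisher`). If `y` is uniform then so is the displaced vector, and the class is guessed
with probability at most `1/2` (`prob_guessShift_uniform_le`). If `y` is an LWE sample, this is the
noisy experiment, up to the distance of the sampled `A` from uniform (`noisyExperiment_le`).

The sampler chooses a vector `t` of zeros and ones with `t₀ = 1`, `t₁ = 0` and an odd number of ones,
takes a uniform matrix and corrects its first column so that `A t = 0`. All columns of the trapdoor
are `t`. For `t ≠ t'` the events `A t = 0` and `A t' = 0` are independent, since the difference has
an entry `±1`, so that the second moment of the density of `A` is at most `1 + 8 qⁿ / 2ᵐ`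
(`statDist_annihilate_sq_le`), and `2ᵐ ≥ qⁿ 4ⁿ`.

All algorithms are obtained from a calculus of polynomial-time functions (`IsPolyTime`), in which
loops may be used as long as the size of the state stays polynomial (`IsPolyTime.loopFrom`). Uniform
residues are made of `4n` coin tosses each; their density is at least `1 - 2⁻ⁿ` times that of the
uniform distribution (`mul_uniform_le_map_bitsVal`). In the same way the noise is sampled by
comparing such a binary number with thresholds, which are the advice (`noisePolynomialSize`).
-/

/-! ### A calculus of polynomial-time functions -/

theorem Polynomial.monotone_eval_nat (P : Polynomial ℕ) : Monotone fun x => P.eval x := by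
  intro a b hab
  simp only [Polynomial.eval_eq_sum, Polynomial.sum]
  gcongr

namespace Data

theorem toNat_lt_size (d : Data) : d.toNat < d.size := by
  cases d <;> simp [size, toNat]

theorem size_fst_le (d : Data) : d.fst.size ≤ d.size := by
  cases d <;> simp [size, fst]; omega

theorem size_snd_le (d : Data) : d.snd.size ≤ d.size := by
  cases d <;> simp [size, snd]; omega

end Data

namespace Prog

theorem size_eval_le_cost (p : Prog) : ∀ x, (p.eval x).size ≤ p.cost x := by
  induction p with
  | seq f g hf hg => intro x; have := hg (f.eval x); simp only [eval, cost]; omega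
  | fork f g hf hg =>
    intro x; have := hf x; have := hg x; simp only [eval, cost, Data.size]; omega
  | cond c f g hc hf hg =>
    intro x; have := hf x; have := hg x; simp only [eval, cost]; split_ifs <;> omega
  | loop f hf =>
    intro x
    simp only [eval, cost]
    rcases hk : x.fst.toNat with _ | k
    · have := Data.size_snd_le x
      simpa using this
    · rw [Function.iterate_succ_apply', Finset.sum_range_succ]
      have := hf ((f.eval)^[k] x.snd)
      omega
  | _ => intro x; simp [cost]

end Prog

/-- `b` is bounded by a polynomial in the size `s`. -/
def PolyBounded {α : Type} (s b : α → ℕ) : Prop :=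
  ∃ P : Polynomial ℕ, ∀ a, b a ≤ P.eval (s a)

namespace PolyBounded

variable {α : Type} {s b c : α → ℕ}

theorem of_le (h : PolyBounded s b) (hc : ∀ a, c a ≤ b a) : PolyBounded s c :=
  let ⟨P, hP⟩ := h; ⟨P, fun a => (hc a).trans (hP a)⟩

theorem size : PolyBounded s s := ⟨Polynomial.X, fun a => by simp⟩

theorem const (k : ℕ) : PolyBounded s fun _ => k := ⟨Polynomial.C k, fun a => by simp⟩

theorem add (hb : PolyBounded s b) (hc : PolyBounded s c) : PolyBounded s fun a => b a + c a := by
  obtain ⟨P, hP⟩ := hb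
  obtain ⟨Q, hQ⟩ := hc
  exact ⟨P + Q, fun a => by simpa using add_le_add (hP a) (hQ a)⟩

theorem mul (hb : PolyBounded s b) (hc : PolyBounded s c) : PolyBounded s fun a => b a * c a := by
  obtain ⟨P, hP⟩ := hb
  obtain ⟨Q, hQ⟩ := hc
  exact ⟨P * Q, fun a => by simpa using Nat.mul_le_mul (hP a) (hQ a)⟩

theorem eval (hb : PolyBounded s b) (P : Polynomial ℕ) : PolyBounded s fun a => P.eval (b a) := by
  obtain ⟨Q, hQ⟩ := hb
  exact ⟨P.comp Q, fun a => by
    simpa [Polynomial.eval_comp] using P.monotone_eval_nat (hQ a)⟩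

end PolyBounded

namespace Prog

theorem PolyTime.size_eval {p : Prog} (hp : p.PolyTime) :
    PolyBounded Data.size fun x => (p.eval x).size :=
  PolyBounded.of_le hp p.size_eval_le_cost

theorem PolyTime.seq {p p' : Prog} (hp : p.PolyTime) (hp' : p'.PolyTime) :
    (p.seq p').PolyTime := by
  obtain ⟨P, hP⟩ := hp'
  exact PolyBounded.of_le (((PolyBounded.const 1).add hp).add (hp.size_eval.eval P))
    fun x => by simpa only [cost] using Nat.add_le_add_left (hP _) _

theorem PolyTime.fork {p p' : Prog} (hp : p.PolyTime) (hp' : p'.PolyTime) :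
    (p.fork p').PolyTime :=
  PolyBounded.of_le (((PolyBounded.const 1).add hp).add hp') fun x => by simp [cost]

theorem PolyTime.cond {c p p' : Prog} (hc : c.PolyTime) (hp : p.PolyTime) (hp' : p'.PolyTime) :
    (c.cond p p').PolyTime :=
  PolyBounded.of_le ((((PolyBounded.const 1).add hc).add hp).add hp')
    fun x => by simp only [cost]; split_ifs <;> omega

/-- A loop is polynomial-time as soon as its intermediate results have polynomial size. -/
theorem PolyTime.loop {p : Prog} (hp : p.PolyTime) {b : Data → ℕ} (hb : PolyBounded Data.size b)
    {g : Prog} (hg : g.PolyTime)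
    (h : ∀ x, ∀ i < (g.eval x).fst.toNat, ((p.eval)^[i] (g.eval x).snd).size ≤ b x) :
    (g.seq p.loop).PolyTime := by
  obtain ⟨P, hP⟩ := hp
  refine PolyBounded.of_le (((PolyBounded.const 1).add hg).add (hg.size_eval.add
    (hg.size_eval.mul ((PolyBounded.const 1).add (hb.eval P))))) fun x => ?_
  simp only [cost]
  refine Nat.add_le_add_left (Nat.add_le_add_left ?_ _) _
  calc _ ≤ ∑ i ∈ Finset.range (g.eval x).fst.toNat, (1 + P.eval (b x)) :=
        Finset.sum_le_sum fun i hi => Nat.add_le_add_left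
          ((hP _).trans (P.monotone_eval_nat (h x i (Finset.mem_range.1 hi)))) _
    _ = (g.eval x).fst.toNat * (1 + P.eval (b x)) := by simp
    _ ≤ _ := Nat.mul_le_mul_right _
        ((Data.toNat_lt_size _).le.trans (Data.size_fst_le _))

theorem polyTime_id : id.PolyTime :=
  PolyBounded.of_le (PolyBounded.size.add .size) fun x => by simp [cost, eval]

theorem polyTime_const (k : ℕ) : (const k).PolyTime :=
  PolyBounded.of_le (PolyBounded.size.add (.const (k + 1))) fun x => by simp [cost, eval, Data.size]

theorem polyTime_fst : fst.PolyTime :=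
  PolyBounded.of_le (PolyBounded.size.add .size) fun x => by
    simpa [cost, eval] using x.size_fst_le

theorem polyTime_snd : snd.PolyTime :=
  PolyBounded.of_le (PolyBounded.size.add .size) fun x => by
    simpa [cost, eval] using x.size_snd_le

theorem polyTime_isNum : isNum.PolyTime :=
  PolyBounded.of_le (PolyBounded.size.add (.const 2)) fun x => by
    cases x <;> simp [cost, eval, Data.isNum, Data.size]

theorem _root_.Data.toNat_fst_le (x : Data) : x.fst.toNat ≤ x.size :=
  (Data.toNat_lt_size _).le.trans x.size_fst_le

theorem _root_.Data.toNat_snd_le (x : Data) : x.snd.toNat ≤ x.size :=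
  (Data.toNat_lt_size _).le.trans x.size_snd_le

theorem polyTime_add : add.PolyTime :=
  PolyBounded.of_le (PolyBounded.size.add ((PolyBounded.size.add .size).add (.const 1))) fun x => by
    have := x.toNat_fst_le
    have := x.toNat_snd_le
    simp only [cost, eval, Data.size]; omega

theorem polyTime_sub : sub.PolyTime :=
  PolyBounded.of_le (PolyBounded.size.add (PolyBounded.size.add (.const 1))) fun x => by
    have := x.toNat_fst_le
    simp only [cost, eval, Data.size]; omega

theorem polyTime_mul : mul.PolyTime :=
  PolyBounded.of_le (PolyBounded.size.add ((PolyBounded.size.mul .size).add (.const 1))) fun x => by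
    have := Nat.mul_le_mul x.toNat_fst_le x.toNat_snd_le
    simp only [cost, eval, Data.size]; omega

theorem polyTime_div : div.PolyTime :=
  PolyBounded.of_le (PolyBounded.size.add (PolyBounded.size.add (.const 1))) fun x => by
    have := x.toNat_fst_le
    have := Nat.div_le_self x.fst.toNat x.snd.toNat
    simp only [cost, eval, Data.size]; omega

/-- The program with a given constant result. -/
def constData : Data → Prog
  | .num k => const k
  | .pair a b => fork (constData a) (constData b)

theorem eval_constData (c x : Data) : (constData c).eval x = c := by
  induction c with
  | num k => rfl
  | pair a b ha hb => simp [constData, eval, ha, hb]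

theorem polyTime_constData : ∀ c : Data, (constData c).PolyTime
  | .num k => polyTime_const k
  | .pair a b => (polyTime_constData a).fork (polyTime_constData b)

end Prog

/-- A type whose elements are represented by data, in such a way that every datum is read as some
element. Programs see only data, and their running time is to be bounded on all data. -/
class DataCoding (α : Type) where
  encode : α → Data
  decode : Data → α
  decode_encode : ∀ a, decode (encode a) = a
  /-- The encoding of the element that a datum is read as can be computed. -/
  normalize : ∃ p : Prog, p.PolyTime ∧ ∀ d, p.eval d = encode (decode d)

open DataCoding

attribute [simp] decode_encode

instance : DataCoding Data where
  encode := id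
  decode := id
  decode_encode _ := rfl
  normalize := ⟨.id, Prog.polyTime_id, fun _ => rfl⟩

instance : DataCoding ℕ where
  encode := Data.num
  decode := Data.toNat
  decode_encode _ := rfl
  normalize := ⟨.seq (.fork .id (.const 0)) .add,
    (Prog.polyTime_id.fork (Prog.polyTime_const 0)).seq Prog.polyTime_add, fun _ => rfl⟩

instance : DataCoding Bool where
  encode := Data.ofBool
  decode d := decide (d.toNat ≠ 0)
  decode_encode b := by cases b <;> simp [Data.ofBool, Data.toNat]
  normalize := ⟨.cond .id (.const 1) (.const 0),
    Prog.polyTime_id.cond (Prog.polyTime_const 1) (Prog.polyTime_const 0), fun d => by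
      by_cases h : d.toNat = 0 <;> simp [Prog.eval, h, Data.ofBool]⟩

instance {α β : Type} [DataCoding α] [DataCoding β] : DataCoding (α × β) where
  encode z := .pair (encode z.1) (encode z.2)
  decode d := (decode d.fst, decode d.snd)
  decode_encode z := by simp [Data.fst, Data.snd]
  normalize := by
    obtain ⟨p, hp, hp'⟩ := normalize (α := α)
    obtain ⟨r, hr, hr'⟩ := normalize (α := β)
    exact ⟨.fork (.seq .fst p) (.seq .snd r),
      (Prog.polyTime_fst.seq hp).fork (Prog.polyTime_snd.seq hr), fun d => by
        simp [Prog.eval, hp', hr']⟩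

/-- The length of the encoding. -/
def codeSize {α : Type} [DataCoding α] (a : α) : ℕ := (encode a).size

/-- `f` is computed by a polynomial-time program. -/
@[fun_prop]
structure IsPolyTime {α β : Type} [DataCoding α] [DataCoding β] (f : α → β) : Prop where
  out : ∃ p : Prog, p.PolyTime ∧ ∀ d, p.eval d = encode (f (decode d))

section

variable {α β γ : Type} [DataCoding α] [DataCoding β] [DataCoding γ]

@[simp] theorem codeSize_nat (k : ℕ) : codeSize k = k + 1 := rfl

@[simp] theorem codeSize_prod (z : α × β) : codeSize z = codeSize z.1 + codeSize z.2 + 1 := rfl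

theorem codeSize_data (d : Data) : codeSize d = d.size := rfl

theorem codeSize_decode : PolyBounded Data.size fun d => codeSize (decode d : α) := by
  obtain ⟨p, hp, hp'⟩ := normalize (α := α)
  exact hp.size_eval.of_le fun d => by simp [codeSize, hp']

theorem PolyBounded.comp_decode {b : α → ℕ} (hb : PolyBounded codeSize b) :
    PolyBounded Data.size fun d => b (decode d) := by
  obtain ⟨P, hP⟩ := hb
  exact (codeSize_decode.eval P).of_le fun d => hP _

namespace IsPolyTime

theorem codeSize {f : α → β} (hf : IsPolyTime f) :
    PolyBounded codeSize fun a => codeSize (f a) := by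
  obtain ⟨p, hp, hp'⟩ := hf
  obtain ⟨P, hP⟩ := hp.size_eval
  exact ⟨P, fun a => by simpa [_root_.codeSize, hp'] using hP (encode a)⟩

theorem le {f : α → ℕ} (hf : IsPolyTime f) : PolyBounded _root_.codeSize f :=
  hf.codeSize.of_le fun a => by simp

@[fun_prop]
theorem id : IsPolyTime (fun a : α => a) := ⟨normalize⟩

@[fun_prop]
theorem const (b : β) : IsPolyTime (fun _ : α => b) :=
  ⟨_, Prog.polyTime_constData (encode b), fun _ => Prog.eval_constData _ _⟩

@[fun_prop]
theorem comp {g : β → γ} {f : α → β} (hg : IsPolyTime g) (hf : IsPolyTime f) :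
    IsPolyTime fun a => g (f a) := by
  obtain ⟨p, hp, hp'⟩ := hf
  obtain ⟨r, hr, hr'⟩ := hg
  exact ⟨.seq p r, hp.seq hr, fun d => by simp [Prog.eval, hp', hr']⟩

@[fun_prop]
theorem prodMk {f : α → β} {g : α → γ} (hf : IsPolyTime f) (hg : IsPolyTime g) :
    IsPolyTime fun a => (f a, g a) := by
  obtain ⟨p, hp, hp'⟩ := hf
  obtain ⟨r, hr, hr'⟩ := hg
  exact ⟨.fork p r, hp.fork hr, fun d => by simp [Prog.eval, hp', hr', encode]⟩

/-- A program acting on encodings of elements of `α` may be applied to arbitrary data after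
normalization. -/
theorem of_prog {f : α → β} {p : Prog} (hp : p.PolyTime)
    (h : ∀ a, p.eval (encode a) = encode (f a)) : IsPolyTime f := by
  obtain ⟨r, hr, hr'⟩ := normalize (α := α)
  exact ⟨.seq r p, hr.seq hp, fun d => by simp [Prog.eval, hr', h]⟩

@[fun_prop]
theorem fst {f : α → β × γ} (hf : IsPolyTime f) : IsPolyTime fun a => (f a).1 :=
  comp (of_prog (f := Prod.fst) Prog.polyTime_fst fun _ => rfl) hf

@[fun_prop]
theorem snd {f : α → β × γ} (hf : IsPolyTime f) : IsPolyTime fun a => (f a).2 :=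
  comp (of_prog (f := Prod.snd) Prog.polyTime_snd fun _ => rfl) hf

@[fun_prop]
theorem pair {f g : α → Data} (hf : IsPolyTime f) (hg : IsPolyTime g) :
    IsPolyTime fun a => Data.pair (f a) (g a) :=
  comp (of_prog (f := fun z : Data × Data => Data.pair z.1 z.2) Prog.polyTime_id fun _ => rfl)
    (prodMk hf hg)

@[fun_prop]
theorem num {f : α → ℕ} (hf : IsPolyTime f) : IsPolyTime fun a => Data.num (f a) :=
  comp (of_prog (f := Data.num) Prog.polyTime_id fun _ => rfl) hf

@[fun_prop]
theorem toNat {f : α → Data} (hf : IsPolyTime f) : IsPolyTime fun a => (f a).toNat :=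
  comp ⟨DataCoding.normalize (α := ℕ)⟩ hf

@[fun_prop]
theorem boolToNat {f : α → Bool} (hf : IsPolyTime f) : IsPolyTime fun a => (f a).toNat :=
  comp (of_prog (f := Bool.toNat) Prog.polyTime_id fun _ => rfl) hf

@[fun_prop]
theorem dataFst {f : α → Data} (hf : IsPolyTime f) : IsPolyTime fun a => (f a).fst :=
  comp (of_prog (f := Data.fst) Prog.polyTime_fst fun _ => rfl) hf

@[fun_prop]
theorem dataSnd {f : α → Data} (hf : IsPolyTime f) : IsPolyTime fun a => (f a).snd :=
  comp (of_prog (f := Data.snd) Prog.polyTime_snd fun _ => rfl) hf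

@[fun_prop]
theorem dataIsNum {f : α → Data} (hf : IsPolyTime f) : IsPolyTime fun a => (f a).isNum :=
  comp (of_prog (f := Data.isNum) Prog.polyTime_isNum fun _ => rfl) hf

@[fun_prop]
theorem add {f g : α → ℕ} (hf : IsPolyTime f) (hg : IsPolyTime g) :
    IsPolyTime fun a => f a + g a :=
  comp (of_prog (f := fun z : ℕ × ℕ => z.1 + z.2) Prog.polyTime_add fun _ => rfl) (prodMk hf hg)

@[fun_prop]
theorem sub {f g : α → ℕ} (hf : IsPolyTime f) (hg : IsPolyTime g) :
    IsPolyTime fun a => f a - g a :=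
  comp (of_prog (f := fun z : ℕ × ℕ => z.1 - z.2) Prog.polyTime_sub fun _ => rfl) (prodMk hf hg)

@[fun_prop]
theorem mul {f g : α → ℕ} (hf : IsPolyTime f) (hg : IsPolyTime g) :
    IsPolyTime fun a => f a * g a :=
  comp (of_prog (f := fun z : ℕ × ℕ => z.1 * z.2) Prog.polyTime_mul fun _ => rfl) (prodMk hf hg)

@[fun_prop]
theorem div {f g : α → ℕ} (hf : IsPolyTime f) (hg : IsPolyTime g) :
    IsPolyTime fun a => f a / g a :=
  comp (of_prog (f := fun z : ℕ × ℕ => z.1 / z.2) Prog.polyTime_div fun _ => rfl) (prodMk hf hg)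

@[fun_prop]
theorem mod {f g : α → ℕ} (hf : IsPolyTime f) (hg : IsPolyTime g) :
    IsPolyTime fun a => f a % g a := by
  simp only [Nat.mod_def]
  fun_prop

@[fun_prop]
theorem pow {f : α → ℕ} (hf : IsPolyTime f) (k : ℕ) : IsPolyTime fun a => f a ^ k := by
  induction k with
  | zero => simp only [pow_zero]; fun_prop
  | succ k ih => simp only [pow_succ]; fun_prop

@[fun_prop]
theorem eval {f : α → ℕ} (hf : IsPolyTime f) (P : Polynomial ℕ) :
    IsPolyTime fun a => P.eval (f a) := by
  induction P using Polynomial.induction_on' with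
  | add P Q hP hQ => simp only [Polynomial.eval_add]; fun_prop
  | monomial k c => simp only [Polynomial.eval_monomial]; fun_prop

@[fun_prop]
theorem ite {p : α → Prop} [DecidablePred p] (hp : IsPolyTime fun a => decide (p a))
    {f g : α → β} (hf : IsPolyTime f) (hg : IsPolyTime g) :
    IsPolyTime fun a => if p a then f a else g a := by
  obtain ⟨c, hc, hc'⟩ := hp
  obtain ⟨r, hr, hr'⟩ := hf
  obtain ⟨t, ht, ht'⟩ := hg
  refine ⟨.cond c r t, hc.cond hr ht, fun d => ?_⟩
  by_cases h : p (decode d) <;> simp [Prog.eval, hc', hr', ht', h, encode, Data.ofBool, Data.toNat]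

@[fun_prop]
theorem decide_eq_zero {f : α → ℕ} (hf : IsPolyTime f) : IsPolyTime fun a => decide (f a = 0) :=
  comp (of_prog (f := fun k : ℕ => decide (k = 0))
    (p := .cond .id (.const 0) (.const 1))
    (Prog.polyTime_id.cond (Prog.polyTime_const 0) (Prog.polyTime_const 1))
    (fun k => by by_cases h : k = 0 <;> simp [Prog.eval, h, encode, Data.ofBool, Data.toNat])) hf

@[fun_prop]
theorem decide_eq {f g : α → ℕ} (hf : IsPolyTime f) (hg : IsPolyTime g) :
    IsPolyTime fun a => decide (f a = g a) := by
  have : ∀ a, decide (f a = g a) = decide ((f a - g a) + (g a - f a) = 0) := fun a => by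
    rw [decide_eq_decide]; omega
  simp only [this]
  fun_prop

@[fun_prop]
theorem decide_le {f g : α → ℕ} (hf : IsPolyTime f) (hg : IsPolyTime g) :
    IsPolyTime fun a => decide (f a ≤ g a) := by
  simp only [← Nat.sub_eq_zero_iff_le]
  fun_prop

@[fun_prop]
theorem decide_lt {f g : α → ℕ} (hf : IsPolyTime f) (hg : IsPolyTime g) :
    IsPolyTime fun a => decide (f a < g a) := by
  simp only [← Nat.succ_le_iff, Nat.succ_eq_add_one]
  fun_prop

@[fun_prop]
theorem not {f : α → Bool} (hf : IsPolyTime f) : IsPolyTime fun a => !f a := by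
  have : ∀ a, (!f a) = decide ((f a).toNat = 0) := fun a => by cases f a <;> rfl
  simp only [this]
  fun_prop

@[fun_prop]
theorem and {f g : α → Bool} (hf : IsPolyTime f) (hg : IsPolyTime g) :
    IsPolyTime fun a => f a && g a := by
  have : ∀ a, (f a && g a) = decide ((f a).toNat * (g a).toNat = 1) := fun a => by
    cases f a <;> cases g a <;> rfl
  simp only [this]
  fun_prop

@[fun_prop]
theorem min {f g : α → ℕ} (hf : IsPolyTime f) (hg : IsPolyTime g) :
    IsPolyTime fun a => min (f a) (g a) := by
  simp only [min_def]
  fun_prop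

@[fun_prop]
theorem max {f g : α → ℕ} (hf : IsPolyTime f) (hg : IsPolyTime g) :
    IsPolyTime fun a => max (f a) (g a) := by
  simp only [max_def]
  fun_prop

end IsPolyTime

end

/-! ### Loops, sums and lists -/

/-- The result of `N` rounds of a loop with initial state `s`, where `F i` is round `i`. -/
def loopFrom {σ : Type} (s : σ) (F : ℕ → σ → σ) : ℕ → σ
  | 0 => s
  | i + 1 => F i (loopFrom s F i)

namespace Data

/-- The list `f 0, …, f (N - 1)`. -/
def tab (N : ℕ) (f : ℕ → Data) : Data := ofList ((List.range N).map f)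

/-- Entry `i` of a list. -/
def nth (d : Data) (i : ℕ) : Data := (snd^[i] d).fst

/-- Entry `i` of a list of numbers. -/
def ent (d : Data) (i : ℕ) : ℕ := (d.nth i).toNat

theorem nth_ofList (l : List Data) {i : ℕ} (hi : i < l.length) : (ofList l).nth i = l[i] := by
  induction l generalizing i with
  | nil => simp at hi
  | cons a l ih =>
    cases i with
    | zero => rfl
    | succ i => exact ih (by simpa using hi)

@[simp] theorem nth_tab {N i : ℕ} (hi : i < N) (f : ℕ → Data) : (tab N f).nth i = f i := by
  rw [tab, nth_ofList _ (by simpa using hi)]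
  simp

theorem ofList_ofFn {N : ℕ} {g : Fin N → Data} {f : ℕ → Data} (h : ∀ i : Fin N, f i = g i) :
    ofList (List.ofFn g) = tab N f := by
  rw [tab, List.ofFn_eq_map, ← List.map_coe_finRange_eq_range, List.map_map]
  exact congrArg _ (List.map_congr_left fun i _ => (h i).symm)

theorem nth_ofList_ofFn {N : ℕ} (g : Fin N → Data) (i : Fin N) :
    (ofList (List.ofFn g)).nth i = g i := by
  rw [nth_ofList _ (by simp)]
  simp

@[simp] theorem ent_ofVec {q k : ℕ} (v : Fin k → ZMod q) (i : Fin k) :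
    (ofVec v).ent i = (v i).val := by
  rw [ent, ofVec, nth_ofList_ofFn]; rfl

@[simp] theorem nth_ofMat {q k l : ℕ} (A : Matrix (Fin k) (Fin l) (ZMod q)) (i : Fin k) :
    (ofMat A).nth i = ofVec (A i) := nth_ofList_ofFn _ i

@[simp] theorem ent_ofBits {k : ℕ} (r : Fin k → Bool) (i : Fin k) :
    (ofBits r).ent i = (r i).toNat := by
  rw [ent, ofBits, nth_ofList_ofFn]; rfl

theorem size_tab_le {N : ℕ} {f : ℕ → Data} {b : ℕ} (h : ∀ i < N, (f i).size ≤ b) :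
    (tab N f).size ≤ N * (b + 1) + 1 := by
  have : ∀ l : List ℕ, (∀ i ∈ l, (f i).size ≤ b) →
      (ofList (l.map f)).size ≤ l.length * (b + 1) + 1 := by
    intro l
    induction l with
    | nil => simp [ofList, size]
    | cons a l ih =>
      intro h
      have h1 := h a (by simp)
      have h2 := ih fun i hi => h i (by simp [hi])
      simp only [List.map_cons, ofList, size, List.length_cons, add_mul, one_mul] at h2 ⊢
      omega
  simpa [tab] using this (List.range N) (by simpa using h)

end Data

namespace IsPolyTime

variable {α β γ σ : Type} [DataCoding α] [DataCoding β] [DataCoding γ] [DataCoding σ]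

/-- Bounded loops whose intermediate states have polynomial size. -/
theorem loopFrom {N : α → ℕ} {s : α → σ} {F : α → ℕ → σ → σ}
    (hN : IsPolyTime N) (hs : IsPolyTime s)
    (hF : IsPolyTime fun z : α × ℕ × σ => F z.1 z.2.1 z.2.2)
    {b : α → ℕ} (hb : PolyBounded _root_.codeSize b)
    (h : ∀ a, ∀ i < N a, _root_.codeSize (_root_.loopFrom (s a) (F a) i) ≤ b a) :
    IsPolyTime fun a => _root_.loopFrom (s a) (F a) (N a) := by
  obtain ⟨p, hp, hp'⟩ : IsPolyTime fun z : α × ℕ × σ => (z.1, z.2.1 + 1, F z.1 z.2.1 z.2.2) := by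
    fun_prop
  obtain ⟨r, hr, hr'⟩ : IsPolyTime fun a => (N a, a, 0, s a) := by fun_prop
  have key : ∀ a i, (p.eval)^[i] (encode (a, 0, s a)) =
      encode (a, i, _root_.loopFrom (s a) (F a) i) := by
    intro a i
    induction i with
    | zero => rfl
    | succ i ih => rw [Function.iterate_succ_apply', ih, hp']; simp [_root_.loopFrom]
  refine comp (g := fun z : α × ℕ × σ => z.2.2)
    (f := fun a => (a, N a, _root_.loopFrom (s a) (F a) (N a))) (by fun_prop)
    ⟨r.seq p.loop, hp.loop (((PolyBounded.size.add hN.le).add hb).add (.const 2)).comp_decode hr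
      fun d i hi => ?_, fun d => ?_⟩
  · rw [hr'] at hi ⊢
    have hi : i < N (decode d) := hi
    have := h (decode d) i hi
    change (p.eval^[i] (encode (decode d, 0, s (decode d)))).size ≤ _
    rw [key]
    change _root_.codeSize (decode d, i, _root_.loopFrom _ _ i) ≤ _
    simp only [codeSize_prod, codeSize_nat]
    omega
  · rw [Prog.eval, hr']
    exact key (decode d) (N (decode d))

theorem codeSize_loopFrom_le {s : σ} {F : ℕ → σ → σ} {b : ℕ}
    (h : ∀ i s, _root_.codeSize (F i s) ≤ Nat.max (_root_.codeSize s) b) (i : ℕ) :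
    _root_.codeSize (_root_.loopFrom s F i) ≤ Nat.max (_root_.codeSize s) b := by
  induction i with
  | zero => exact le_max_left _ _
  | succ i ih => exact (h i _).trans (max_le ih (le_max_right _ _))

/-- Loops whose rounds do not make the state larger than a given polynomial. -/
theorem loopFrom_of_le_max {N : α → ℕ} {s : α → σ} {F : α → ℕ → σ → σ}
    (hN : IsPolyTime N) (hs : IsPolyTime s)
    (hF : IsPolyTime fun z : α × ℕ × σ => F z.1 z.2.1 z.2.2)
    {b : α → ℕ} (hb : PolyBounded _root_.codeSize b)
    (h : ∀ a i s, _root_.codeSize (F a i s) ≤ Nat.max (_root_.codeSize s) (b a)) :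
    IsPolyTime fun a => _root_.loopFrom (s a) (F a) (N a) :=
  loopFrom hN hs hF (hs.codeSize.add hb) fun a i _ =>
    (codeSize_loopFrom_le (h a) i).trans (max_le (Nat.le_add_right _ _) (Nat.le_add_left _ _))

/-- A polynomial bound that holds uniformly for all indices below a polynomial-time bound. -/
theorem exists_bound {N : α → ℕ} (hN : IsPolyTime N) {f : α → ℕ → β}
    (hf : IsPolyTime fun z : α × ℕ => f z.1 z.2) :
    ∃ b : α → ℕ, PolyBounded _root_.codeSize b ∧
      ∀ a, ∀ i ≤ N a, _root_.codeSize (f a i) ≤ b a := by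
  obtain ⟨P, hP⟩ := hf.codeSize
  refine ⟨_, ((PolyBounded.size.add hN.le).add (.const 2)).eval P, fun a i hi => ?_⟩
  refine (hP (a, i)).trans (P.monotone_eval_nat ?_)
  simp only [codeSize_prod, codeSize_nat]
  omega

@[fun_prop]
theorem sum {N : α → ℕ} (hN : IsPolyTime N) {f : α → ℕ → ℕ}
    (hf : IsPolyTime fun z : α × ℕ => f z.1 z.2) :
    IsPolyTime fun a => ∑ i ∈ Finset.range (N a), f a i := by
  obtain ⟨b, hb, h⟩ := exists_bound hN hf
  have key : ∀ a i, ∑ j ∈ Finset.range i, f a j =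
      _root_.loopFrom 0 (fun j s => s + f a j) i := by
    intro a i
    induction i with
    | zero => rfl
    | succ i ih => rw [Finset.sum_range_succ, ih]; rfl
  simp only [key]
  refine loopFrom hN (const 0) (by fun_prop) ((hN.le.mul hb).add (.const 1)) fun a i hi => ?_
  rw [← key, codeSize_nat, Nat.add_le_add_iff_right]
  calc ∑ j ∈ Finset.range i, f a j ≤ ∑ j ∈ Finset.range i, b a :=
        Finset.sum_le_sum fun j hj =>
          (Nat.le_succ _).trans (h a j ((Finset.mem_range.1 hj).le.trans hi.le))
    _ = i * b a := by simp
    _ ≤ _ := Nat.mul_le_mul_right _ hi.le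

@[fun_prop]
theorem tab {N : α → ℕ} (hN : IsPolyTime N) {f : α → ℕ → Data}
    (hf : IsPolyTime fun z : α × ℕ => f z.1 z.2) :
    IsPolyTime fun a => Data.tab (N a) (f a) := by
  obtain ⟨b, hb, h⟩ := exists_bound hN hf
  -- The list is built from its last entry.
  have key : ∀ a, ∀ i ≤ N a, _root_.loopFrom (.num 0) (fun j s => .pair (f a (N a - 1 - j)) s) i =
      Data.tab i fun j => f a (N a - i + j) := by
    intro a i hi
    induction i with
    | zero => rfl
    | succ i ih =>
      rw [_root_.loopFrom, ih (by omega), Data.tab, Data.tab, List.range_succ_eq_map,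
        List.map_cons, List.map_map, Data.ofList]
      congr 2
      · rw [show N a - (i + 1) + 0 = N a - 1 - i by omega]
      · exact List.map_congr_left fun j _ => congrArg (f a) (by simp; omega)
  have key' : ∀ a, Data.tab (N a) (f a) =
      _root_.loopFrom (.num 0) (fun j s => .pair (f a (N a - 1 - j)) s) (N a) := fun a => by
    rw [key a _ le_rfl]; simp
  simp only [key']
  have hf' := hf.comp (f := fun z : α × ℕ × Data => (z.1, N z.1 - 1 - z.2.1)) (by fun_prop)
  refine loopFrom hN (const _) (by fun_prop)
    ((hN.le.mul (hb.add (.const 1))).add (.const 1)) fun a i hi => ?_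
  rw [key a i hi.le, codeSize_data]
  exact (Data.size_tab_le fun j hj => h a _ (by omega)).trans
    (Nat.add_le_add_right (Nat.mul_le_mul_right _ hi.le) _)

@[fun_prop]
theorem nth {f : α → Data} {i : α → ℕ} (hf : IsPolyTime f) (hi : IsPolyTime i) :
    IsPolyTime fun a => (f a).nth (i a) := by
  have key : ∀ (d : Data) (k : ℕ), Data.snd^[k] d = _root_.loopFrom d (fun _ s => s.snd) k := by
    intro d k
    induction k with
    | zero => rfl
    | succ k ih => rw [Function.iterate_succ_apply', ih]; rfl
  simp only [Data.nth, key]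
  exact (loopFrom_of_le_max hi hf (dataSnd (by fun_prop)) (.const 0)
    fun a i s => (Data.size_snd_le s).trans (le_max_left _ _)).dataFst

@[fun_prop]
theorem ent {f : α → Data} {i : α → ℕ} (hf : IsPolyTime f) (hi : IsPolyTime i) :
    IsPolyTime fun a => (f a).ent (i a) := by
  unfold Data.ent
  fun_prop

end IsPolyTime

/-! ### Computing the parameters -/

/-- Numbers are unary, so that powers of two have to be cut off at a bound to be computed in
polynomial time. -/
theorem loopFrom_min_two_mul (b i : ℕ) :
    loopFrom (min 1 b) (fun _ s => min (2 * s) b) i = min (2 ^ i) b := by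
  induction i with
  | zero => rfl
  | succ i ih => rw [loopFrom, ih, pow_succ]; omega

theorem Nat.clog_two_eq_sum (q : ℕ) :
    Nat.clog 2 q = ∑ i ∈ Finset.range q, if min (2 ^ i) q < q then 1 else 0 := by
  rw [Finset.sum_boole, Nat.cast_id]
  have : Finset.filter (fun i => min (2 ^ i) q < q) (Finset.range q) =
      Finset.range (Nat.clog 2 q) := by
    ext i
    rw [Finset.mem_filter, Finset.mem_range, Finset.mem_range, Nat.lt_clog_iff_pow_lt one_lt_two]
    have := Nat.lt_two_pow_self (n := i)
    omega
  rw [this, Finset.card_range]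

namespace IsPolyTime

variable {α : Type} [DataCoding α]

@[fun_prop]
theorem clog {f : α → ℕ} (hf : IsPolyTime f) : IsPolyTime fun a => Nat.clog 2 (f a) := by
  have h : IsPolyTime fun z : ℕ × ℕ => Min.min (2 ^ z.2) z.1 := by
    simp only [← loopFrom_min_two_mul]
    refine loopFrom_of_le_max (by fun_prop) (by fun_prop) (by fun_prop)
      (b := fun z => z.1 + 1) (by exact (IsPolyTime.le (by fun_prop)).add (.const 1)) fun a i s => ?_
    simp only [codeSize_nat]
    exact le_max_of_le_right (by omega)
  simp only [Nat.clog_two_eq_sum]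
  have h' := h.comp (f := fun z : α × ℕ => (f z.1, z.2)) (by fun_prop)
  fun_prop

@[fun_prop]
theorem modulus {f : α → ℕ} (hf : IsPolyTime f) : IsPolyTime fun a => modulus (f a) := by
  unfold _root_.modulus
  fun_prop

@[fun_prop]
theorem trapCols {f : α → ℕ} (hf : IsPolyTime f) : IsPolyTime fun a => trapCols (f a) := by
  unfold _root_.trapCols
  fun_prop

@[fun_prop]
theorem dim {f : α → ℕ} (hf : IsPolyTime f) : IsPolyTime fun a => dim (f a) := by
  unfold _root_.dim
  fun_prop

end IsPolyTime

/-! ### Growth of the parameters -/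

theorem modulus_pos (n : ℕ) : 0 < modulus n := Nat.pos_of_ne_zero (NeZero.ne _)

theorem modulus_of_pos {n : ℕ} (hn : 0 < n) : modulus n = n ^ 3 :=
  max_eq_right (Nat.one_le_pow _ _ hn)

theorem modulus_le (n : ℕ) : modulus n ≤ n ^ 3 + 1 := by
  unfold modulus; omega

theorem modulus_le_two_pow (n : ℕ) : modulus n ≤ 2 ^ (3 * n) := by
  rcases n.eq_zero_or_pos with rfl | hn
  · simp [modulus]
  · rw [modulus_of_pos hn, mul_comm, pow_mul]
    exact Nat.pow_le_pow_left Nat.lt_two_pow_self.le 3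

theorem modulus_le_two_pow_clog (n : ℕ) : modulus n ≤ 2 ^ Nat.clog 2 (modulus n) :=
  Nat.le_pow_clog one_lt_two _

theorem dim_le (n : ℕ) : dim n ≤ 3 * n ^ 2 + 2 * n := by
  have : Nat.clog 2 (modulus n) ≤ 3 * n :=
    (Nat.clog_le_iff_le_pow one_lt_two).2 (modulus_le_two_pow n)
  unfold dim trapCols
  nlinarith

/-- For large `n` the modulus `n³` exceeds `2 m²`, as `m = O(n log n)`. -/
theorem eventually_two_mul_dim_sq_lt : ∀ᶠ n : ℕ in atTop, 2 * (dim n) ^ 2 < modulus n := by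
  have h1 : ∀ᶠ n : ℕ in atTop, Real.log n ^ 2 ≤ 1 / 200 * (n : ℝ) := by
    have := (Real.isLittleO_pow_log_id_atTop (n := 2)).bound (c := 1 / 200) (by norm_num)
    filter_upwards [tendsto_natCast_atTop_atTop.eventually this] with n hn
    simpa using hn
  have h2 : ∀ᶠ n : ℕ in atTop, 1 ≤ Real.log n :=
    (Real.tendsto_log_atTop.comp tendsto_natCast_atTop_atTop).eventually_ge_atTop 1
  filter_upwards [h1, h2, eventually_gt_atTop 0] with n h1 h2 hn
  have hL : (Nat.clog 2 (modulus n) : ℝ) ≤ 5 * Real.log n + 1 := by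
    rw [modulus_of_pos hn, ← Real.natCeil_logb_natCast]
    have hlog : Real.logb 2 ((n ^ 3 : ℕ) : ℝ) ≤ 5 * Real.log n := by
      rw [Nat.cast_pow, Real.logb, Real.log_pow, div_le_iff₀ (Real.log_pos one_lt_two)]
      have := Real.log_two_gt_d9
      push_cast
      nlinarith
    have h0 : 0 ≤ Real.logb 2 ((n ^ 3 : ℕ) : ℝ) :=
      Real.logb_nonneg one_lt_two (by exact_mod_cast Nat.one_le_pow _ _ hn)
    exact (Nat.ceil_lt_add_one (by exact_mod_cast h0)).le.trans (by exact_mod_cast by linarith)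
  have hn' : (0 : ℝ) < n := by exact_mod_cast hn
  have : 2 * ((dim n : ℕ) : ℝ) ^ 2 < (n : ℝ) ^ 3 := by
    unfold dim trapCols
    push_cast
    set L : ℝ := (Nat.clog 2 (modulus n) : ℝ) with hLdef
    have hL0 : 0 ≤ L := by positivity
    have : (L + 2) ^ 2 ≤ (8 * Real.log n) ^ 2 := by gcongr; linarith
    have h3 : 2 * (L + 2) ^ 2 < n := by nlinarith
    calc 2 * (n * L + 2 * n) ^ 2 = (n : ℝ) ^ 2 * (2 * (L + 2) ^ 2) := by ring
      _ < (n : ℝ) ^ 2 * n := by gcongr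
      _ = _ := by ring
  rw [modulus_of_pos hn]
  exact_mod_cast this

/-! ### The trapdoor classifier -/

/-- Sums of products of representatives compute matrix products modulo `q`. -/
theorem ZMod.val_sum_mul {q m : ℕ} [NeZero q] (a b : Fin m → ZMod q) (a' b' : ℕ → ℕ)
    (ha : ∀ i : Fin m, a' i = (a i).val) (hb : ∀ i : Fin m, b' i = (b i).val) :
    (∑ i ∈ Finset.range m, a' i * b' i) % q = (∑ i, a i * b i).val := by
  rw [← ZMod.val_natCast, Finset.sum_range]
  congr 1
  push_cast
  exact Finset.sum_congr rfl fun i _ => by rw [ha, hb]; simp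

/-- Entry `j` of `yᵀT mod q`, as a computation with numbers. -/
def trapdoorEntry (n : ℕ) (T y : Data) (j : ℕ) : ℕ :=
  (∑ i ∈ Finset.range (dim n), y.ent i * (T.nth i).ent j) % modulus n

/-- The trapdoor classifier as a computation with numbers. -/
def trapdoorLabel (n : ℕ) (T y : Data) : Bool :=
  !decide ((∑ j ∈ Finset.range (trapCols n),
    if modulus n < 4 * min (trapdoorEntry n T y j) (modulus n - trapdoorEntry n T y j)
    then 1 else 0) = 0)

theorem isPolyTime_trapdoorLabel :
    IsPolyTime fun d : ℕ × Data × Data => trapdoorLabel d.1 d.2.1 d.2.2 := by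
  unfold trapdoorLabel trapdoorEntry
  fun_prop

theorem trapdoorEntry_eq {n : ℕ} (T : TrapdoorMatrix n) (y : Vec n) (j : Fin (trapCols n)) :
    trapdoorEntry n (.ofMat T) (.ofVec y) j = (Matrix.vecMul y T j).val :=
  ZMod.val_sum_mul y (fun i => T i j) _ _ (by simp) (by simp)

theorem trapdoorLabel_eq (n : ℕ) (T : TrapdoorMatrix n) (y : Vec n) :
    trapdoorLabel n (.ofMat T) (.ofVec y) = trapdoorClassifier T y := by
  unfold trapdoorLabel trapdoorClassifier
  congr 2
  rw [Finset.sum_range, Finset.sum_eq_zero_iff, eq_iff_iff]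
  refine forall_congr' fun j => ?_
  rw [trapdoorEntry_eq, ZMod.valMinAbs_natAbs_eq_min]
  simp

theorem exists_prog_trapdoorClassifier : ∃ R : Prog, R.PolyTime ∧
    ∀ (n : ℕ) (T : TrapdoorMatrix n) (y : Vec n),
      R.eval (.pair (.num n) (.pair (.ofMat T) (.ofVec y))) = .ofBool (trapdoorClassifier T y) := by
  obtain ⟨p, hp, hp'⟩ := isPolyTime_trapdoorLabel
  exact ⟨p, hp, fun n T y => by rw [← trapdoorLabel_eq]; exact hp' _⟩

/-! ### Robustness of the trapdoor classifier -/

namespace ZMod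

/-- The absolute value of the representative of least absolute value. -/
def absMin {q : ℕ} (z : ZMod q) : ℕ := z.valMinAbs.natAbs

variable {q : ℕ}

theorem absMin_add_le (a b : ZMod q) : absMin (a + b) ≤ absMin a + absMin b :=
  (natAbs_valMinAbs_add_le a b).trans (Int.natAbs_add_le _ _)

theorem absMin_sum_le {ι : Type*} (s : Finset ι) (f : ι → ZMod q) :
    absMin (∑ i ∈ s, f i) ≤ ∑ i ∈ s, absMin (f i) :=
  Finset.le_sum_of_subadditive absMin (by simp [absMin]) absMin_add_le s f

theorem absMin_sub_comm (a b : ZMod q) : absMin (a - b) = absMin (b - a) := by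
  rw [← neg_sub, absMin, natAbs_valMinAbs_neg, absMin]

/-- An odd multiple of `⌊q/2⌋` is far from zero. -/
theorem le_absMin_half_mul_odd [NeZero q] {v : ℕ} (hv : v ≤ q / 2) :
    2 * q ≤ 4 * absMin (((q / 2 : ℕ) : ZMod q) * ((2 * v + 1 : ℕ) : ZMod q)) + 4 * v + 2 := by
  obtain ⟨v', hv', h⟩ : ∃ v' ≤ q / 2, 2 * q ≤ 4 * (q / 2 - v') + 4 * v + 2 ∧
      ((q / 2 : ℕ) : ZMod q) * ((2 * v + 1 : ℕ) : ZMod q) = ((q / 2 - v' : ℕ) : ZMod q) := by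
    obtain ⟨k, hk⟩ | ⟨k, hk⟩ := q.even_or_odd
    · refine ⟨0, by omega, by omega, ?_⟩
      have e : q / 2 * (2 * v + 1) = q * v + q / 2 := by
        rw [show q / 2 = k by omega]; rw [hk]; ring
      rw [← Nat.cast_mul, e]
      simp
    · refine ⟨v, hv, by omega, ?_⟩
      have e : q / 2 * (2 * v + 1) = q * v + (q / 2 - v) := by
        rw [show q / 2 = k by omega] at hv ⊢
        rw [hk]
        obtain ⟨c, rfl⟩ := Nat.exists_eq_add_of_le hv
        rw [Nat.add_sub_cancel_left]; ring
      rw [← Nat.cast_mul, e]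
      simp
  rw [h.2, absMin, valMinAbs_natCast_of_le_half (by omega), Int.natAbs_natCast]
  exact h.1

end ZMod

theorem prob_eq_one {α : Type} {p : PMF α} {S : Set α} (h : p.support ⊆ S) : prob p S = 1 := by
  rw [prob, (p.toOuterMeasure_apply_eq_one_iff S).2 h, ENNReal.toReal_one]

theorem mem_support_classDist {n : ℕ} {A : LatticeMatrix n} {b : Bool} {x : Vec n} :
    x ∈ (classDist A b).support ↔ ∃ s, Matrix.vecMul s A +
      (if b then (fun _ => ((modulus n / 2 : ℕ) : ZMod (modulus n))) else 0 : Vec n) = x := by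
  simp [classDist]

open ZMod in
/-- Small perturbations change the entries of `yᵀT` by a small amount. -/
theorem absMin_vecMul_le {n : ℕ} {T : TrapdoorMatrix n} (hT : ∀ i j, T i j = 0 ∨ T i j = 1)
    (e : Vec n) {d : ℕ} (he : ∀ i, absMin (e i) ≤ d) (j) :
    absMin (Matrix.vecMul e T j) ≤ (Finset.univ.filter fun i => T i j = 1).card * d := by
  rw [Matrix.vecMul, dotProduct, Finset.card_eq_sum_ones, Finset.sum_mul, Finset.sum_filter]
  refine (absMin_sum_le _ _).trans (Finset.sum_le_sum fun i _ => ?_)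
  split_ifs with h
  · simpa [h] using he i
  · simp [(hT i j).resolve_right h, absMin]

open ZMod in
theorem trapdoorClassifier_of_linfDist_le {n : ℕ} {A : LatticeMatrix n} {T : TrapdoorMatrix n}
    (hAT : A * T = 0) (hT : ∀ i j, T i j = 0 ∨ T i j = 1)
    (hodd : ∃ j, Odd (Finset.univ.filter fun i => T i j = 1).card ∧ ∃ i, T i j = 0)
    (hm : 2 * dim n ^ 2 < modulus n) {b : Bool} {x y : Vec n}
    (hx : x ∈ (classDist A b).support) (hxy : 4 * dim n * linfDist x y ≤ modulus n) :
    trapdoorClassifier T y = b := by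
  obtain ⟨s, rfl⟩ := mem_support_classDist.1 hx
  set c : Vec n := if b then (fun _ => ((modulus n / 2 : ℕ) : ZMod (modulus n))) else 0 with hc
  set x := Matrix.vecMul s A + c with hxdef
  set d := linfDist x y with hd
  have he : ∀ i, absMin ((y - x) i) ≤ d := fun i => by
    rw [Pi.sub_apply, absMin_sub_comm]
    exact Finset.le_sup (f := fun i => (x i - y i).valMinAbs.natAbs) (Finset.mem_univ i)
  have he' := absMin_vecMul_le hT _ he
  have hxT : Matrix.vecMul x T = Matrix.vecMul c T := by
    rw [hxdef, Matrix.add_vecMul, Matrix.vecMul_vecMul, hAT, Matrix.vecMul_zero, zero_add]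
  have hyT : ∀ j, Matrix.vecMul y T j = Matrix.vecMul (y - x) T j + Matrix.vecMul c T j := by
    intro j
    rw [← hxT, Matrix.sub_vecMul]; simp
  unfold trapdoorClassifier
  cases b with
  | false =>
    simp only [Bool.not_eq_false', decide_eq_true_eq]
    intro j
    have h0 : Matrix.vecMul c T j = 0 := by simp [hc]
    rw [hyT, h0, add_zero]
    have hw := (Finset.card_filter_le (Finset.univ : Finset (Fin (dim n)))
      fun i => T i j = 1).trans_eq (Finset.card_fin _)
    calc 4 * absMin (Matrix.vecMul (y - x) T j) ≤ 4 * (dim n * d) :=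
          Nat.mul_le_mul_left _ ((he' j).trans (Nat.mul_le_mul_right _ hw))
      _ = 4 * dim n * d := by ring
      _ ≤ _ := hxy
  | true =>
    simp only [Bool.not_eq_true', decide_eq_false_iff_not, not_forall]
    obtain ⟨j, hj, i₀, hi₀⟩ := hodd
    have h01 : Fact (1 < modulus n) := ⟨by
      have : 0 < dim n := i₀.pos
      nlinarith⟩
    refine ⟨j, ?_⟩
    have hj' := he' j
    have hw : (Finset.univ.filter fun i => T i j = 1).card < dim n := by
      refine (Finset.card_lt_univ_of_notMem (x := i₀) ?_).trans_eq (Fintype.card_fin _)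
      simp [hi₀]
    have hcT : Matrix.vecMul c T j = ((modulus n / 2 : ℕ) : ZMod (modulus n)) *
        (((Finset.univ.filter fun i => T i j = 1).card : ℕ) : ZMod (modulus n)) := by
      rw [Matrix.vecMul, dotProduct, Finset.card_filter, Nat.cast_sum, Finset.mul_sum]
      refine Finset.sum_congr rfl fun i _ => ?_
      rcases hT i j with h | h <;> simp [hc, h]
    obtain ⟨v, hv⟩ := hj
    rw [hv] at hcT hj' hw
    have hvq : v ≤ modulus n / 2 := by
      have := Nat.le_self_pow two_ne_zero (dim n)
      omega
    have h1 := le_absMin_half_mul_odd hvq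
    have h2 : absMin (Matrix.vecMul c T j) ≤
        absMin (Matrix.vecMul y T j) + (2 * v + 1) * d := by
      have : Matrix.vecMul c T j = Matrix.vecMul y T j + -Matrix.vecMul (y - x) T j := by
        rw [hyT]; ring
      rw [this]
      refine (absMin_add_le _ _).trans (Nat.add_le_add_left ?_ _)
      rwa [absMin, natAbs_valMinAbs_neg]
    rw [← hcT] at h1
    rw [not_le]
    change modulus n < 4 * absMin _
    -- With `w = 2v + 1 < m`, the perturbation contributes `4wd ≤ (m - 1) q / m`.
    have h3 : dim n * (4 * ((2 * v + 1) * d) + 2 * (2 * v + 1)) < dim n * modulus n := by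
      have e1 : dim n * (4 * ((2 * v + 1) * d)) ≤ (2 * v + 1) * modulus n := by
        calc _ = (2 * v + 1) * (4 * dim n * d) := by ring
          _ ≤ _ := Nat.mul_le_mul_left _ hxy
      have e2 : (2 * v + 1) * modulus n + modulus n ≤ dim n * modulus n := by
        calc _ = (2 * v + 1 + 1) * modulus n := by ring
          _ ≤ _ := Nat.mul_le_mul_right _ hw
      nlinarith
    have h4 := Nat.lt_of_mul_lt_mul_left h3
    omega

theorem eventually_isRobust {TS : (n : ℕ) → PMF (LatticeMatrix n × TrapdoorMatrix n)}
    (hTS : IsTrapdoorSampler TS) : ∀ᶠ n : ℕ in atTop, ∀ z ∈ (TS n).support,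
      IsRobust (classDist z.1) ((modulus n : ℝ) / (4 * dim n)) (trapdoorClassifier z.2) := by
  filter_upwards [hTS.odd_column, eventually_two_mul_dim_sq_lt] with n hodd hm z hz b
  rw [prob_eq_one]
  · norm_num
  · intro x hx y hxy
    refine trapdoorClassifier_of_linfDist_le (hTS.mul_eq_zero n z hz) (hTS.zero_one n z hz)
      (hodd z hz) hm hx ?_
    obtain ⟨j, -, i, -⟩ := hodd z hz
    have hd : (0 : ℝ) < 4 * dim n := by
      have : 0 < dim n := i.pos
      positivity
    rw [le_div_iff₀ hd] at hxy
    have : (4 * dim n * linfDist x y : ℝ) ≤ modulus n := by linarith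
    exact_mod_cast this

/-! ### Probabilities and statistical distance -/

section

variable {α β γ : Type}

theorem PMF.sum_toReal [Fintype α] (p : PMF α) : ∑ a, (p a).toReal = 1 := by
  rw [← ENNReal.toReal_sum fun a _ => p.apply_ne_top a, ← tsum_fintype (L := .unconditional α),
    p.tsum_coe, ENNReal.toReal_one]

theorem prob_nonneg (p : PMF α) (S : Set α) : 0 ≤ prob p S := ENNReal.toReal_nonneg

theorem toOuterMeasure_le_one (p : PMF α) (S : Set α) : p.toOuterMeasure S ≤ 1 := by
  rw [p.toOuterMeasure_apply]
  exact (ENNReal.tsum_le_tsum fun a => Set.indicator_le_self _ _ a).trans p.tsum_coe.le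

theorem prob_le_one (p : PMF α) (S : Set α) : prob p S ≤ 1 :=
  ENNReal.toReal_mono ENNReal.one_ne_top (toOuterMeasure_le_one p S)

theorem prob_map (p : PMF α) (f : α → β) (S : Set β) : prob (p.map f) S = prob p (f ⁻¹' S) := by
  rw [prob, prob, PMF.toOuterMeasure_map_apply]

theorem prob_pure (a : α) (S : Set α) [Decidable (a ∈ S)] :
    prob (PMF.pure a) S = if a ∈ S then 1 else 0 := by
  rw [prob, PMF.toOuterMeasure_pure_apply]; split_ifs <;> simp

theorem prob_bind [Fintype α] (p : PMF α) (g : α → PMF β) (S : Set β) :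
    prob (p.bind g) S = ∑ a, (p a).toReal * prob (g a) S := by
  rw [prob, PMF.toOuterMeasure_bind_apply, tsum_fintype, ENNReal.toReal_sum]
  · simp [prob, ENNReal.toReal_mul]
  · exact fun a _ => ENNReal.mul_ne_top (p.apply_ne_top a)
      (ne_top_of_le_ne_top ENNReal.one_ne_top (toOuterMeasure_le_one _ _))

theorem prob_eq_sum [Fintype α] (p : PMF α) (S : Set α) [DecidablePred (· ∈ S)] :
    prob p S = ∑ a, if a ∈ S then (p a).toReal else 0 := by
  have := prob_bind p PMF.pure S
  rw [PMF.bind_pure] at this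
  rw [this]
  exact Finset.sum_congr rfl fun a _ => by rw [prob_pure]; split_ifs <;> simp

theorem prob_uniform_bind [Fintype α] [Nonempty α] (g : α → PMF β) (S : Set β) :
    prob ((PMF.uniformOfFintype α).bind g) S = (Fintype.card α : ℝ)⁻¹ * ∑ a, prob (g a) S := by
  rw [prob_bind, Finset.mul_sum]
  simp

theorem prob_bind_mono [Fintype α] {p : PMF α} {g : α → PMF β} {g' : α → PMF γ}
    {S : Set β} {S' : Set γ}
    (h : ∀ a ∈ p.support, prob (g a) S ≤ prob (g' a) S') :
    prob (p.bind g) S ≤ prob (p.bind g') S' := by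
  rw [prob_bind, prob_bind]
  refine Finset.sum_le_sum fun a _ => ?_
  by_cases ha : a ∈ p.support
  · exact mul_le_mul_of_nonneg_left (h a ha) ENNReal.toReal_nonneg
  · rw [PMF.mem_support_iff, not_not] at ha
    simp [ha]

theorem le_prob_bind [Fintype α] {p : PMF α} {g : α → PMF β} {S : Set β} {c : ℝ}
    (h : ∀ a ∈ p.support, c ≤ prob (g a) S) : c ≤ prob (p.bind g) S := by
  rw [prob_bind, ← mul_one c, ← p.sum_toReal, Finset.mul_sum]
  refine Finset.sum_le_sum fun a _ => ?_
  by_cases ha : a ∈ p.support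
  · rw [mul_comm]
    exact mul_le_mul_of_nonneg_left (h a ha) ENNReal.toReal_nonneg
  · rw [PMF.mem_support_iff, not_not] at ha
    simp [ha]

theorem prob_bind_le [Fintype α] {p : PMF α} {g : α → PMF β} {S : Set β} {c : ℝ}
    (h : ∀ a, prob (g a) S ≤ c) : prob (p.bind g) S ≤ c := by
  rw [prob_bind, ← mul_one c, ← p.sum_toReal, Finset.mul_sum]
  refine Finset.sum_le_sum fun a _ => ?_
  rw [mul_comm c]
  exact mul_le_mul_of_nonneg_left (h a) ENNReal.toReal_nonneg

variable [Fintype α]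

theorem statDist_comm (p p' : PMF α) : statDist p p' = statDist p' p := by
  simp only [statDist, abs_sub_comm]

theorem statDist_triangle (p p' p'' : PMF α) :
    statDist p p'' ≤ statDist p p' + statDist p' p'' := by
  rw [statDist, statDist, statDist, ← mul_add, ← Finset.sum_add_distrib]
  gcongr
  exact abs_sub_le _ _ _

/-- The statistical distance as a sum of positive parts. -/
theorem statDist_eq_sum_max (p p' : PMF α) :
    statDist p p' = ∑ a, max ((p a).toReal - (p' a).toReal) 0 := by
  have h : ∑ a, ((p a).toReal - (p' a).toReal) = 0 := by
    rw [Finset.sum_sub_distrib, p.sum_toReal, p'.sum_toReal, sub_self]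
  have h2 : ∀ x : ℝ, max x 0 = 2⁻¹ * |x| + 2⁻¹ * x := fun x => by
    rcases le_total 0 x with hx | hx
    · rw [max_eq_left hx, abs_of_nonneg hx]; ring
    · rw [max_eq_right hx, abs_of_nonpos hx]; ring
  simp only [h2, Finset.sum_add_distrib, ← Finset.mul_sum, h, statDist, mul_zero, add_zero]

/-- The statistical distance bounds the difference of expectations of functions with values in
`[0, 1]`. -/
theorem sum_mul_le_add_statDist (p p' : PMF α) {f : α → ℝ} (h0 : ∀ a, 0 ≤ f a)
    (h1 : ∀ a, f a ≤ 1) :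
    ∑ a, (p a).toReal * f a ≤ ∑ a, (p' a).toReal * f a + statDist p p' := by
  rw [statDist_eq_sum_max, ← Finset.sum_add_distrib]
  refine Finset.sum_le_sum fun a _ => ?_
  have : ((p a).toReal - (p' a).toReal) * f a ≤ max ((p a).toReal - (p' a).toReal) 0 :=
    calc _ ≤ max ((p a).toReal - (p' a).toReal) 0 * f a :=
          mul_le_mul_of_nonneg_right (le_max_left _ _) (h0 a)
      _ ≤ _ := mul_le_of_le_one_right (le_max_right _ _) (h1 a)
  linarith

theorem prob_bind_le_add_statDist (p p' : PMF α) (g : α → PMF β) (S : Set β) :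
    prob (p.bind g) S ≤ prob (p'.bind g) S + statDist p p' := by
  rw [prob_bind, prob_bind]
  exact sum_mul_le_add_statDist p p' (fun a => prob_nonneg _ _) fun a => prob_le_one _ _

/-- Data processing: a randomized map does not increase the statistical distance. -/
theorem statDist_bind_le [Fintype β] (p p' : PMF α) (g : α → PMF β) :
    statDist (p.bind g) (p'.bind g) ≤ statDist p p' := by
  have key : ∀ (p : PMF α) b, (p.bind g b).toReal = ∑ a, (p a).toReal * (g a b).toReal := by
    intro p b
    rw [PMF.bind_apply, tsum_fintype, ENNReal.toReal_sum]
    · simp [ENNReal.toReal_mul]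
    · exact fun a _ => ENNReal.mul_ne_top (p.apply_ne_top a) ((g a).apply_ne_top b)
  rw [statDist, statDist]
  gcongr
  calc ∑ b, |(p.bind g b).toReal - (p'.bind g b).toReal|
      = ∑ b, |∑ a, ((p a).toReal - (p' a).toReal) * (g a b).toReal| := by
        simp only [key, ← Finset.sum_sub_distrib, sub_mul]
    _ ≤ ∑ b, ∑ a, |(p a).toReal - (p' a).toReal| * (g a b).toReal :=
        Finset.sum_le_sum fun b _ => (Finset.abs_sum_le_sum_abs _ _).trans_eq <|
          Finset.sum_congr rfl fun a _ => by
            rw [abs_mul, abs_of_nonneg (ENNReal.toReal_nonneg (a := g a b))]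
    _ = ∑ a, |(p a).toReal - (p' a).toReal| := by
        rw [Finset.sum_comm]
        exact Finset.sum_congr rfl fun a _ => by
          rw [← Finset.mul_sum, PMF.sum_toReal, mul_one]

theorem statDist_map_le [Fintype β] (p p' : PMF α) (f : α → β) :
    statDist (p.map f) (p'.map f) ≤ statDist p p' :=
  statDist_bind_le p p' _

/-- If `p'` has almost the density `1` with respect to `p`, then the two are close. -/
theorem statDist_le_of_mul_le {p p' : PMF α} {ε : ℝ} (hε : 0 ≤ ε)
    (h : ∀ a, (1 - ε) * (p a).toReal ≤ (p' a).toReal) : statDist p p' ≤ ε := by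
  rw [statDist_eq_sum_max]
  calc ∑ a, max ((p a).toReal - (p' a).toReal) 0 ≤ ∑ a, ε * (p a).toReal :=
        Finset.sum_le_sum fun a _ =>
          max_le (by linarith [h a]) (mul_nonneg hε ENNReal.toReal_nonneg)
    _ = ε := by rw [← Finset.mul_sum, p.sum_toReal, mul_one]

end

/-! ### Uniform distributions and independent samples -/

section

variable {α β : Type}

theorem uniformOfFintype_toReal [Fintype α] [Nonempty α] (a : α) :
    (PMF.uniformOfFintype α a).toReal = (Fintype.card α : ℝ)⁻¹ := by simp

theorem map_uniform_apply [Fintype α] [Nonempty α] [DecidableEq β] (f : α → β) (b : β) :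
    (PMF.uniformOfFintype α).map f b =
      (Finset.univ.filter fun a => f a = b).card * (Fintype.card α : ENNReal)⁻¹ := by
  rw [PMF.map_apply, tsum_fintype, Finset.card_filter]
  simp only [PMF.uniformOfFintype_apply, eq_comm (a := b), Nat.cast_sum, Finset.sum_mul]
  exact Finset.sum_congr rfl fun a _ => by split_ifs <;> simp

theorem map_uniform_toReal [Fintype α] [Nonempty α] [DecidableEq β] (f : α → β) (b : β) :
    ((PMF.uniformOfFintype α).map f b).toReal =
      (Finset.univ.filter fun a => f a = b).card / (Fintype.card α : ℝ) := by
  rw [map_uniform_apply, ENNReal.toReal_mul, ENNReal.toReal_inv, ENNReal.toReal_natCast,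
    ENNReal.toReal_natCast, div_eq_mul_inv]

/-- A map whose nonempty fibers have equal size takes the uniform distribution to the uniform
distribution on its range. -/
theorem map_uniform_eq_uniformOfFinset [Fintype α] [Nonempty α] [DecidableEq β] (f : α → β)
    (s : Finset β) (hs : s.Nonempty) (hf : ∀ a, f a ∈ s) (c : ℕ)
    (hc : ∀ b ∈ s, (Finset.univ.filter fun a => f a = b).card = c) :
    (PMF.uniformOfFintype α).map f = PMF.uniformOfFinset s hs := by
  ext b
  rw [map_uniform_apply]
  by_cases hb : b ∈ s
  · rw [PMF.uniformOfFinset_apply_of_mem hs hb, hc b hb]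
    have hcard : Fintype.card α = s.card * c := by
      rw [← Finset.card_univ, Finset.card_eq_sum_card_fiberwise fun a _ => hf a,
        Finset.sum_congr rfl hc, Finset.sum_const, smul_eq_mul]
    have hne : s.card * c ≠ 0 := hcard ▸ Fintype.card_ne_zero
    rw [hcard, Nat.cast_mul, ENNReal.mul_inv (by simp) (by simp), mul_comm, mul_assoc,
      ENNReal.inv_mul_cancel (by simpa using right_ne_zero_of_mul hne) (by simp), mul_one]
  · rw [PMF.uniformOfFinset_apply_of_notMem hs hb, Finset.filter_false_of_mem]
    · simp
    · exact fun a _ h => hb (h ▸ hf a)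

theorem map_uniform_eq_uniform [Fintype α] [Nonempty α] [Fintype β] [Nonempty β] [DecidableEq β]
    (f : α → β) (c : ℕ) (hc : ∀ b, (Finset.univ.filter fun a => f a = b).card = c) :
    (PMF.uniformOfFintype α).map f = PMF.uniformOfFintype β :=
  map_uniform_eq_uniformOfFinset f _ _ (fun _ => Finset.mem_univ _) c fun b _ => hc b

theorem map_uniform_of_bijective [Fintype α] [Nonempty α] [Fintype β] [Nonempty β]
    {f : α → β} (hf : f.Bijective) :
    (PMF.uniformOfFintype α).map f = PMF.uniformOfFintype β := by
  classical
  refine map_uniform_eq_uniform f 1 fun b => Finset.card_eq_one.2 ?_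
  obtain ⟨a, rfl⟩ := hf.2 b
  exact ⟨a, by ext; simp [hf.1.eq_iff]⟩

/-- Some coordinates of a uniform sequence are uniform. -/
theorem map_uniform_comp_injective {I J X : Type} [Fintype I] [Fintype J] [DecidableEq I]
    [DecidableEq J] [Fintype X] [DecidableEq X] [Nonempty X] {ι : I → J} (hι : ι.Injective) :
    (PMF.uniformOfFintype (J → X)).map (fun r => r ∘ ι) = PMF.uniformOfFintype (I → X) := by
  obtain ⟨x⟩ := ‹Nonempty X›
  refine map_uniform_eq_uniform _ _ fun u =>
    Finset.card_bij' (t := Finset.univ.filter fun r : J → X => r ∘ ι = fun _ => x)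
      (fun r _ => Function.extend ι (fun _ => x) r) (fun r _ => Function.extend ι u r)
      (by simp [Function.extend_comp hι]) (by simp [Function.extend_comp hι]) ?_ ?_
  all_goals
    intro r hr
    replace hr := (Finset.mem_filter.1 hr).2
    ext j
    by_cases hj : ∃ i, ι i = j
    · obtain ⟨i, rfl⟩ := hj
      rw [hι.extend_apply]; exact (congrFun hr i).symm
    · rw [Function.extend_apply' _ _ _ hj, Function.extend_apply' _ _ _ hj]

theorem uniform_prod [Fintype α] [Nonempty α] [Fintype β] [Nonempty β] :
    PMF.uniformOfFintype (α × β) =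
      (PMF.uniformOfFintype α).bind fun a => (PMF.uniformOfFintype β).map fun b => (a, b) := by
  classical
  ext ⟨a, b⟩
  rw [PMF.bind_apply, tsum_fintype, Finset.sum_eq_single a]
  · rw [PMF.map_apply, tsum_fintype, Finset.sum_eq_single b] <;>
      simp +contextual [ENNReal.mul_inv, eq_comm]
  · intro a' _ ha'
    rw [PMF.map_apply, tsum_fintype, Finset.sum_eq_zero]
    · simp
    · simp [ha'.symm]
  · simp

theorem uniform_prod_bind {γ : Type} [Fintype α] [Nonempty α] [Fintype β] [Nonempty β]
    (g : α × β → PMF γ) :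
    (PMF.uniformOfFintype (α × β)).bind g =
      (PMF.uniformOfFintype α).bind fun a => (PMF.uniformOfFintype β).bind fun b => g (a, b) := by
  rw [uniform_prod, PMF.bind_bind]
  simp only [PMF.bind_map, Function.comp_def]

theorem iid_apply [Fintype α] (p : PMF α) (k : ℕ) (v : Fin k → α) :
    iid p k v = ∏ i, p (v i) := by
  rw [iid, PMF.ofFintype_apply]

theorem iid_uniform [Fintype α] [Nonempty α] (k : ℕ) :
    iid (PMF.uniformOfFintype α) k = PMF.uniformOfFintype (Fin k → α) := by
  classical
  ext v
  rw [iid_apply]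
  simp [ENNReal.inv_pow]

theorem iid_map [Fintype α] [Fintype β] (p : PMF α) (f : α → β) (k : ℕ) :
    iid (p.map f) k = (iid p k).map fun v => f ∘ v := by
  classical
  ext w
  rw [iid_apply, PMF.map_apply, tsum_fintype]
  simp only [PMF.map_apply, tsum_fintype, iid_apply]
  rw [Finset.prod_univ_sum, Fintype.piFinset_univ]
  refine Finset.sum_congr rfl fun v _ => ?_
  by_cases h : w = f ∘ v
  · subst h; simp
  · rw [if_neg h]
    obtain ⟨i, hi⟩ := Function.ne_iff.1 h
    exact Finset.prod_eq_zero (Finset.mem_univ i) (if_neg hi)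

/-- Independent samples from distributions whose density is almost `1`. -/
theorem statDist_iid_le [Fintype α] {p p' : PMF α} {ε : ℝ} (hε : 0 ≤ ε) (hε1 : ε ≤ 1) (k : ℕ)
    (h : ∀ a, (1 - ε) * (p a).toReal ≤ (p' a).toReal) :
    statDist (iid p k) (iid p' k) ≤ k * ε := by
  refine statDist_le_of_mul_le (by positivity) fun v => ?_
  simp only [iid_apply, ENNReal.toReal_prod]
  calc (1 - k * ε) * ∏ i, (p (v i)).toReal ≤ (1 - ε) ^ k * ∏ i, (p (v i)).toReal := by
        gcongr
        have := one_add_mul_le_pow (show -2 ≤ -ε by linarith) k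
        rwa [mul_neg, ← sub_eq_add_neg, ← sub_eq_add_neg] at this
    _ = ∏ i, (1 - ε) * (p (v i)).toReal := by
        rw [Finset.prod_mul_distrib, Finset.prod_const, Finset.card_fin]
    _ ≤ _ := Finset.prod_le_prod
        (fun i _ => mul_nonneg (by linarith) ENNReal.toReal_nonneg) fun i _ => h _

/-- `D_b` is the law of `sᵀA + b ⌊q/2⌋ · 1ᵀ` for uniform `s`. -/
theorem classDist_eq_map {n : ℕ} (A : LatticeMatrix n) (b : Bool) :
    classDist A b = (PMF.uniformOfFintype (Fin n → ZMod (modulus n))).map fun s =>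
      Matrix.vecMul s A + (if b then (fun _ => ((modulus n / 2 : ℕ) : ZMod (modulus n))) else 0 :
        Vec n) := by
  refine (map_uniform_eq_uniformOfFinset _ _ _ (fun s => Finset.mem_image_of_mem _
    (Finset.mem_univ s)) (Finset.univ.filter fun s => Matrix.vecMul s A = 0).card ?_).symm
  intro x hx
  obtain ⟨s₀, -, rfl⟩ := Finset.mem_image.1 hx
  refine Finset.card_bij' (fun s _ => s - s₀) (fun s _ => s + s₀) ?_ ?_ ?_ ?_ <;>
    simp +contextual [Matrix.sub_vecMul, Matrix.add_vecMul]

end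

/-! ### Running a randomized algorithm on part of its coins -/

theorem PPT.run_eq (M : PPT) (n : ℕ) (x : Data) : M.run n x =
    (PMF.uniformOfFintype (Fin (M.coins.eval n) → Bool)).map fun r =>
      M.prog.eval (.pair x (.ofBits r)) := rfl

/-- A polynomial-time function of an input and a sequence of coin tosses. -/
theorem IsPolyTime.exists_ppt {α β : Type} [DataCoding α] [DataCoding β] {f : α × Data → β}
    (hf : IsPolyTime f) (P : Polynomial ℕ) : ∃ M : PPT, ∀ n a, M.run n (encode a) =
      (PMF.uniformOfFintype (Fin (P.eval n) → Bool)).map fun r => encode (f (a, .ofBits r)) := by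
  obtain ⟨p, hp, hp'⟩ := hf
  refine ⟨⟨p, P, hp⟩, fun n a => ?_⟩
  rw [PPT.run_eq]
  congr 1
  ext1 r
  rw [hp', show Data.pair (encode a) (.ofBits r) = encode (a, Data.ofBits r) from rfl,
    decode_encode]

theorem PPT.isPolyTime (M : PPT) : IsPolyTime M.prog.eval :=
  ⟨M.prog, M.polyTime, fun _ => rfl⟩

/-! ### Negligible functions -/

theorem Negligible.of_eventually_le {f g : ℕ → ℝ} (hg : Negligible g) (h0 : ∀ n, 0 ≤ f n)
    (h : ∀ᶠ n in atTop, f n ≤ g n) : Negligible f :=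
  Asymptotics.SuperpolynomialDecay.trans_eventuallyLE (.of_forall fun n => Nat.cast_nonneg n)
    (Asymptotics.superpolynomialDecay_zero _ _) hg (.of_forall h0) h

theorem Negligible.add {f g : ℕ → ℝ} (hf : Negligible f) (hg : Negligible g) :
    Negligible fun n => f n + g n :=
  Asymptotics.SuperpolynomialDecay.add hf hg

theorem negligible_pow {r : ℝ} (h0 : 0 ≤ r) (h1 : r < 1) : Negligible fun n => r ^ n := fun k =>
  tendsto_pow_const_mul_const_pow_of_abs_lt_one k (by rwa [abs_of_nonneg h0])

theorem Negligible.eval_mul {f : ℕ → ℝ} (hf : Negligible f) (P : Polynomial ℕ) :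
    Negligible fun n => (P.eval n : ℕ) * f n := by
  have := Asymptotics.SuperpolynomialDecay.polynomial_mul hf (P.map (Nat.castRingHom ℝ))
  refine this.congr fun n => ?_
  rw [Polynomial.eval_natCast_map]
  simp

theorem negligible_eval_mul_two_inv_pow (P : Polynomial ℕ) :
    Negligible fun n => (P.eval n : ℕ) * (2⁻¹ : ℝ) ^ n :=
  (negligible_pow (by norm_num) (by norm_num)).eval_mul P

/-- A polynomial bound for the dimension. -/
noncomputable def dimPoly : Polynomial ℕ := 3 * Polynomial.X ^ 2 + 2 * Polynomial.X

theorem dim_le_eval (n : ℕ) : dim n ≤ dimPoly.eval n := by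
  simpa [dimPoly] using dim_le n

/-! ### Binary numbers -/

/-- The number with given binary digits, the least significant one first. -/
def bitsVal {K : ℕ} (u : Fin K → Bool) : ℕ := ∑ i, (u i).toNat * 2 ^ (i : ℕ)

theorem bitsVal_eq_finFunctionFinEquiv {K : ℕ} (u : Fin K → Bool) :
    bitsVal u = finFunctionFinEquiv fun i => finTwoEquiv.symm (u i) := by
  rw [finFunctionFinEquiv_apply, bitsVal]
  exact Finset.sum_congr rfl fun i _ => by cases u i <;> rfl

theorem card_filter_bitsVal (K : ℕ) (P : ℕ → Prop) [DecidablePred P] :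
    (Finset.univ.filter fun u : Fin K → Bool => P (bitsVal u)).card =
      ((Finset.range (2 ^ K)).filter P).card := by
  refine Finset.card_nbij bitsVal ?_ ?_ ?_
  · intro u hu
    rw [Finset.mem_coe, Finset.mem_filter] at hu ⊢
    refine ⟨Finset.mem_range.2 ?_, hu.2⟩
    rw [bitsVal_eq_finFunctionFinEquiv]
    exact Fin.is_lt _
  · intro u _ v _ huv
    rw [bitsVal_eq_finFunctionFinEquiv, bitsVal_eq_finFunctionFinEquiv, Fin.val_inj,
      EmbeddingLike.apply_eq_iff_eq] at huv
    ext1 i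
    simpa using congrFun huv i
  · intro x hx
    rw [Finset.mem_coe, Finset.mem_filter, Finset.mem_range] at hx
    obtain ⟨f, hf⟩ := finFunctionFinEquiv.surjective (⟨x, hx.1⟩ : Fin (2 ^ K))
    have : bitsVal (fun i => finTwoEquiv (f i)) = x := by
      simp [bitsVal_eq_finFunctionFinEquiv, hf]
    exact ⟨fun i => finTwoEquiv (f i), by simp [this, hx.2], this⟩

/-- Comparison of two binary numbers, digit by digit; the result is `1` for `<` and `0` for
`≥`. -/
def lessBits (a b : ℕ → ℕ) (K : ℕ) : ℕ :=
  loopFrom 0 (fun i s => if a i < b i then 1 else if b i < a i then 0 else s) K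

theorem lessBits_eq {a b : ℕ → ℕ} {K : ℕ} (ha : ∀ i < K, a i ≤ 1) (hb : ∀ i < K, b i ≤ 1) :
    lessBits a b K = if ∑ i ∈ Finset.range K, a i * 2 ^ i < ∑ i ∈ Finset.range K, b i * 2 ^ i
      then 1 else 0 := by
  have hlt : ∀ {c : ℕ → ℕ} (K : ℕ), (∀ i < K, c i ≤ 1) →
      ∑ i ∈ Finset.range K, c i * 2 ^ i < 2 ^ K := by
    intro c K
    induction K with
    | zero => simp
    | succ K ih =>
      intro hc
      have h1 := ih fun i hi => hc i (by omega)
      have h2 := Nat.mul_le_mul_right (2 ^ K) (hc K (by omega))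
      rw [Finset.sum_range_succ, pow_succ]
      omega
  induction K with
  | zero => rfl
  | succ K ih =>
    have ih := ih (fun i hi => ha i (by omega)) fun i hi => hb i (by omega)
    have h1 := hlt K fun i hi => ha i (by omega)
    have h2 := hlt K fun i hi => hb i (by omega)
    have h3 := ha K (by omega)
    have h4 := hb K (by omega)
    rw [lessBits] at ih ⊢
    rw [loopFrom, ih, Finset.sum_range_succ, Finset.sum_range_succ]
    interval_cases a K <;> interval_cases b K <;> simp <;> omega

/-- Powers of two, reduced modulo `q`. -/
def twoPowMod (n i : ℕ) : ℕ := 2 ^ i % modulus n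

theorem twoPowMod_eq (n i : ℕ) :
    twoPowMod n i = loopFrom (1 % modulus n) (fun _ s => 2 * s % modulus n) i := by
  induction i with
  | zero => rfl
  | succ i ih => rw [loopFrom, ← ih, twoPowMod, twoPowMod, Nat.mul_mod_mod, pow_succ']

/-- A binary number, reduced modulo `q`. -/
def residue (n : ℕ) (a : ℕ → ℕ) (K : ℕ) : ℕ :=
  (∑ i ∈ Finset.range K, a i * twoPowMod n i) % modulus n

theorem residue_eq {n K : ℕ} {a : ℕ → ℕ} {u : Fin K → Bool} (h : ∀ i : Fin K, a i = (u i).toNat) :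
    residue n a K = ((bitsVal u : ℕ) : ZMod (modulus n)).val := by
  rw [residue, ← ZMod.val_natCast, Finset.sum_range, bitsVal]
  congr 1
  push_cast
  exact Finset.sum_congr rfl fun i _ => by simp [h, twoPowMod]

namespace IsPolyTime

variable {α : Type} [DataCoding α]

@[fun_prop]
theorem lessBits {a b : α → ℕ → ℕ} {K : α → ℕ} (ha : IsPolyTime fun z : α × ℕ => a z.1 z.2)
    (hb : IsPolyTime fun z : α × ℕ => b z.1 z.2) (hK : IsPolyTime K) :
    IsPolyTime fun x => lessBits (a x) (b x) (K x) := by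
  have ha' := ha.comp (f := fun z : α × ℕ × ℕ => (z.1, z.2.1)) (by fun_prop)
  have hb' := hb.comp (f := fun z : α × ℕ × ℕ => (z.1, z.2.1)) (by fun_prop)
  refine loopFrom_of_le_max hK (const 0) (by fun_prop) (.const 2) fun x i s => ?_
  split_ifs
  · exact le_max_right _ _
  · exact le_max_of_le_right (by simp)
  · exact le_max_left _ _

@[fun_prop]
theorem twoPowMod {n i : α → ℕ} (hn : IsPolyTime n) (hi : IsPolyTime i) :
    IsPolyTime fun x => twoPowMod (n x) (i x) := by
  simp only [twoPowMod_eq]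
  refine loopFrom_of_le_max hi (by fun_prop) (by fun_prop)
    (b := fun x => _root_.modulus (n x)) (IsPolyTime.le (by fun_prop)) fun x i s => ?_
  exact le_max_of_le_right (Nat.mod_lt _ (modulus_pos _))

@[fun_prop]
theorem residue {n : α → ℕ} {a : α → ℕ → ℕ} {K : α → ℕ} (hn : IsPolyTime n)
    (ha : IsPolyTime fun z : α × ℕ => a z.1 z.2) (hK : IsPolyTime K) :
    IsPolyTime fun x => residue (n x) (a x) (K x) := by
  unfold _root_.residue
  fun_prop

end IsPolyTime

/-! ### Sampling with fair coins -/

/-- The number of coin tosses spent on a sample from `ℤ/q`: `2 ^ sampleBits n ≥ 2 ^ n q`. -/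
def sampleBits (n : ℕ) : ℕ := 4 * n

theorem modulus_le_two_inv_pow_mul (n : ℕ) :
    (modulus n : ℝ) ≤ (2⁻¹ : ℝ) ^ n * 2 ^ sampleBits n := by
  have h : (modulus n : ℝ) ≤ 2 ^ (3 * n) := by exact_mod_cast modulus_le_two_pow n
  refine h.trans_eq ?_
  rw [sampleBits, show 4 * n = n + 3 * n by ring, pow_add, inv_pow, inv_mul_cancel_left₀]
  positivity

/-- A long binary number, reduced modulo `q`, is almost uniform. -/
theorem mul_uniform_le_map_bitsVal (n : ℕ) (z : ZMod (modulus n)) :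
    (1 - (2⁻¹ : ℝ) ^ n) * (PMF.uniformOfFintype (ZMod (modulus n)) z).toReal ≤
      ((PMF.uniformOfFintype (Fin (sampleBits n) → Bool)).map
        (fun u => ((bitsVal u : ℕ) : ZMod (modulus n))) z).toReal := by
  rw [map_uniform_toReal, uniformOfFintype_toReal, ZMod.card]
  have hq := modulus_pos n
  have hcount : (2 ^ sampleBits n : ℝ) - modulus n ≤ modulus n *
      (Finset.univ.filter fun u : Fin (sampleBits n) → Bool =>
        ((bitsVal u : ℕ) : ZMod (modulus n)) = z).card := by
    rw [card_filter_bitsVal (sampleBits n) fun i => (i : ZMod (modulus n)) = z]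
    have h1 : ((Finset.range (2 ^ sampleBits n)).filter
        fun i : ℕ => (i : ZMod (modulus n)) = z).card =
        Nat.count (fun x => x ≡ z.val [MOD modulus n]) (2 ^ sampleBits n) := by
      rw [Nat.count_eq_card_filter_range]
      congr 1
      ext i
      rw [Finset.mem_filter, Finset.mem_filter, ← ZMod.natCast_eq_natCast_iff, ZMod.natCast_zmod_val]
    rw [h1, Nat.count_modEq_card _ hq]
    have h2 : 2 ^ sampleBits n ≤ modulus n * (2 ^ sampleBits n / modulus n) + modulus n := by
      have := Nat.div_add_mod (2 ^ sampleBits n) (modulus n)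
      have := Nat.mod_lt (2 ^ sampleBits n) hq
      omega
    have h3 : (2 ^ sampleBits n : ℝ) ≤
        modulus n * (2 ^ sampleBits n / modulus n : ℕ) + modulus n := by exact_mod_cast h2
    push_cast at h3 ⊢
    have h4 : (0 : ℝ) ≤ modulus n * (if z.val % modulus n < 2 ^ sampleBits n % modulus n
      then 1 else 0) := by positivity
    linarith
  have hq' : (0 : ℝ) < modulus n := by exact_mod_cast hq
  have h5 := modulus_le_two_inv_pow_mul n
  rw [← div_eq_mul_inv, div_le_div_iff₀ hq' (by simp)]
  simp only [Fintype.card_pi, Fintype.card_bool, Finset.prod_const, Finset.card_univ,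
    Fintype.card_fin, Nat.cast_pow, Nat.cast_ofNat]
  linarith

/-- Disjoint blocks of a uniform sequence of coin tosses are independent and uniform. -/
theorem map_uniform_blocks {N k K : ℕ} {ι : Fin k → Fin K → Fin N}
    (hι : ∀ j i j' i', ι j i = ι j' i' → j = j' ∧ i = i') :
    (PMF.uniformOfFintype (Fin N → Bool)).map (fun r j i => r (ι j i)) =
      iid (PMF.uniformOfFintype (Fin K → Bool)) k := by
  rw [iid_uniform, ← map_uniform_of_bijective (Equiv.curry (Fin k) (Fin K) Bool).bijective,
    ← map_uniform_comp_injective (ι := fun z : Fin k × Fin K => ι z.1 z.2), PMF.map_comp]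
  · rfl
  · rintro ⟨j, i⟩ ⟨j', i'⟩ h
    exact Prod.ext_iff.2 (hι j i j' i' h)

/-! ### The noise has polynomial size -/

/-- The upper ends of consecutive intervals in `{0, …, 2 ^ K}` whose lengths are almost
proportional to the probabilities of the noise distribution. -/
noncomputable def noiseThreshold (n t : ℕ) : ℕ :=
  ∑ y ∈ Finset.range t,
    ⌈(1 - (2⁻¹ : ℝ) ^ n) * (noise n (y : ZMod (modulus n))).toReal * 2 ^ sampleBits n⌉₊

theorem noiseThreshold_mono (n : ℕ) : Monotone (noiseThreshold n) := fun _ _ h =>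
  Finset.sum_le_sum_of_subset (Finset.range_subset_range.2 h)

theorem ZMod.sum_range_natCast {M : Type*} [AddCommMonoid M] (q : ℕ) [NeZero q] (f : ZMod q → M) :
    ∑ y ∈ Finset.range q, f (y : ZMod q) = ∑ z, f z :=
  Finset.sum_nbij' (fun y => (y : ZMod q)) ZMod.val (by simp)
    (by simp [ZMod.val_lt]) (fun y hy => by
      rw [ZMod.val_natCast, Nat.mod_eq_of_lt (Finset.mem_range.1 hy)]) (by simp) (by simp)

theorem noiseThreshold_modulus_lt (n : ℕ) : noiseThreshold n (modulus n) < 2 ^ sampleBits n := by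
  have h1 : (0 : ℝ) ≤ 1 - (2⁻¹ : ℝ) ^ n :=
    sub_nonneg.2 (pow_le_one₀ (by norm_num) (by norm_num))
  have : (noiseThreshold n (modulus n) : ℝ) < 2 ^ sampleBits n := by
    calc (noiseThreshold n (modulus n) : ℝ)
        < ∑ y ∈ Finset.range (modulus n), ((1 - (2⁻¹ : ℝ) ^ n) *
            (noise n (y : ZMod (modulus n))).toReal * 2 ^ sampleBits n + 1) := by
          rw [noiseThreshold, Nat.cast_sum]
          refine Finset.sum_lt_sum_of_nonempty
            (Finset.nonempty_range_iff.2 (modulus_pos n).ne') fun y _ => Nat.ceil_lt_add_one ?_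
          have : 0 ≤ (noise n (y : ZMod (modulus n))).toReal := ENNReal.toReal_nonneg
          positivity
      _ = (1 - (2⁻¹ : ℝ) ^ n) * 2 ^ sampleBits n + modulus n := by
          rw [Finset.sum_add_distrib, ← Finset.sum_mul, ← Finset.mul_sum,
            ZMod.sum_range_natCast (modulus n) fun z => (noise n z).toReal, PMF.sum_toReal]
          simp
      _ ≤ 2 ^ sampleBits n := by linarith [modulus_le_two_inv_pow_mul n]
  exact_mod_cast this

/-- The noise sample determined by a binary number: the index of the interval it lies in. -/
noncomputable def noiseValue (n v : ℕ) : ℕ :=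
  ∑ t ∈ Finset.range (modulus n - 1), (1 - if v < noiseThreshold n (t + 1) then 1 else 0)

theorem noiseValue_eq {n v t : ℕ} (ht : t < modulus n) (h1 : noiseThreshold n t ≤ v)
    (h2 : v < noiseThreshold n (t + 1)) : noiseValue n v = t := by
  have : ∀ y, (1 - if v < noiseThreshold n (y + 1) then 1 else 0) = if y < t then 1 else 0 := by
    intro y
    by_cases hy : y < t
    · have := noiseThreshold_mono n (show y + 1 ≤ t from hy)
      rw [if_neg (by omega), if_pos hy]
    · have := noiseThreshold_mono n (show t + 1 ≤ y + 1 by omega)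
      rw [if_pos (by omega), if_neg hy]
  simp only [noiseValue, this, Finset.sum_boole, Nat.cast_id]
  rw [show (Finset.range (modulus n - 1)).filter (· < t) = Finset.range t by ext; simp; omega,
    Finset.card_range]

theorem mul_noise_le_map_noiseValue (n : ℕ) (z : ZMod (modulus n)) :
    (1 - (2⁻¹ : ℝ) ^ n) * (noise n z).toReal ≤
      ((PMF.uniformOfFintype (Fin (sampleBits n) → Bool)).map
        (fun u => (noiseValue n (bitsVal u) : ZMod (modulus n))) z).toReal := by
  rw [map_uniform_toReal, le_div_iff₀ (by simp),
    card_filter_bitsVal (sampleBits n) fun v => (noiseValue n v : ZMod (modulus n)) = z]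
  simp only [Fintype.card_pi, Fintype.card_bool, Finset.prod_const, Finset.card_univ,
    Fintype.card_fin, Nat.cast_pow, Nat.cast_ofNat]
  have hz := z.val_lt
  have hsub : Finset.Ico (noiseThreshold n z.val) (noiseThreshold n (z.val + 1)) ⊆
      (Finset.range (2 ^ sampleBits n)).filter
        fun v => (noiseValue n v : ZMod (modulus n)) = z := by
    intro v hv
    rw [Finset.mem_Ico] at hv
    have := noiseThreshold_mono n (show z.val + 1 ≤ modulus n from hz)
    have := noiseThreshold_modulus_lt n
    rw [Finset.mem_filter, Finset.mem_range, noiseValue_eq hz hv.1 hv.2, ZMod.natCast_zmod_val]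
    exact ⟨by omega, rfl⟩
  have hcard := Finset.card_le_card hsub
  rw [Nat.card_Ico, noiseThreshold, noiseThreshold, Finset.sum_range_succ,
    Nat.add_sub_cancel_left, ZMod.natCast_zmod_val] at hcard
  exact (Nat.le_ceil _).trans (by exact_mod_cast hcard)

/-- The binary digits of the thresholds. -/
noncomputable def noiseAdvice (n : ℕ) : Data :=
  .tab (modulus n) fun t => .tab (sampleBits n) fun i =>
    .num (noiseThreshold n t / 2 ^ i % 2)

/-- The noise sampler: the thresholds `w` are compared with binary numbers made of coins `r`. -/
def noisyVec (n : ℕ) (w x r : Data) : Data :=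
  .tab (dim n) fun j => .num ((x.ent j + ∑ t ∈ Finset.range (modulus n - 1),
    (1 - lessBits (fun i => r.ent (j * sampleBits n + i)) (fun i => (w.nth (t + 1)).ent i)
      (sampleBits n))) % modulus n)

@[fun_prop]
theorem IsPolyTime.sampleBits {α : Type} [DataCoding α] {f : α → ℕ} (hf : IsPolyTime f) :
    IsPolyTime fun a => sampleBits (f a) := by
  unfold _root_.sampleBits
  fun_prop

theorem isPolyTime_noisyVec :
    IsPolyTime fun z : (ℕ × Data × Data) × Data => noisyVec z.1.1 z.1.2.1 z.1.2.2 z.2 := by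
  unfold noisyVec
  fun_prop

theorem sum_div_two_pow_mod_two {K v : ℕ} (hv : v < 2 ^ K) :
    ∑ i ∈ Finset.range K, v / 2 ^ i % 2 * 2 ^ i = v := by
  have : ∀ K, ∑ i ∈ Finset.range K, v / 2 ^ i % 2 * 2 ^ i = v % 2 ^ K := by
    intro K
    induction K with
    | zero => simp [Nat.mod_one]
    | succ K ih => rw [Finset.sum_range_succ, ih, Nat.mod_pow_succ, mul_comm]
  rw [this, Nat.mod_eq_of_lt hv]

theorem ofVec_eq_tab {q k : ℕ} {v : Fin k → ZMod q} {f : ℕ → ℕ}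
    (h : ∀ i : Fin k, f i = (v i).val) : Data.ofVec v = .tab k fun i => .num (f i) :=
  Data.ofList_ofFn fun i => by rw [h]

theorem block_lt {k K j i : ℕ} (hj : j < k) (hi : i < K) : j * K + i < k * K := by
  calc j * K + i < j * K + K := by omega
    _ = (j + 1) * K := by ring
    _ ≤ _ := Nat.mul_le_mul_right _ hj

theorem block_inj {K j i j' i' : ℕ} (hi : i < K) (hi' : i' < K)
    (h : j * K + i = j' * K + i') : j = j' ∧ i = i' := by
  have h1 := congrArg (· / K) h
  have h2 := congrArg (· % K) h
  have hK : 0 < K := by omega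
  simp only [mul_comm _ K, Nat.mul_add_div hK, Nat.mul_add_mod, Nat.div_eq_of_lt hi,
    Nat.div_eq_of_lt hi', Nat.mod_eq_of_lt hi, Nat.mod_eq_of_lt hi', add_zero] at h1 h2
  exact ⟨h1, h2⟩

/-- The noise vector determined by a sequence of coin tosses. -/
noncomputable def noiseOfCoins {n N : ℕ} (hN : dim n * sampleBits n ≤ N) (r : Fin N → Bool) :
    Vec n := fun j =>
  (noiseValue n (bitsVal fun i : Fin (sampleBits n) =>
    r ⟨j * sampleBits n + i, (block_lt j.2 i.2).trans_le hN⟩) : ZMod (modulus n))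

theorem noisyVec_eq {n N : ℕ} (hN : dim n * sampleBits n ≤ N) (x : Vec n) (r : Fin N → Bool) :
    noisyVec n (noiseAdvice n) (.ofVec x) (.ofBits r) = .ofVec (x + noiseOfCoins hN r) := by
  refine (ofVec_eq_tab fun j => ?_).symm
  rw [← ZMod.val_natCast, Pi.add_apply, Data.ent_ofVec, noiseOfCoins]
  congr 1
  push_cast
  rw [ZMod.natCast_zmod_val]
  congr 1
  rw [noiseValue]
  push_cast
  refine Finset.sum_congr rfl fun t ht => ?_
  rw [Finset.mem_range] at ht
  have hthr : noiseThreshold n (t + 1) < 2 ^ sampleBits n :=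
    (noiseThreshold_mono n (by omega)).trans_lt (noiseThreshold_modulus_lt n)
  have hadv : ∀ i < sampleBits n, ((noiseAdvice n).nth (t + 1)).ent i =
      noiseThreshold n (t + 1) / 2 ^ i % 2 := by
    intro i hi
    rw [noiseAdvice, Data.nth_tab (by omega), Data.ent, Data.nth_tab hi]; rfl
  have hr : ∀ i : Fin (sampleBits n), (Data.ofBits r).ent (j * sampleBits n + i) =
      (r ⟨j * sampleBits n + i, (block_lt j.2 i.2).trans_le hN⟩).toNat := fun i =>
    Data.ent_ofBits r ⟨j * sampleBits n + i, _⟩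
  rw [lessBits_eq (fun i hi => by rw [hr ⟨i, hi⟩]; exact Bool.toNat_le _)
    (fun i hi => by rw [hadv i hi]; omega)]
  have h1 : ∑ i ∈ Finset.range (sampleBits n), ((noiseAdvice n).nth (t + 1)).ent i * 2 ^ i =
      noiseThreshold n (t + 1) := by
    refine (Finset.sum_congr rfl fun i hi => ?_).trans (sum_div_two_pow_mod_two hthr)
    rw [hadv i (Finset.mem_range.1 hi)]
  rw [h1, Finset.sum_range, bitsVal]
  simp only [hr]

theorem noisePolynomialSize : NoisePolynomialSize := by
  obtain ⟨M, hM⟩ := isPolyTime_noisyVec.exists_ppt (dimPoly * (4 * Polynomial.X))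
  have hN : ∀ n, dim n * sampleBits n ≤ (dimPoly * (4 * Polynomial.X)).eval n := fun n => by
    rw [Polynomial.eval_mul]
    simpa [sampleBits] using Nat.mul_le_mul_right (4 * n) (dim_le_eval n)
  refine ⟨M, noiseAdvice, (Polynomial.X ^ 3 + 1) * (4 * Polynomial.X * 3 + 2) + 1,
    fun n x => (PMF.uniformOfFintype (Fin ((dimPoly * (4 * Polynomial.X)).eval n) → Bool)).map
      fun r => x + noiseOfCoins (hN n) r,
    _, negligible_eval_mul_two_inv_pow dimPoly, fun n => ⟨?_, fun x => ⟨?_, ?_⟩⟩⟩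
  · have h2 : ∀ i t, (Data.num (noiseThreshold n t / 2 ^ i % 2)).size ≤ 2 := fun i t => by
      simp only [Data.size]; omega
    refine (Data.size_tab_le fun t _ => Data.size_tab_le fun i _ => h2 i t).trans ?_
    simp only [Polynomial.eval_add, Polynomial.eval_mul, Polynomial.eval_pow, Polynomial.eval_X,
      Polynomial.eval_one, Polynomial.eval_ofNat, sampleBits]
    exact Nat.add_le_add_right (Nat.mul_le_mul_right _ (modulus_le n)) 1
  · refine (hM n (n, noiseAdvice n, .ofVec x)).trans ?_
    rw [PMF.map_comp]
    congr 1
    ext1 r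
    exact noisyVec_eq (hN n) x r
  · have hout : (PMF.uniformOfFintype (Fin ((dimPoly * (4 * Polynomial.X)).eval n) → Bool)).map
        (fun r => x + noiseOfCoins (hN n) r) =
        (iid ((PMF.uniformOfFintype (Fin (sampleBits n) → Bool)).map fun u =>
          (noiseValue n (bitsVal u) : ZMod (modulus n))) (dim n)).map fun e => x + e := by
      rw [iid_map, ← map_uniform_blocks
        (ι := fun (j : Fin (dim n)) (i : Fin (sampleBits n)) =>
          (⟨j * sampleBits n + i, (block_lt j.2 i.2).trans_le (hN n)⟩ : Fin _)),
        PMF.map_comp, PMF.map_comp]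
      · rfl
      · intro j i j' i' h
        have := block_inj i.2 i'.2 (Fin.mk.inj h)
        exact ⟨Fin.ext this.1, Fin.ext this.2⟩
    dsimp only
    rw [hout, statDist_comm]
    refine (statDist_map_le _ _ _).trans ((statDist_iid_le (by positivity)
      (pow_le_one₀ (by norm_num) (by norm_num)) (dim n) (mul_noise_le_map_noiseValue n)).trans ?_)
    gcongr
    exact dim_le_eval n

/-! ### Guessing the label of a perturbed sample -/

section

variable {α β γ : Type}

theorem prob_bind_le_add [Fintype α] {p : PMF α} {g : α → PMF β} {g' : α → PMF γ}
    {S : Set β} {S' : Set γ} {δ : ℝ} (h : ∀ a, prob (g a) S ≤ prob (g' a) S' + δ) :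
    prob (p.bind g) S ≤ prob (p.bind g') S' + δ := by
  rw [prob_bind, prob_bind, ← mul_one δ, ← p.sum_toReal, Finset.mul_sum, ← Finset.sum_add_distrib]
  refine Finset.sum_le_sum fun a _ => ?_
  rw [mul_comm δ, ← mul_add]
  exact mul_le_mul_of_nonneg_left (h a) ENNReal.toReal_nonneg

theorem prob_add_prob_le_one (p : PMF α) {S S' : Set α} (h : Disjoint S S') :
    prob p S + prob p S' ≤ 1 := by
  have h1 : p.toOuterMeasure S + p.toOuterMeasure S' ≤ 1 := by
    rw [p.toOuterMeasure_apply, p.toOuterMeasure_apply, ← ENNReal.tsum_add]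
    refine (ENNReal.tsum_le_tsum fun a => ?_).trans p.tsum_coe.le
    by_cases ha : a ∈ S
    · simp [ha, Set.disjoint_left.1 h ha]
    · simpa [ha] using Set.indicator_le_self _ _ a
  rw [prob, prob, ← ENNReal.toReal_add
    (ne_top_of_le_ne_top ENNReal.one_ne_top (toOuterMeasure_le_one _ _))
    (ne_top_of_le_ne_top ENNReal.one_ne_top (toOuterMeasure_le_one _ _))]
  exact ENNReal.toReal_mono ENNReal.one_ne_top h1

end

/-- The displacement `b ⌊q/2⌋ · 1ᵀ` of the class `b`. -/
def classShift (n : ℕ) (b : Bool) : Vec n :=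
  if b then fun _ => ((modulus n / 2 : ℕ) : ZMod (modulus n)) else 0

/-- Secrets for `k` samples from each class. -/
abbrev Secrets (n k : ℕ) : Type := Bool → Fin k → Fin n → ZMod (modulus n)

/-- The samples of class `b` with given secrets. -/
def samplesOf {n k : ℕ} (A : LatticeMatrix n) (σ : Secrets n k) (b : Bool) : Fin k → Vec n :=
  fun l => Matrix.vecMul (σ b l) A + classShift n b

/-- A classifier is learned from the samples `S`, and then guesses the label of `y`. -/
noncomputable def guess (L R : PPT) {n k : ℕ} (S : Bool → Fin k → Vec n) (y : Vec n) : PMF Data :=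
  (L.run n (.pair (.num n) (.pair (.ofVecs (S false)) (.ofVecs (S true))))).bind fun h =>
    R.run n (.pair (.num n) (.pair h (.ofVec y)))

/-- The displacement of `y` by a random class is to be recognized by a classifier that is learned
from the samples with secrets `σ`. -/
noncomputable def guessShift (L R : PPT) {n k : ℕ} (A : LatticeMatrix n) (σ : Secrets n k)
    (y : Vec n) : PMF Bool :=
  (PMF.uniformOfFintype Bool).bind fun b =>
    (guess L R (samplesOf A σ) (y + classShift n b)).map fun b' => decide (b' = .ofBool b)

theorem iid_classDist {n : ℕ} (A : LatticeMatrix n) (b : Bool) (k : ℕ) :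
    iid (classDist A b) k = (PMF.uniformOfFintype (Fin k → Fin n → ZMod (modulus n))).map
      fun s l => Matrix.vecMul (s l) A + classShift n b := by
  rw [classDist_eq_map, iid_map, iid_uniform]
  rfl

theorem uniform_secrets_bind {n k : ℕ} {β : Type} (g : Secrets n k → PMF β) :
    (PMF.uniformOfFintype (Secrets n k)).bind g =
      (PMF.uniformOfFintype (Fin k → Fin n → ZMod (modulus n))).bind fun s =>
        (PMF.uniformOfFintype (Fin k → Fin n → ZMod (modulus n))).bind fun s' =>
          g fun b => bif b then s' else s := by
  rw [← uniform_prod_bind fun z : (Fin k → Fin n → ZMod (modulus n)) ×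
      (Fin k → Fin n → ZMod (modulus n)) => g fun b => bif b then z.2 else z.1,
    ← map_uniform_of_bijective (f := fun (z : (Fin k → Fin n → ZMod (modulus n)) ×
      (Fin k → Fin n → ZMod (modulus n))) (b : Bool) => bif b then z.2 else z.1), PMF.bind_map]
  · rfl
  · refine ⟨fun z z' h => Prod.ext (congrFun h false) (congrFun h true), fun σ =>
      ⟨(σ false, σ true), ?_⟩⟩
    ext1 b
    cases b <;> rfl

theorem train_eq (L : PPT) (k : ℕ) {n : ℕ} (A : LatticeMatrix n) : train L k A =
    (PMF.uniformOfFintype (Fin k → Fin n → ZMod (modulus n))).bind fun s =>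
      (PMF.uniformOfFintype (Fin k → Fin n → ZMod (modulus n))).bind fun s' =>
        L.run n (.pair (.num n) (.pair
          (.ofVecs fun l => Matrix.vecMul (s l) A + classShift n false)
          (.ofVecs fun l => Matrix.vecMul (s' l) A + classShift n true))) := by
  change (iid _ k).bind (fun S => (iid _ k).bind fun S' => _) = _
  rw [iid_classDist, iid_classDist]
  simp only [PMF.bind_map, Function.comp_def]

/-- The noisy experiment in terms of secrets: the perturbed sample is an LWE sample, displaced by a
random class. -/
theorem noisyExperiment_eq (TS : (n : ℕ) → PMF (LatticeMatrix n × TrapdoorMatrix n))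
    (k : Polynomial ℕ) (L R : PPT) (n : ℕ) :
    noisyExperiment TS k L R n = ((TS n).map Prod.fst).bind fun A =>
      (PMF.uniformOfFintype (Secrets n (k.eval n))).bind fun σ =>
        (PMF.uniformOfFintype (Fin n → ZMod (modulus n))).bind fun s =>
          (noiseVec n).bind fun e => guessShift L R A σ (Matrix.vecMul s A + e) := by
  rw [PMF.bind_map]
  change (TS n).bind (fun z => (train L (k.eval n) z.1).bind fun h =>
    (PMF.uniformOfFintype Bool).bind fun b => (classDist z.1 b).bind fun x =>
      (noiseVec n).bind fun e => (R.run n (.pair (.num n) (.pair h (.ofVec (x + e))))).bind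
        fun b' => PMF.pure (decide (b' = .ofBool b))) = _
  refine congrArg _ (funext fun z => ?_)
  rw [Function.comp_apply, train_eq, uniform_secrets_bind, PMF.bind_bind]
  refine congrArg _ (funext fun s₀ => ?_)
  rw [PMF.bind_bind]
  refine congrArg _ (funext fun s₁ => ?_)
  rw [PMF.bind_comm]
  have h1 : ∀ b : Bool, classDist z.1 b =
      (PMF.uniformOfFintype (Fin n → ZMod (modulus n))).map
        fun s => Matrix.vecMul s z.1 + classShift n b := classDist_eq_map z.1
  simp only [h1, PMF.bind_map, Function.comp_def, guessShift, guess, PMF.map_bind]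
  -- The label, the secret, the noise and the learned classifier are drawn in another order.
  have h2 : ∀ (H : PMF Data) (g : Bool → (Fin n → ZMod (modulus n)) → Vec n → Data → PMF Bool),
      ((PMF.uniformOfFintype Bool).bind fun b => H.bind fun h =>
        (PMF.uniformOfFintype (Fin n → ZMod (modulus n))).bind fun s =>
          (noiseVec n).bind fun e => g b s e h) =
      (PMF.uniformOfFintype (Fin n → ZMod (modulus n))).bind fun s =>
        (noiseVec n).bind fun e => (PMF.uniformOfFintype Bool).bind fun b =>
          H.bind fun h => g b s e h := by
    intro H g
    have h3 : ∀ b, (H.bind fun h => (PMF.uniformOfFintype (Fin n → ZMod (modulus n))).bind fun s =>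
        (noiseVec n).bind fun e => g b s e h) =
        (PMF.uniformOfFintype (Fin n → ZMod (modulus n))).bind fun s => (noiseVec n).bind fun e =>
          H.bind fun h => g b s e h := fun b => by
      rw [PMF.bind_comm]
      exact congrArg _ (funext fun s => PMF.bind_comm _ _ _)
    simp only [h3]
    rw [PMF.bind_comm]
    exact congrArg _ (funext fun s => PMF.bind_comm _ _ _)
  refine (h2 _ _).trans ?_
  simp only [PMF.map, Function.comp_def, add_right_comm]
  rfl

/-! ### Success probability on uniform vectors -/

/-- A uniform vector displaced by a random class carries no information on the class. -/
theorem prob_guessShift_uniform_le (L R : PPT) {n k : ℕ} (A : LatticeMatrix n) (σ : Secrets n k) :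
    prob ((PMF.uniformOfFintype (Vec n)).bind fun y => guessShift L R A σ y) {true} ≤ 1 / 2 := by
  unfold guessShift
  have h1 : ∀ b, ((PMF.uniformOfFintype (Vec n)).bind fun y =>
      (guess L R (samplesOf A σ) (y + classShift n b)).map fun b' => decide (b' = .ofBool b)) =
      (PMF.uniformOfFintype (Vec n)).bind fun y =>
        (guess L R (samplesOf A σ) y).map fun b' => decide (b' = .ofBool b) := by
    intro b
    nth_rewrite 2 [← map_uniform_of_bijective (Equiv.addRight (classShift n b)).bijective]
    rw [PMF.bind_map]
    rfl
  rw [PMF.bind_comm]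
  simp only [h1]
  rw [PMF.bind_comm]
  refine prob_bind_le fun y => ?_
  rw [prob_uniform_bind, Fintype.sum_bool, prob_map, prob_map, Fintype.card_bool]
  have := prob_add_prob_le_one (guess L R (samplesOf A σ) y)
    (S := (fun b' => decide (b' = Data.ofBool true)) ⁻¹' {true})
    (S' := (fun b' => decide (b' = Data.ofBool false)) ⁻¹' {true})
    (Set.disjoint_left.2 fun d h h' => by
      simp only [Set.mem_preimage, Set.mem_singleton_iff, decide_eq_true_eq] at h h'
      simp [h, Data.ofBool] at h')
  norm_num
  linarith

/-! ### The distinguisher -/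

/-- The coin tosses of a sequence that start at position `o`. -/
def sliceBits (r : Data) (o N : ℕ) : Data := .tab N fun i => .num (r.ent (o + i))

/-- The position of coordinate `i` of the secret of sample `l` of class `b`. -/
def secretIndex (n k b l i : ℕ) : ℕ := (b * k + l) * n + i

/-- The samples of class `b` that are made of coins `r`. -/
def coinSamples (n k : ℕ) (A r : Data) (o b : ℕ) : Data :=
  .tab k fun l => .tab (dim n) fun j => .num ((∑ i ∈ Finset.range n,
    residue n (fun t => r.ent (o + (secretIndex n k b l i * sampleBits n + t))) (sampleBits n) *
      (A.nth i).ent j + b * (modulus n / 2)) % modulus n)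

@[fun_prop]
theorem IsPolyTime.sliceBits {α : Type} [DataCoding α] {r : α → Data} {o N : α → ℕ}
    (hr : IsPolyTime r) (ho : IsPolyTime o) (hN : IsPolyTime N) :
    IsPolyTime fun a => sliceBits (r a) (o a) (N a) := by
  unfold _root_.sliceBits
  fun_prop

@[fun_prop]
theorem IsPolyTime.coinSamples {α : Type} [DataCoding α] {n k o b : α → ℕ} {A r : α → Data}
    (hn : IsPolyTime n) (hk : IsPolyTime k) (hA : IsPolyTime A) (hr : IsPolyTime r)
    (ho : IsPolyTime o) (hb : IsPolyTime b) :
    IsPolyTime fun a => coinSamples (n a) (k a) (A a) (r a) (o a) (b a) := by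
  unfold _root_.coinSamples secretIndex
  fun_prop

/-- The guess that the distinguisher obtains: coin `0` of `r` selects the class, the next coins are
those of the learner and of the evaluator, and the remaining ones make the samples. -/
def simulatedGuess (L R : PPT) (k : Polynomial ℕ) (n : ℕ) (A y r : Data) : Data :=
  let S := fun b => coinSamples n (k.eval n) A r (1 + L.coins.eval n + R.coins.eval n) b
  let h := L.prog.eval (.pair (.pair (.num n) (.pair (S 0) (S 1)))
    (sliceBits r 1 (L.coins.eval n)))
  let y' := Data.tab (dim n) fun j => .num ((y.ent j + r.ent 0 * (modulus n / 2)) % modulus n)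
  R.prog.eval (.pair (.pair (.num n) (.pair h y'))
    (sliceBits r (1 + L.coins.eval n) (R.coins.eval n)))

/-- The distinguisher accepts if the class is recognized. -/
def distinguish (L R : PPT) (k : Polynomial ℕ) (n : ℕ) (A y r : Data) : ℕ :=
  if (simulatedGuess L R k n A y r).isNum.toNat = 1 then
    if (simulatedGuess L R k n A y r).toNat = r.ent 0 then 1 else 0
  else 0

theorem isPolyTime_distinguish (L R : PPT) (k : Polynomial ℕ) :
    IsPolyTime fun z : (ℕ × Data × Data) × Data =>
      distinguish L R k z.1.1 z.1.2.1 z.1.2.2 z.2 := by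
  have hL := L.isPolyTime
  have hR := R.isPolyTime
  unfold distinguish simulatedGuess
  dsimp only
  fun_prop

theorem secretIndex_lt {n k : ℕ} (b : Bool) (l : Fin k) (i : Fin n) :
    secretIndex n k b.toNat l i < 2 * k * n :=
  block_lt (block_lt (by cases b <;> simp) l.2) i.2

/-- The `a` coins from position `o` on. -/
def coinSlice {N : ℕ} (r : Fin N → Bool) (o a : ℕ) (h : o + a ≤ N) : Fin a → Bool :=
  fun i => r ⟨o + i, by omega⟩

/-- The `M` blocks of `K` coins from position `o` on. -/
def coinBlocks {N : ℕ} (r : Fin N → Bool) (o M K : ℕ) (h : o + M * K ≤ N) :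
    Fin M → Fin K → Bool :=
  fun j i => r ⟨o + (j * K + i), by have := block_lt j.2 i.2; omega⟩

/-- The coins of the distinguisher are independent and uniform. -/
theorem map_uniform_tape {N a b M K : ℕ} (h : 1 + a + b + M * K ≤ N) :
    (PMF.uniformOfFintype (Fin N → Bool)).map (fun r =>
      (r ⟨0, by omega⟩, coinSlice r 1 a (by omega), coinSlice r (1 + a) b (by omega),
        coinBlocks r (1 + a + b) M K h)) =
      PMF.uniformOfFintype (Bool × (Fin a → Bool) × (Fin b → Bool) × (Fin M → Fin K → Bool)) := by
  have h1 : Function.Bijective fun (u : Unit ⊕ Fin a ⊕ Fin b ⊕ (Fin M × Fin K) → Bool) =>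
      ((u (.inl ()), fun i => u (.inr (.inl i)), fun i => u (.inr (.inr (.inl i))),
        fun j i => u (.inr (.inr (.inr (j, i))))) :
        Bool × (Fin a → Bool) × (Fin b → Bool) × (Fin M → Fin K → Bool)) := by
    refine Function.bijective_iff_has_inverse.2 ⟨fun z => Sum.elim (fun _ => z.1)
      (Sum.elim z.2.1 (Sum.elim z.2.2.1 fun x => z.2.2.2 x.1 x.2)), fun u => ?_, fun z => rfl⟩
    ext (_ | _ | _ | _) <;> rfl
  rw [← map_uniform_of_bijective h1, ← map_uniform_comp_injective
    (ι := Sum.elim (fun _ : Unit => (⟨0, by omega⟩ : Fin N)) (Sum.elim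
      (fun i : Fin a => ⟨1 + i, by omega⟩) (Sum.elim (fun i : Fin b => ⟨1 + a + i, by omega⟩)
        fun x : Fin M × Fin K => ⟨1 + a + b + (x.1 * K + x.2), by
          have := block_lt x.1.2 x.2.2; omega⟩))), PMF.map_comp]
  · rfl
  · rintro (_ | i | i | ⟨j, i⟩) (_ | i' | i' | ⟨j', i'⟩) hij <;>
      simp only [Sum.elim_inl, Sum.elim_inr, Fin.mk.injEq] at hij
    all_goals first
      | rfl
      | (exfalso; omega)
      | (obtain rfl : i = i' := Fin.ext (by omega); rfl)
      | (obtain ⟨h1, h2⟩ := block_inj i.2 i'.2 (Nat.add_left_cancel hij)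
         rw [Fin.ext h1, Fin.ext h2])

/-- Secrets made of coin tosses. -/
def coinSecrets {n k : ℕ} (t : Fin (2 * k * n) → Fin (sampleBits n) → Bool) : Secrets n k :=
  fun b l i => ((bitsVal (t ⟨_, secretIndex_lt b l i⟩) : ℕ) : ZMod (modulus n))

theorem statDist_coinSecrets_le (n k : ℕ) :
    statDist (PMF.uniformOfFintype (Secrets n k))
      ((PMF.uniformOfFintype (Fin (2 * k * n) → Fin (sampleBits n) → Bool)).map coinSecrets) ≤
      (2 * k * n : ℕ) * (2⁻¹ : ℝ) ^ n := by
  let f : (Fin (2 * k * n) → ZMod (modulus n)) → Secrets n k :=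
    fun w b l i => w ⟨_, secretIndex_lt b l i⟩
  have h1 : (iid (PMF.uniformOfFintype (ZMod (modulus n))) (2 * k * n)).map f =
      PMF.uniformOfFintype (Secrets n k) := by
    have h2 : Function.Bijective fun (u : Bool × Fin k × Fin n → ZMod (modulus n)) b l i =>
        u (b, l, i) :=
      Function.bijective_iff_has_inverse.2 ⟨fun σ x => σ x.1 x.2.1 x.2.2, fun u => rfl,
        fun σ => rfl⟩
    rw [iid_uniform, ← map_uniform_of_bijective h2, ← map_uniform_comp_injective
      (ι := fun x : Bool × Fin k × Fin n => (⟨_, secretIndex_lt x.1 x.2.1 x.2.2⟩ : Fin _)),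
      PMF.map_comp]
    · rfl
    · rintro ⟨b, l, i⟩ ⟨b', l', i'⟩ h
      obtain ⟨h3, h4⟩ := block_inj i.2 i'.2 (Fin.mk.inj h)
      obtain ⟨h5, h6⟩ := block_inj l.2 l'.2 h3
      have h7 : b = b' := by revert h5; cases b <;> cases b' <;> simp
      rw [Fin.ext h4, Fin.ext h6, h7]
  have h2 : (PMF.uniformOfFintype (Fin (2 * k * n) → Fin (sampleBits n) → Bool)).map coinSecrets =
      (iid ((PMF.uniformOfFintype (Fin (sampleBits n) → Bool)).map
        fun u => ((bitsVal u : ℕ) : ZMod (modulus n))) (2 * k * n)).map f := by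
    rw [iid_map, iid_uniform, PMF.map_comp]; rfl
  rw [← h1, h2]
  exact (statDist_map_le _ _ _).trans (statDist_iid_le (by positivity)
    (pow_le_one₀ (by norm_num) (by norm_num)) _ (mul_uniform_le_map_bitsVal n))

theorem sliceBits_eq {N a : ℕ} (r : Fin N → Bool) {o : ℕ} (h : o + a ≤ N) :
    sliceBits (.ofBits r) o a = .ofBits (coinSlice r o a h) :=
  (Data.ofList_ofFn fun i => by
    rw [Data.ent_ofBits r ⟨o + i, by omega⟩]; rfl).symm

theorem coinSamples_eq {N n k : ℕ} (A : LatticeMatrix n) (r : Fin N → Bool) {o : ℕ}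
    (h : o + 2 * k * n * sampleBits n ≤ N) (b : Bool) :
    coinSamples n k (.ofMat A) (.ofBits r) o b.toNat =
      .ofVecs (samplesOf A (coinSecrets (coinBlocks r o _ _ h)) b) := by
  refine (Data.ofList_ofFn fun l => ?_).symm
  refine (ofVec_eq_tab fun j => ?_).symm
  rw [← ZMod.val_natCast, Finset.sum_range]
  congr 1
  push_cast
  rw [samplesOf, Pi.add_apply, Matrix.vecMul, dotProduct]
  congr 1
  · refine Finset.sum_congr rfl fun i _ => ?_
    rw [residue_eq (u := coinBlocks r o _ _ h ⟨_, secretIndex_lt b l i⟩) fun t =>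
      Data.ent_ofBits r ⟨_, _⟩]
    simp [coinSecrets]
  · cases b <;> simp [classShift]

theorem Data.eq_ofBool_iff (d : Data) (b : Bool) :
    d = .ofBool b ↔ d.isNum.toNat = 1 ∧ d.toNat = b.toNat := by
  cases d <;> simp [Data.ofBool, Data.isNum, Data.toNat]

/-- The guess of the distinguisher for the class `b`, with coins `u` for the learner, `v` for the
evaluator and `t` for the secrets, where `z = (b, u, v, t)`. -/
def guessOfCoins (L R : PPT) {n k : ℕ} (A : LatticeMatrix n) (y : Vec n)
    (z : Bool × (Fin (L.coins.eval n) → Bool) × (Fin (R.coins.eval n) → Bool) ×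
      (Fin (2 * k * n) → Fin (sampleBits n) → Bool)) : Data :=
  R.prog.eval (.pair (.pair (.num n) (.pair (L.prog.eval (.pair (.pair (.num n) (.pair
      (.ofVecs (samplesOf A (coinSecrets z.2.2.2) false))
      (.ofVecs (samplesOf A (coinSecrets z.2.2.2) true)))) (.ofBits z.2.1)))
    (.ofVec (y + classShift n z.1)))) (.ofBits z.2.2.1))

theorem distinguish_eq (L R : PPT) (k : Polynomial ℕ) {n N : ℕ}
    (h : 1 + L.coins.eval n + R.coins.eval n + 2 * k.eval n * n * sampleBits n ≤ N)
    (A : LatticeMatrix n) (y : Vec n) (r : Fin N → Bool) :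
    distinguish L R k n (.ofMat A) (.ofVec y) (.ofBits r) =
      (decide (guessOfCoins L R A y (r ⟨0, by omega⟩, coinSlice r 1 _ (by omega),
        coinSlice r (1 + L.coins.eval n) _ (by omega), coinBlocks r _ _ _ h) =
          .ofBool (r ⟨0, by omega⟩))).toNat := by
  have h0 : (Data.ofBits r).ent 0 = (r ⟨0, by omega⟩).toNat := Data.ent_ofBits r ⟨0, _⟩
  have hy : (Data.tab (dim n) fun j => .num (((Data.ofVec y).ent j +
      (Data.ofBits r).ent 0 * (modulus n / 2)) % modulus n)) =
      .ofVec (y + classShift n (r ⟨0, by omega⟩)) := by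
    refine (ofVec_eq_tab fun j => ?_).symm
    rw [← ZMod.val_natCast, h0, Data.ent_ofVec]
    congr 1
    push_cast
    rw [ZMod.natCast_zmod_val, Pi.add_apply]
    cases r ⟨0, by omega⟩ <;> simp [classShift]
  have hS := coinSamples_eq A r h
  have hS0 := hS false
  have hS1 := hS true
  rw [Bool.toNat_false] at hS0
  rw [Bool.toNat_true] at hS1
  have hg : simulatedGuess L R k n (.ofMat A) (.ofVec y) (.ofBits r) =
      guessOfCoins L R A y (r ⟨0, by omega⟩, coinSlice r 1 _ (by omega),
        coinSlice r (1 + L.coins.eval n) _ (by omega), coinBlocks r _ _ _ h) := by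
    unfold simulatedGuess guessOfCoins
    dsimp only
    rw [hS0, hS1, hy, sliceBits_eq r (by omega), sliceBits_eq r (by omega)]
  rw [distinguish, hg, h0]
  simp only [Data.eq_ofBool_iff, Bool.decide_and]
  split_ifs <;> simp_all

/-- The distinguisher learns from samples with almost uniform secrets, and applies the learned
classifier to the displaced vector. -/
theorem exists_distinguisher (L R : PPT) (k : Polynomial ℕ) : ∃ D : PPT,
    ∀ n (A : LatticeMatrix n) (y : Vec n),
      D.run n (.pair (.num n) (.pair (.ofMat A) (.ofVec y))) =
        (((PMF.uniformOfFintype (Fin (2 * k.eval n * n) → Fin (sampleBits n) → Bool)).map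
          coinSecrets).bind fun σ => guessShift L R A σ y).map fun x => .num x.toNat := by
  obtain ⟨D, hD⟩ := (isPolyTime_distinguish L R k).exists_ppt
    (1 + L.coins + R.coins + 2 * k * Polynomial.X * (4 * Polynomial.X))
  refine ⟨D, fun n A y => (hD n (n, .ofMat A, .ofVec y)).trans ?_⟩
  have hN : 1 + L.coins.eval n + R.coins.eval n + 2 * k.eval n * n * sampleBits n ≤
      (1 + L.coins + R.coins + 2 * k * Polynomial.X * (4 * Polynomial.X)).eval n := by
    simp [sampleBits]
  simp only [distinguish_eq L R k hN]
  -- The result depends on the coins only through the parts considered in `map_uniform_tape`.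
  have h1 := congrArg (PMF.map fun z => Data.num (decide (guessOfCoins L R A y z = .ofBool z.1)).toNat)
    (map_uniform_tape hN)
  rw [PMF.map_comp] at h1
  refine h1.trans ?_
  simp only [PMF.map, uniform_prod_bind, PMF.bind_bind, guessShift, guess, PPT.run_eq,
    Function.comp_def, PMF.pure_bind, guessOfCoins]
  symm
  rw [PMF.bind_comm]
  refine congrArg _ (funext fun b => ?_)
  rw [PMF.bind_comm]
  refine congrArg _ (funext fun u => ?_)
  exact PMF.bind_comm _ _ _

theorem lweSample_eq (n : ℕ) : lweSample n =
    (PMF.uniformOfFintype (LatticeMatrix n)).bind fun A =>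
      (PMF.uniformOfFintype (Fin n → ZMod (modulus n))).bind fun s =>
        (noiseVec n).map fun e => (A, Matrix.vecMul s A + e) := rfl

/-- Under the LWE assumption, the success probability in the noisy experiment exceeds `1/2` by a
negligible amount only: up to small statistical errors it is the acceptance probability of the
distinguisher on LWE samples, and on uniform samples the latter is at most `1/2`. -/
theorem noisyExperiment_le {TS : (n : ℕ) → PMF (LatticeMatrix n × TrapdoorMatrix n)}
    (hTS : IsTrapdoorSampler TS) (hLWE : LWEAssumption) (k : Polynomial ℕ) (L R : PPT) :
    ∃ ν : ℕ → ℝ, Negligible ν ∧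
      ∀ n, prob (noisyExperiment TS k L R n) {true} ≤ 1 / 2 + ν n := by
  obtain ⟨D, hD⟩ := exists_distinguisher L R k
  obtain ⟨c, hc, hclose⟩ := hTS.close_to_uniform
  have hDprob : ∀ n (A : LatticeMatrix n) (y : Vec n),
      prob (D.run n (.pair (.num n) (.pair (.ofMat A) (.ofVec y)))) {.num 1} =
        prob (((PMF.uniformOfFintype (Fin (2 * k.eval n * n) → Fin (sampleBits n) → Bool)).map
          coinSecrets).bind fun σ => guessShift L R A σ y) {true} := by
    intro n A y
    rw [hD, prob_map]
    congr 1
    ext x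
    cases x <;> simp
  -- On uniform samples the distinguisher is right with probability at most `1/2`.
  have huniform : ∀ n, acceptProb D n (uniformSample n) ≤ 1 / 2 := by
    intro n
    rw [acceptProb, uniformSample, uniform_prod_bind]
    refine prob_bind_le fun A => ?_
    refine (prob_bind_mono (g' := fun y => ((PMF.uniformOfFintype
      (Fin (2 * k.eval n * n) → Fin (sampleBits n) → Bool)).map coinSecrets).bind
        fun σ => guessShift L R A σ y) (S' := {true}) fun y _ => (hDprob n A y).le).trans ?_
    rw [PMF.bind_comm]
    exact prob_bind_le fun σ => prob_guessShift_uniform_le L R A σ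
  have hlwe : ∀ n, prob (noisyExperiment TS k L R n) {true} ≤ acceptProb D n (lweSample n) +
      (2 * k.eval n * n : ℕ) * (2⁻¹ : ℝ) ^ n +
      statDist ((TS n).map Prod.fst) (PMF.uniformOfFintype (LatticeMatrix n)) := by
    intro n
    rw [noisyExperiment_eq]
    refine (prob_bind_le_add_statDist _ (PMF.uniformOfFintype (LatticeMatrix n)) _ _).trans
      (add_le_add_left ?_ _)
    rw [acceptProb, lweSample_eq, PMF.bind_bind]
    refine prob_bind_le_add fun A => ?_
    rw [PMF.bind_comm, PMF.bind_bind]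
    refine prob_bind_le_add fun s => ?_
    rw [PMF.bind_comm, PMF.bind_map]
    refine prob_bind_le_add fun e => ?_
    rw [Function.comp_apply, hDprob]
    exact (prob_bind_le_add_statDist _ _ _ _).trans
      (add_le_add_right (statDist_coinSecrets_le n (k.eval n)) _)
  refine ⟨fun n => max (prob (noisyExperiment TS k L R n) {true} - 1 / 2) 0, ?_,
    fun n => by linarith [le_max_left (prob (noisyExperiment TS k L R n) {true} - 1 / 2) 0]⟩
  have h1 : Negligible fun n : ℕ => ((2 : ℝ) ^ (-c)) ^ n :=
    negligible_pow (by positivity) (Real.rpow_lt_one_of_one_lt_of_neg one_lt_two (by linarith))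
  refine (((hLWE D).add (negligible_eval_mul_two_inv_pow (2 * k * Polynomial.X))).add
    h1).of_eventually_le (fun n => le_max_right _ _) ?_
  filter_upwards [hclose] with n hn
  have h2 : ((2 : ℝ) ^ (-c)) ^ n = 2 ^ (-(c * n)) := by
    rw [← Real.rpow_natCast, ← Real.rpow_mul (by norm_num), neg_mul]
  have h3 := hlwe n
  have h4 := huniform n
  have h5 := le_abs_self (acceptProb D n (lweSample n) - acceptProb D n (uniformSample n))
  have h6 : (2 * k * Polynomial.X).eval n = 2 * k.eval n * n := by simp
  rw [h2, h6]
  refine max_le (by linarith) ?_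
  have := abs_nonneg (acceptProb D n (lweSample n) - acceptProb D n (uniformSample n))
  positivity

/-! ### Membership in a span modulo `q` -/

theorem loopFrom_induction {σ : Type} {P : ℕ → σ → Prop} {s : σ} {F : ℕ → σ → σ} (h0 : P 0 s)
    {N : ℕ} (h : ∀ i < N, ∀ s, P i s → P (i + 1) (F i s)) : P N (loopFrom s F N) := by
  induction N with
  | zero => exact h0
  | succ N ih => exact h N (by omega) _ (ih fun i hi => h i (by omega))

/-- The row operation `p - ⌊p_c / v_c⌋ v` modulo `q`. -/
def subMul (n c : ℕ) (p v : Data) : Data :=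
  .tab (dim n) fun j => .num ((p.ent j + p.ent c / v.ent c * (modulus n - v.ent j)) % modulus n)

/-- A vector with entries cut off at `q`; this only serves to bound the size of arbitrary data. -/
def clip (n : ℕ) (v : Data) : Data :=
  .tab (dim n) fun j => .num (min (v.ent j) (modulus n))

/-- The vector that is zero except for the number `q` in coordinate `c`. -/
def initialPivot (n c : ℕ) : Data :=
  .tab (dim n) fun j => .num (if j = c then modulus n else 0)

/-- The Euclidean algorithm on coordinate `c` of two rows. -/
def euclid (n c : ℕ) (s : Data × Data) : Data × Data :=
  loopFrom s (fun _ s => if s.2.ent c = 0 then s else (s.2, subMul n c s.1 s.2)) (modulus n + 1)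

/-- Elimination of coordinate `c` from `k` rows: a pivot row and rows without coordinate `c`. -/
def eliminate (n c k : ℕ) (rows : Data) : Data × Data :=
  loopFrom (initialPivot n c, .num 0)
    (fun i s => ((euclid n c (s.1, clip n (rows.nth i))).1,
      .pair (euclid n c (s.1, clip n (rows.nth i))).2 s.2)) k

/-- Whether the vector `x` is in the span of the given `k` rows: the coordinates are eliminated
one after the other, and `x` is reduced by the pivot rows. The state consists of the remaining
rows, the reduced vector, and whether all reductions were successful. -/
def memSpan (n k : ℕ) (rows x : Data) : Data × Data × Bool :=
  loopFrom (rows, x, true)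
    (fun c s => ((eliminate n c k s.1).2, subMul n c s.2.1 (eliminate n c k s.1).1,
      s.2.2 && decide ((subMul n c s.2.1 (eliminate n c k s.1).1).ent c = 0))) (dim n)

/-- A bound for the size of a row. -/
def rowSize (n : ℕ) : ℕ := dim n * (modulus n + 2) + 1

theorem size_tab_num_le {n : ℕ} {f : ℕ → ℕ} (h : ∀ j, f j ≤ modulus n) :
    (Data.tab (dim n) fun j => .num (f j)).size ≤ rowSize n :=
  Data.size_tab_le fun j _ => Nat.succ_le_succ (h j)

theorem size_subMul_le (n c : ℕ) (p v : Data) : (subMul n c p v).size ≤ rowSize n :=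
  size_tab_num_le fun _ => (Nat.mod_lt _ (modulus_pos n)).le

theorem size_clip_le (n : ℕ) (v : Data) : (clip n v).size ≤ rowSize n :=
  size_tab_num_le fun _ => min_le_right _ _

theorem size_initialPivot_le (n c : ℕ) : (initialPivot n c).size ≤ rowSize n :=
  size_tab_num_le fun j => by split_ifs <;> omega

theorem size_euclid_loop_le {n c b : ℕ} (hb : rowSize n ≤ b) {s : Data × Data}
    (h : s.1.size ≤ b ∧ s.2.size ≤ b) (i : ℕ) :
    (loopFrom s (fun _ s => if s.2.ent c = 0 then s else (s.2, subMul n c s.1 s.2)) i).1.size ≤ b ∧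
    (loopFrom s (fun _ s => if s.2.ent c = 0 then s else (s.2, subMul n c s.1 s.2)) i).2.size ≤ b :=
  loopFrom_induction (P := fun _ (s : Data × Data) => s.1.size ≤ b ∧ s.2.size ≤ b) h
    fun _ _ s hs => by
    split_ifs
    · exact hs
    · exact ⟨hs.2, (size_subMul_le _ _ _ _).trans hb⟩

theorem size_eliminate_loop_le (n c : ℕ) (rows : Data) (i : ℕ) :
    (loopFrom (initialPivot n c, Data.num 0)
      (fun i s => ((euclid n c (s.1, clip n (rows.nth i))).1,
        .pair (euclid n c (s.1, clip n (rows.nth i))).2 s.2)) i).1.size ≤ rowSize n ∧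
    (loopFrom (initialPivot n c, Data.num 0)
      (fun i s => ((euclid n c (s.1, clip n (rows.nth i))).1,
        .pair (euclid n c (s.1, clip n (rows.nth i))).2 s.2)) i).2.size ≤
      i * (rowSize n + 1) + 1 :=
  loopFrom_induction (P := fun i (s : Data × Data) =>
      s.1.size ≤ rowSize n ∧ s.2.size ≤ i * (rowSize n + 1) + 1)
    ⟨size_initialPivot_le n c, by simp [Data.size]⟩ fun i _ s hs => by
      have h := size_euclid_loop_le (c := c) le_rfl
        (s := (s.1, clip n (rows.nth i))) ⟨hs.1, size_clip_le _ _⟩ (modulus n + 1)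
      refine ⟨h.1, ?_⟩
      have h2 : (euclid n c (s.1, clip n (rows.nth i))).2.size ≤ rowSize n := h.2
      have h3 := hs.2
      simp only [Data.size, add_mul, one_mul] at h2 h3 ⊢
      omega

namespace IsPolyTime

variable {α : Type} [DataCoding α]

@[fun_prop]
theorem subMul {n c : α → ℕ} {p v : α → Data} (hn : IsPolyTime n) (hc : IsPolyTime c)
    (hp : IsPolyTime p) (hv : IsPolyTime v) :
    IsPolyTime fun a => subMul (n a) (c a) (p a) (v a) := by
  unfold _root_.subMul
  fun_prop

@[fun_prop]
theorem clip {n : α → ℕ} {v : α → Data} (hn : IsPolyTime n) (hv : IsPolyTime v) :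
    IsPolyTime fun a => clip (n a) (v a) := by
  unfold _root_.clip
  fun_prop

@[fun_prop]
theorem initialPivot {n c : α → ℕ} (hn : IsPolyTime n) (hc : IsPolyTime c) :
    IsPolyTime fun a => initialPivot (n a) (c a) := by
  unfold _root_.initialPivot
  fun_prop

@[fun_prop]
theorem rowSize {n : α → ℕ} (hn : IsPolyTime n) : IsPolyTime fun a => rowSize (n a) := by
  unfold _root_.rowSize
  fun_prop

@[fun_prop]
theorem euclid {n c : α → ℕ} {s : α → Data × Data} (hn : IsPolyTime n) (hc : IsPolyTime c)
    (hs : IsPolyTime s) : IsPolyTime fun a => euclid (n a) (c a) (s a) := by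
  refine loopFrom (by fun_prop) hs (by fun_prop)
    (b := fun a => 2 * (_root_.codeSize (s a) + _root_.rowSize (n a)) + 1)
    ((PolyBounded.const 2).mul (hs.codeSize.add hn.rowSize.le) |>.add (.const 1)) fun a i _ => ?_
  have := size_euclid_loop_le (n := n a) (c := c a)
    (b := _root_.codeSize (s a) + _root_.rowSize (n a)) (s := s a)
    (Nat.le_add_left _ _) (by simp only [codeSize_prod, codeSize_data]; omega) i
  simp only [codeSize_prod, codeSize_data] at this ⊢
  omega

@[fun_prop]
theorem eliminate {n c k : α → ℕ} {rows : α → Data} (hn : IsPolyTime n) (hc : IsPolyTime c)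
    (hk : IsPolyTime k) (hr : IsPolyTime rows) :
    IsPolyTime fun a => eliminate (n a) (c a) (k a) (rows a) := by
  refine loopFrom hk (by fun_prop) (by fun_prop)
    (b := fun a => _root_.rowSize (n a) + (k a * (_root_.rowSize (n a) + 1) + 1) + 1)
    (IsPolyTime.le (by fun_prop)) fun a i hi => ?_
  have h := size_eliminate_loop_le (n a) (c a) (rows a) i
  have := Nat.mul_le_mul_right (_root_.rowSize (n a) + 1) hi.le
  simp only [codeSize_prod, codeSize_data]
  omega

@[fun_prop]
theorem memSpan {n k : α → ℕ} {rows x : α → Data} (hn : IsPolyTime n) (hk : IsPolyTime k)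
    (hr : IsPolyTime rows) (hx : IsPolyTime x) :
    IsPolyTime fun a => memSpan (n a) (k a) (rows a) (x a) := by
  refine loopFrom_of_le_max (by fun_prop) (by fun_prop) (by fun_prop)
    (b := fun a => (k a * (_root_.rowSize (n a) + 1) + 1) + (_root_.rowSize (n a) + 2 + 1) + 1)
    (IsPolyTime.le (by fun_prop)) fun a c s => le_max_of_le_right ?_
  have h1 : (_root_.eliminate (n a) c (k a) s.1).2.size ≤ _ :=
    (size_eliminate_loop_le (n a) c s.1 (k a)).2
  have h2 := size_subMul_le (n a) c s.2.1 (_root_.eliminate (n a) c (k a) s.1).1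
  have h3 : ∀ b : Bool, _root_.codeSize b ≤ 2 := fun b => by cases b <;> decide
  have h4 := h3 (s.2.2 && decide ((_root_.subMul (n a) c s.2.1
    (_root_.eliminate (n a) c (k a) s.1).1).ent c = 0))
  simp only [codeSize_prod, codeSize_data]
  omega

end IsPolyTime

/-! ### Correctness of the elimination -/

/-- The vector over `ℤ/q` that a datum represents. -/
def rowVec (n : ℕ) (d : Data) : Vec n := fun j => (d.ent j : ZMod (modulus n))

/-- The vector that a datum represents, together with its coordinate `c` as an integer. The row
operations act on these pairs, and `(q, 0)` is the pivot row that the elimination starts from. -/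
def rowLift (n c : ℕ) (d : Data) : ℤ × Vec n := (d.ent c, rowVec n d)

/-- Rows with entries in `{0, …, q}` whose first `c` coordinates are zero. -/
def IsRow (n c : ℕ) (d : Data) : Prop :=
  (∀ j < dim n, d.ent j ≤ modulus n) ∧ ∀ j < dim n, j < c → d.ent j = 0

theorem Data.ent_tab {N j : ℕ} (hj : j < N) (f : ℕ → ℕ) :
    (Data.tab N fun j => .num (f j)).ent j = f j := by
  rw [Data.ent, Data.nth_tab hj]; rfl

section

variable {n c : ℕ} {p v : Data}

theorem rowVec_subMul (hv : ∀ j < dim n, v.ent j ≤ modulus n) :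
    rowVec n (subMul n c p v) = rowVec n p - ((p.ent c / v.ent c : ℕ) : ℤ) • rowVec n v := by
  ext j
  rw [rowVec, subMul, Data.ent_tab j.2, ZMod.natCast_mod]
  generalize p.ent c / v.ent c = d
  push_cast [Nat.cast_sub (hv j j.2)]
  simp [rowVec, sub_eq_add_neg]

theorem ent_subMul (hc : c < dim n) (hv : ∀ j < dim n, v.ent j ≤ modulus n)
    (h0 : 0 < v.ent c) : (subMul n c p v).ent c = p.ent c % v.ent c := by
  rw [subMul, Data.ent_tab hc]
  have h1 := hv c hc
  have h2 := Nat.div_add_mod (p.ent c) (v.ent c)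
  have h3 := Nat.mod_lt (p.ent c) h0
  have h4 : p.ent c + p.ent c / v.ent c * (modulus n - v.ent c) =
      p.ent c % v.ent c + modulus n * (p.ent c / v.ent c) := by
    obtain ⟨e, he⟩ := Nat.exists_eq_add_of_le h1
    rw [he, Nat.add_sub_cancel_left]
    nlinarith
  rw [h4, Nat.add_mul_mod_self_left, Nat.mod_eq_of_lt (by omega)]

theorem rowLift_subMul (hc : c < dim n) (hv : ∀ j < dim n, v.ent j ≤ modulus n)
    (h0 : 0 < v.ent c) : rowLift n c (subMul n c p v) =
      rowLift n c p - ((p.ent c / v.ent c : ℕ) : ℤ) • rowLift n c v := by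
  refine Prod.ext ?_ (rowVec_subMul hv)
  rw [rowLift, ent_subMul hc hv h0, Nat.mod_def, Nat.cast_sub (Nat.mul_div_le _ _)]
  simp [rowLift, mul_comm]

theorem IsRow.subMul {c' : ℕ} (hp : IsRow n c' p) (hv : IsRow n c' v) :
    IsRow n c' (subMul n c p v) := by
  refine ⟨fun j hj => ?_, fun j hj hjc => ?_⟩
  · rw [_root_.subMul, Data.ent_tab hj]
    exact (Nat.mod_lt _ (modulus_pos n)).le
  · rw [_root_.subMul, Data.ent_tab hj, hp.2 j hj hjc, hv.2 j hj hjc]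
    simp

theorem ent_clip (hv : ∀ j < dim n, v.ent j ≤ modulus n) {j : ℕ} (hj : j < dim n) :
    (clip n v).ent j = v.ent j := by
  rw [clip, Data.ent_tab hj, min_eq_left (hv j hj)]

theorem rowLift_clip (hc : c < dim n) (hv : ∀ j < dim n, v.ent j ≤ modulus n) :
    rowLift n c (clip n v) = rowLift n c v := by
  rw [rowLift, rowLift, ent_clip hv hc]
  congr 1
  ext j
  rw [rowVec, ent_clip hv j.2]; rfl

theorem IsRow.clip {c' : ℕ} (hv : IsRow n c' v) : IsRow n c' (clip n v) := by
  refine ⟨fun j hj => ?_, fun j hj hjc => ?_⟩ <;> rw [ent_clip hv.1 hj]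
  exacts [hv.1 j hj, hv.2 j hj hjc]

theorem AddSubgroup.closure_insert_sub_zsmul {G : Type*} [AddCommGroup G] (a b : G) (d : ℤ)
    (T : Set G) : closure (insert b (insert (a - d • b) T)) = closure (insert a (insert b T)) := by
  refine le_antisymm ((closure_le _).2 ?_) ((closure_le _).2 ?_)
  · rintro x (rfl | rfl | hx)
    · exact subset_closure (by simp)
    · exact sub_mem (subset_closure (by simp)) (zsmul_mem (subset_closure (by simp)) d)
    · exact subset_closure (by simp [hx])
  · rintro x (rfl | rfl | hx)
    · rw [← sub_add_cancel x (d • b)]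
      exact add_mem (subset_closure (by simp)) (zsmul_mem (subset_closure (by simp)) d)
    · exact subset_closure (by simp)
    · exact subset_closure (by simp [hx])

/-- The Euclidean algorithm makes the coordinate of the second row zero, and preserves the
span. -/
theorem euclid_spec (hc : c < dim n) (hp : IsRow n c p) (hp0 : 0 < p.ent c) (hv : IsRow n c v) :
    IsRow n c (euclid n c (p, v)).1 ∧ 0 < (euclid n c (p, v)).1.ent c ∧
    IsRow n (c + 1) (euclid n c (p, v)).2 ∧
    ∀ T, AddSubgroup.closure (insert (rowLift n c (euclid n c (p, v)).1)
      (insert (rowLift n c (euclid n c (p, v)).2) T)) =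
      AddSubgroup.closure (insert (rowLift n c p) (insert (rowLift n c v) T)) := by
  have key := loopFrom_induction (N := modulus n + 1)
    (F := fun _ s => if s.2.ent c = 0 then s else (s.2, subMul n c s.1 s.2)) (s := (p, v))
    (P := fun i (s : Data × Data) => IsRow n c s.1 ∧ 0 < s.1.ent c ∧ IsRow n c s.2 ∧
      (s.2.ent c = 0 ∨ s.2.ent c + i ≤ modulus n) ∧
      ∀ T, AddSubgroup.closure (insert (rowLift n c s.1) (insert (rowLift n c s.2) T)) =
        AddSubgroup.closure (insert (rowLift n c p) (insert (rowLift n c v) T)))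
    ⟨hp, hp0, hv, Or.inr (hv.1 c hc), fun _ => rfl⟩ (by
      rintro i - ⟨p', v'⟩ ⟨h1, h2, h3, h4, h5⟩
      dsimp only at *
      split_ifs with h0
      · exact ⟨h1, h2, h3, Or.inl h0, h5⟩
      · have h0' := Nat.pos_of_ne_zero h0
        refine ⟨h3, h0', h1.subMul h3, ?_, fun T => ?_⟩
        · dsimp only
          rw [ent_subMul hc h3.1 h0']
          have := Nat.mod_lt (p'.ent c) h0'
          omega
        · dsimp only
          rw [rowLift_subMul hc h3.1 h0', AddSubgroup.closure_insert_sub_zsmul, h5])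
  obtain ⟨h1, h2, h3, h4, h5⟩ := key
  refine ⟨h1, h2, ⟨h3.1, fun j hj hjc => ?_⟩, h5⟩
  obtain hjc | rfl := Nat.lt_succ_iff_lt_or_eq.1 hjc
  · exact h3.2 j hj hjc
  · exact h4.resolve_right (by omega)

theorem initialPivot_spec (hc : c < dim n) : IsRow n c (initialPivot n c) ∧
    (initialPivot n c).ent c = modulus n ∧
    rowLift n c (initialPivot n c) = ((modulus n : ℤ), 0) := by
  have h : (initialPivot n c).ent c = modulus n := by simp [initialPivot, Data.ent_tab hc]
  refine ⟨⟨fun j hj => ?_, fun j hj hjc => ?_⟩, h, Prod.ext (by simp [rowLift, h]) ?_⟩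
  · rw [initialPivot, Data.ent_tab hj]; split_ifs <;> omega
  · rw [initialPivot, Data.ent_tab hj, if_neg (by omega)]
  · ext j
    simp only [rowLift, rowVec, initialPivot, Data.ent_tab j.2]
    split_ifs <;> simp

/-- The elimination of coordinate `c` preserves the span of the rows and `(q, 0)`. -/
theorem eliminate_spec (hc : c < dim n) {l : List Data} (hl : ∀ d ∈ l, IsRow n c d) :
    IsRow n c (eliminate n c l.length (.ofList l)).1 ∧
    0 < (eliminate n c l.length (.ofList l)).1.ent c ∧
    ∃ l' : List Data, (eliminate n c l.length (.ofList l)).2 = .ofList l' ∧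
      l'.length = l.length ∧ (∀ d ∈ l', IsRow n (c + 1) d) ∧
      AddSubgroup.closure (insert (rowLift n c (eliminate n c l.length (.ofList l)).1)
        (rowLift n c '' {d | d ∈ l'})) =
      AddSubgroup.closure (insert ((modulus n : ℤ), 0) (rowLift n c '' {d | d ∈ l})) := by
  have key := loopFrom_induction (N := l.length) (s := (initialPivot n c, Data.num 0))
    (F := fun i s => ((euclid n c (s.1, clip n ((Data.ofList l).nth i))).1,
      .pair (euclid n c (s.1, clip n ((Data.ofList l).nth i))).2 s.2))
    (P := fun i (s : Data × Data) => IsRow n c s.1 ∧ 0 < s.1.ent c ∧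
      ∃ l' : List Data, s.2 = .ofList l' ∧ l'.length = i ∧ (∀ d ∈ l', IsRow n (c + 1) d) ∧
        AddSubgroup.closure (insert (rowLift n c s.1) (rowLift n c '' {d | d ∈ l'})) =
        AddSubgroup.closure (insert ((modulus n : ℤ), 0) (rowLift n c '' {d | d ∈ l.take i})))
    (by
      obtain ⟨h1, h2, h3⟩ := initialPivot_spec hc
      exact ⟨h1, by rw [h2]; exact modulus_pos n, [], rfl, rfl, by simp, by simp [h3]⟩)
    (by
      rintro i hi ⟨p, acc⟩ ⟨h1, h2, l', rfl, h4, h5, h6⟩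
      dsimp only at *
      have hrow := hl _ (List.getElem_mem hi)
      rw [Data.nth_ofList l hi]
      obtain ⟨e1, e2, e3, e4⟩ := euclid_spec hc h1 h2 hrow.clip
      refine ⟨e1, e2, (euclid n c (p, clip n l[i])).2 :: l', rfl, by simp [h4], ?_, ?_⟩
      · simpa [e3] using h5
      · have hset : ∀ (d : Data) (l : List Data), {x | x ∈ d :: l} = insert d {x | x ∈ l} := by
          intro d l; ext; simp
        have htake : {x | x ∈ l.take (i + 1)} = insert l[i] {x | x ∈ l.take i} := by
          ext x
          rw [List.take_succ_eq_append_getElem hi]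
          simp only [Set.mem_ofPred_eq, Set.mem_insert_iff, List.mem_append, List.mem_singleton]
          exact or_comm
        rw [hset, Set.image_insert_eq, e4, rowLift_clip hc hrow.1, htake, Set.image_insert_eq,
          Set.insert_comm, Set.insert_eq, AddSubgroup.closure_union, h6,
          ← AddSubgroup.closure_union, ← Set.insert_eq, Set.insert_comm])
  rw [List.take_length] at key
  exact key

/-- The span of rows, as vectors over `ℤ/q`. -/
def rowSpan (n : ℕ) (l : List Data) : AddSubgroup (Vec n) :=
  AddSubgroup.closure (rowVec n '' {d | d ∈ l})

theorem map_snd_closure_rowLift (n c : ℕ) (l : List Data) :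
    (AddSubgroup.closure (rowLift n c '' {d | d ∈ l})).map (AddMonoidHom.snd ℤ (Vec n)) =
      rowSpan n l := by
  rw [AddMonoidHom.map_closure, Set.image_image]; rfl

theorem mem_closure_insert_iff {G : Type*} [AddCommGroup G] {a x : G} {T : Set G} :
    x ∈ AddSubgroup.closure (insert a T) ↔ ∃ d : ℤ, x - d • a ∈ AddSubgroup.closure T := by
  rw [Set.insert_eq, AddSubgroup.closure_union, ← AddSubgroup.zmultiples_eq_closure,
    AddSubgroup.mem_sup]
  constructor
  · rintro ⟨y, hy, z, hz, rfl⟩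
    obtain ⟨d, rfl⟩ := AddSubgroup.mem_zmultiples_iff.1 hy
    exact ⟨d, by simpa using hz⟩
  · rintro ⟨d, hd⟩
    exact ⟨d • a, AddSubgroup.mem_zmultiples_iff.2 ⟨d, rfl⟩, _, hd, by abel⟩

/-- Integer lifts of elements of the span are congruent to the coordinate. -/
theorem fst_of_mem_closure_rowLift (hc : c < dim n) {l : List Data} {z : ℤ × Vec n}
    (hz : z ∈ AddSubgroup.closure (rowLift n c '' {d | d ∈ l})) :
    ((z.1 : ℤ) : ZMod (modulus n)) = z.2 ⟨c, hc⟩ := by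
  induction hz using AddSubgroup.closure_induction with
  | mem z hz =>
    obtain ⟨d, -, rfl⟩ := hz
    simp [rowLift, rowVec]
  | zero => simp
  | add z z' _ _ h h' => simp [h, h']
  | neg z _ h => simp [h]

/-- Reduction of a vector by the pivot row. -/
theorem mem_rowSpan_iff (hc : c < dim n) {l l' : List Data} (hp : IsRow n c p)
    (hp0 : 0 < p.ent c) (hl' : ∀ d ∈ l', IsRow n (c + 1) d)
    (h : AddSubgroup.closure (insert (rowLift n c p) (rowLift n c '' {d | d ∈ l'})) =
      AddSubgroup.closure (insert ((modulus n : ℤ), 0) (rowLift n c '' {d | d ∈ l}))) (x : Data) :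
    rowVec n x ∈ rowSpan n l ↔
      (subMul n c x p).ent c = 0 ∧ rowVec n (subMul n c x p) ∈ rowSpan n l' := by
  rw [ent_subMul hc hp.1 hp0, rowVec_subMul hp.1]
  constructor
  · intro hx
    rw [← map_snd_closure_rowLift n c] at hx
    obtain ⟨⟨a, w⟩, haw, rfl : w = rowVec n x⟩ := hx
    have ha := fst_of_mem_closure_rowLift hc haw
    have hmem : ((x.ent c : ℤ), rowVec n x) ∈ AddSubgroup.closure
        (insert (rowLift n c p) (rowLift n c '' {d | d ∈ l'})) := by
      rw [h, mem_closure_insert_iff]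
      have : ((modulus n : ℕ) : ℤ) ∣ x.ent c - a := by
        rw [← ZMod.intCast_zmod_eq_zero_iff_dvd]
        push_cast
        rw [ha]
        simp [rowVec]
      obtain ⟨t, ht⟩ := this
      refine ⟨t, ?_⟩
      have : ((x.ent c : ℤ), rowVec n x) - t • ((modulus n : ℤ), (0 : Vec n)) =
          (a, rowVec n x) := by
        refine Prod.ext ?_ (by simp)
        simp only [Prod.fst_sub, Prod.smul_fst, smul_eq_mul]; linarith
      rw [this]
      exact haw
    obtain ⟨d, hd⟩ := mem_closure_insert_iff.1 hmem
    -- The remaining rows vanish in coordinate `c`.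
    have hfst : ∀ z ∈ AddSubgroup.closure (rowLift n c '' {d | d ∈ l'}), z.1 = 0 := by
      intro z hz
      induction hz using AddSubgroup.closure_induction with
      | mem z hz =>
        obtain ⟨d, hd, rfl⟩ := hz
        simp [rowLift, (hl' d hd).2 c hc (by omega)]
      | zero => rfl
      | add z z' _ _ h h' => simp [h, h']
      | neg z _ h => simp [h]
    have h1 : (x.ent c : ℤ) = p.ent c * d := by
      have := hfst _ hd
      simp only [rowLift, Prod.fst_sub, Prod.smul_fst, smul_eq_mul] at this
      linarith
    have h2 : ((x.ent c / p.ent c : ℕ) : ℤ) = d := by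
      rw [Int.natCast_div, h1, Int.mul_ediv_cancel_left _ (by omega)]
    refine ⟨Nat.mod_eq_zero_of_dvd (Int.natCast_dvd_natCast.1 ⟨d, h1⟩), ?_⟩
    rw [h2, ← map_snd_closure_rowLift n c]
    exact ⟨_, hd, rfl⟩
  · rintro ⟨-, hx⟩
    have hle : ∀ z ∈ AddSubgroup.closure (insert (rowLift n c p) (rowLift n c '' {d | d ∈ l'})),
        z.2 ∈ rowSpan n l := by
      intro z hz
      rw [h, mem_closure_insert_iff] at hz
      obtain ⟨d, hd⟩ := hz
      rw [← map_snd_closure_rowLift n c]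
      exact ⟨_, hd, by simp⟩
    have h1 : rowVec n p ∈ rowSpan n l :=
      hle (rowLift n c p) (AddSubgroup.subset_closure (Set.mem_insert _ _))
    have h2 : rowSpan n l' ≤ rowSpan n l := by
      rw [← map_snd_closure_rowLift n c l']
      rintro _ ⟨z, hz, rfl⟩
      exact hle z (AddSubgroup.closure_mono (Set.subset_insert _ _) hz)
    rw [← sub_add_cancel (rowVec n x) (((x.ent c / p.ent c : ℕ) : ℤ) • rowVec n p)]
    exact add_mem (h2 hx) (zsmul_mem h1 _)

theorem memSpan_iff {l : List Data} (hl : ∀ d ∈ l, IsRow n 0 d) (x : Data) :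
    (memSpan n l.length (.ofList l) x).2.2 = true ↔ rowVec n x ∈ rowSpan n l := by
  obtain ⟨l', -, -, h3, h4, h5⟩ := loopFrom_induction (N := dim n) (s := (Data.ofList l, x, true))
    (F := fun c s => ((eliminate n c l.length s.1).2,
      subMul n c s.2.1 (eliminate n c l.length s.1).1,
      s.2.2 && decide ((subMul n c s.2.1 (eliminate n c l.length s.1).1).ent c = 0)))
    (P := fun c (s : Data × Data × Bool) => ∃ l' : List Data, s.1 = .ofList l' ∧
      l'.length = l.length ∧ (∀ d ∈ l', IsRow n c d) ∧
      (rowVec n x ∈ rowSpan n l ↔ s.2.2 = true ∧ rowVec n s.2.1 ∈ rowSpan n l') ∧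
      (s.2.2 = true → ∀ j < dim n, j < c → s.2.1.ent j = 0))
    ⟨l, rfl, rfl, hl, by simp, by simp⟩ (by
      rintro c hc ⟨rows, x', ok⟩ ⟨l', rfl, h2, h3, h4, h5⟩
      dsimp only at *
      rw [← h2]
      obtain ⟨e1, e2, l'', e3, e4, e5, e6⟩ := eliminate_spec hc h3
      refine ⟨l'', e3, e4, e5, ?_, ?_⟩
      · rw [h4, mem_rowSpan_iff hc e1 e2 e5 e6, Bool.and_eq_true, decide_eq_true_eq, and_assoc]
      · rw [Bool.and_eq_true, decide_eq_true_eq]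
        rintro ⟨hok, h0⟩ j hj hjc
        obtain hjc | rfl := Nat.lt_succ_iff_lt_or_eq.1 hjc
        · rw [subMul, Data.ent_tab hj, h5 hok j hj hjc, e1.2 j hj hjc]
          simp
        · exact h0)
  rw [h4]
  refine (and_iff_left_of_imp fun hok => ?_).symm
  have : rowVec n (memSpan n l.length (.ofList l) x).2.1 = 0 := by
    ext j
    exact (congrArg Nat.cast (h5 hok j j.2 j.2)).trans Nat.cast_zero
  exact this ▸ zero_mem _

theorem rowVec_ofVec (v : Vec n) : rowVec n (.ofVec v) = v := by
  ext j
  rw [rowVec, Data.ent_ofVec, ZMod.natCast_zmod_val]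

theorem memSpan_ofVecs {k : ℕ} (S : Fin k → Vec n) (x : Vec n) :
    (memSpan n k (.ofVecs S) (.ofVec x)).2.2 = true ↔
      x ∈ AddSubgroup.closure (Set.range S) := by
  have h := memSpan_iff (n := n) (l := List.ofFn fun i => Data.ofVec (S i)) (fun d hd => by
    obtain ⟨i, rfl⟩ := List.mem_ofFn.1 hd
    exact ⟨fun j hj => (Data.ent_ofVec (S i) ⟨j, hj⟩).trans_le (ZMod.val_lt _).le,
      fun j _ h => absurd h (by omega)⟩) (.ofVec x)
  rw [List.length_ofFn, rowVec_ofVec] at h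
  have hset : rowVec n '' {d | d ∈ List.ofFn fun i => Data.ofVec (S i)} = Set.range S := by
    ext y
    simp [List.mem_ofFn, rowVec_ofVec]
  rw [rowSpan, hset] at h
  exact h

end

/-! ### Learnability -/

/-- Random elements of a finite abelian group generate it: otherwise they are all in the kernel of
a nontrivial character, and kernels of nontrivial characters have index at least `2`. -/
theorem card_closure_ne_top_le (V : Type) [AddCommGroup V] [Fintype V] (k : ℕ) [DecidablePred
    fun σ : Fin k → V => AddSubgroup.closure (Set.range σ) ≠ ⊤] :
    (Finset.univ.filter fun σ : Fin k → V => AddSubgroup.closure (Set.range σ) ≠ ⊤).card * 2 ^ k ≤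
      Fintype.card V * Fintype.card V ^ k := by
  classical
  let K : AddChar V ℂ → Finset V := fun ψ => Finset.univ.filter fun v => ψ v = 1
  have hsub : (Finset.univ.filter fun σ : Fin k → V => AddSubgroup.closure (Set.range σ) ≠ ⊤) ⊆
      (Finset.univ.filter fun ψ : AddChar V ℂ => ∃ v, ψ v ≠ 1).biUnion
        fun ψ => Fintype.piFinset fun _ => K ψ := by
    intro σ hσ
    obtain ⟨v, hv⟩ : ∃ v, v ∉ AddSubgroup.closure (Set.range σ) := by
      by_contra! h
      exact (Finset.mem_filter.1 hσ).2 ((AddSubgroup.eq_top_iff' _).2 h)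
    obtain ⟨ψ, hψ⟩ := AddChar.exists_apply_ne_zero.2
      (mt (QuotientAddGroup.eq_zero_iff v).1 hv)
    simp only [Finset.mem_biUnion, Finset.mem_filter, Finset.mem_univ, true_and,
      Fintype.mem_piFinset, K]
    refine ⟨ψ.compAddMonoidHom (QuotientAddGroup.mk' _), ⟨v, hψ⟩, fun i => ?_⟩
    have : ((σ i : V) : V ⧸ AddSubgroup.closure (Set.range σ)) = 0 :=
      (QuotientAddGroup.eq_zero_iff _).2 (AddSubgroup.subset_closure ⟨i, rfl⟩)
    rw [AddChar.compAddMonoidHom_apply, QuotientAddGroup.mk'_apply, this, AddChar.map_zero_eq_one]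
  have hK : ∀ ψ : AddChar V ℂ, (∃ v, ψ v ≠ 1) → (K ψ).card * 2 ≤ Fintype.card V := by
    rintro ψ ⟨v, hv⟩
    have h1 : (K ψ).card ≤ (Finset.univ.filter fun v => ¬ψ v = 1).card := by
      refine Finset.card_le_card_of_injOn (· + v) (fun w hw => ?_)
        fun _ _ _ _ h => add_right_cancel h
      have hw : ψ w = 1 := (Finset.mem_filter.1 hw).2
      simp [AddChar.map_add_eq_mul, hw, hv]
    have h2 := Finset.card_filter_add_card_filter_not (s := (Finset.univ : Finset V)) fun v => ψ v = 1
    rw [Finset.card_univ] at h2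
    change (Finset.univ.filter fun v => ψ v = 1).card * 2 ≤ _
    change (Finset.univ.filter fun v => ψ v = 1).card ≤ _ at h1
    omega
  calc _ ≤ (∑ ψ ∈ Finset.univ.filter fun ψ : AddChar V ℂ => ∃ v, ψ v ≠ 1, (K ψ).card ^ k) *
        2 ^ k := by
        refine Nat.mul_le_mul_right _ ((Finset.card_le_card hsub).trans
          (Finset.card_biUnion_le.trans_eq (Finset.sum_congr rfl fun ψ _ => ?_)))
        rw [Fintype.card_piFinset_const]
    _ = ∑ ψ ∈ Finset.univ.filter fun ψ : AddChar V ℂ => ∃ v, ψ v ≠ 1, ((K ψ).card * 2) ^ k := by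
        rw [Finset.sum_mul]
        exact Finset.sum_congr rfl fun ψ _ => (mul_pow _ _ _).symm
    _ ≤ ∑ ψ ∈ Finset.univ.filter fun ψ : AddChar V ℂ => ∃ v, ψ v ≠ 1, Fintype.card V ^ k :=
        Finset.sum_le_sum fun ψ hψ => Nat.pow_le_pow_left (hK ψ (Finset.mem_filter.1 hψ).2) k
    _ ≤ _ := by
        rw [Finset.sum_const, smul_eq_mul, ← AddChar.card_eq (α := V)]
        exact Nat.mul_le_mul_right _ (Finset.card_le_univ _)

/-- The number of samples used by the learner. -/
noncomputable def learnerSamples : Polynomial ℕ := 3 * Polynomial.X ^ 2 + Polynomial.X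

theorem le_prob_closure_eq_top (n : ℕ) :
    1 - (2⁻¹ : ℝ) ^ n ≤ prob (PMF.uniformOfFintype
      (Fin (learnerSamples.eval n) → Fin n → ZMod (modulus n)))
      {σ | AddSubgroup.closure (Set.range σ) = ⊤} := by
  classical
  set k := learnerSamples.eval n with hk
  have hcard := card_closure_ne_top_le (Fin n → ZMod (modulus n)) k
  have hV : Fintype.card (Fin n → ZMod (modulus n)) ≤ 2 ^ (3 * n ^ 2) := by
    rw [Fintype.card_fun, ZMod.card, Fintype.card_fin]
    refine (Nat.pow_le_pow_left (modulus_le_two_pow n) n).trans_eq ?_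
    rw [← pow_mul]; ring_nf
  have hpow : 2 ^ k = 2 ^ (3 * n ^ 2) * 2 ^ n := by
    rw [hk, learnerSamples, ← pow_add]; simp
  have hsum : prob (PMF.uniformOfFintype (Fin k → Fin n → ZMod (modulus n)))
      {σ | AddSubgroup.closure (Set.range σ) = ⊤} =
      1 - (Finset.univ.filter fun σ : Fin k → Fin n → ZMod (modulus n) =>
        AddSubgroup.closure (Set.range σ) ≠ ⊤).card *
        (Fintype.card (Fin k → Fin n → ZMod (modulus n)) : ℝ)⁻¹ := by
    have h1 := (PMF.uniformOfFintype (Fin k → Fin n → ZMod (modulus n))).sum_toReal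
    rw [← Finset.sum_filter_add_sum_filter_not _
      fun σ => AddSubgroup.closure (Set.range σ) = ⊤] at h1
    rw [prob_eq_sum, ← Finset.sum_filter]
    simp only [uniformOfFintype_toReal, Finset.sum_const, nsmul_eq_mul, Set.mem_ofPred_eq] at h1 ⊢
    simp only [ne_eq]
    linarith
  rw [hsum]
  refine sub_le_sub_left ?_ _
  have hpos : (0 : ℝ) < Fintype.card (Fin k → Fin n → ZMod (modulus n)) := by
    exact_mod_cast Fintype.card_pos
  rw [← div_eq_mul_inv, div_le_iff₀ hpos, inv_pow, ← div_eq_inv_mul, le_div_iff₀ (by positivity)]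
  have h2 : (Finset.univ.filter fun σ : Fin k → Fin n → ZMod (modulus n) =>
      AddSubgroup.closure (Set.range σ) ≠ ⊤).card * 2 ^ n ≤
      Fintype.card (Fin k → Fin n → ZMod (modulus n)) := by
    rw [hpow] at hcard
    rw [Fintype.card_fun (α := Fin k), Fintype.card_fin]
    refine Nat.le_of_mul_le_mul_left (c := 2 ^ (3 * n ^ 2)) ?_ (by positivity)
    calc _ ≤ _ := (by ring_nf; rfl : _ ≤ _ * (2 ^ (3 * n ^ 2) * 2 ^ n)).trans hcard
      _ ≤ _ := Nat.mul_le_mul_right _ hV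
  exact_mod_cast h2

/-- The second class is disjoint from the row space, as the trapdoor classifier tells them
apart. -/
theorem vecMul_ne_classShift {n : ℕ} {A : LatticeMatrix n} {T : TrapdoorMatrix n}
    (hAT : A * T = 0) (hT : ∀ i j, T i j = 0 ∨ T i j = 1)
    (hodd : ∃ j, Odd (Finset.univ.filter fun i => T i j = 1).card ∧ ∃ i, T i j = 0)
    (hm : 2 * dim n ^ 2 < modulus n) (s : Fin n → ZMod (modulus n)) :
    Matrix.vecMul s A ≠ classShift n true := by
  intro h
  have h0 : linfDist (classShift n true) (classShift n true) = 0 := by simp [linfDist]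
  have h1 := trapdoorClassifier_of_linfDist_le (b := false) (x := classShift n true)
    (y := classShift n true) hAT hT hodd hm (mem_support_classDist.2 ⟨s, by simp [h]⟩) (by simp [h0])
  have h2 := trapdoorClassifier_of_linfDist_le (b := true) (x := classShift n true)
    (y := classShift n true) hAT hT hodd hm
    (mem_support_classDist.2 ⟨0, by simp [classShift]⟩) (by simp [h0])
  simp [h1] at h2

/-- The learner outputs its samples of the first class, and the classifier tests membership in
their span. -/
theorem exists_learner {TS : (n : ℕ) → PMF (LatticeMatrix n × TrapdoorMatrix n)}
    (hTS : IsTrapdoorSampler TS) :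
    ∃ (k : Polynomial ℕ) (L : PPT) (R : Prog) (ν : ℕ → ℝ), R.PolyTime ∧ Negligible ν ∧
      ∀ n, 1 - ν n ≤ prob (learningExperiment TS k L n) {p | ClassifiesWell R p.1 p.2} := by
  obtain ⟨L, hL⟩ := (show IsPolyTime fun z : (ℕ × Data × Data) × Data => z.1.2.1 by
    fun_prop).exists_ppt 0
  obtain ⟨R, hR, hR'⟩ : IsPolyTime fun z : ℕ × Data × Data =>
      !(memSpan z.1 (learnerSamples.eval z.1) z.2.1 z.2.2).2.2 := by fun_prop
  -- The failure probability, cut off at zero.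
  refine ⟨learnerSamples, L, R, fun n => max (1 - prob (learningExperiment TS learnerSamples L n)
    {p | ClassifiesWell R p.1 p.2}) 0, hR, ?_, fun n => by
      linarith [le_max_left (1 - prob (learningExperiment TS learnerSamples L n)
        {p | ClassifiesWell R p.1 p.2}) 0]⟩
  refine (negligible_pow (r := 2⁻¹) (by norm_num) (by norm_num)).of_eventually_le
    (fun n => le_max_right _ _) ?_
  filter_upwards [hTS.odd_column, eventually_two_mul_dim_sq_lt] with n hodd hm
  refine max_le ?_ (by positivity)
  rw [sub_le_comm]
  refine le_prob_bind fun z hz => (le_prob_closure_eq_top n).trans ?_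
  have htrain : train L (learnerSamples.eval n) z.1 = (PMF.uniformOfFintype
      (Fin (learnerSamples.eval n) → Fin n → ZMod (modulus n))).map
      fun s => Data.ofVecs fun l => Matrix.vecMul (s l) z.1 + classShift n false := by
    rw [train_eq]
    have hrun : ∀ S S' : Data, L.run n (.pair (.num n) (.pair S S')) = PMF.pure S := fun S S' =>
      (hL n (n, S, S')).trans (PMF.map_const _ _)
    simp only [hrun, PMF.bind_const]
    rfl
  change _ ≤ prob ((train L (learnerSamples.eval n) z.1).map fun h => (z.1, h)) _
  rw [htrain, PMF.map_comp, prob_map]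
  refine ENNReal.toReal_mono (ne_top_of_le_ne_top ENNReal.one_ne_top (toOuterMeasure_le_one _ _))
    (PMF.toOuterMeasure_mono _ fun σ hσ => ?_)
  have hσ : AddSubgroup.closure (Set.range σ) = ⊤ := hσ.1
  have hspan : ∀ x : Vec n, x ∈ AddSubgroup.closure (Set.range fun l =>
      Matrix.vecMul (σ l) z.1 + classShift n false) ↔ ∃ s, Matrix.vecMul s z.1 = x := by
    intro x
    have h1 : (Set.range fun l => Matrix.vecMul (σ l) z.1 + classShift n false) =
        (Matrix.vecMulLinear z.1).toAddMonoidHom '' Set.range σ := by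
      rw [← Set.range_comp]
      congr 1
      ext1 l
      simp [classShift]
    rw [h1, ← AddMonoidHom.map_closure, hσ]
    simp [AddSubgroup.mem_map]
  intro b
  rw [prob_eq_one]
  · norm_num
  · intro x hx
    obtain ⟨s, hs⟩ := mem_support_classDist.1 hx
    refine (hR' (.pair (.num n) (.pair _ (.ofVec x)))).trans (congrArg Data.ofBool ?_)
    have hmem := (memSpan_ofVecs (fun l => Matrix.vecMul (σ l) z.1 + classShift n false) x).trans
      (hspan x)
    change (!(memSpan n (learnerSamples.eval n) _ (.ofVec x)).2.2) = b
    cases b with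
    | false =>
      rw [Bool.not_eq_false']
      exact hmem.2 ⟨s, by simpa using hs⟩
    | true =>
      rw [Bool.not_eq_true', Bool.eq_false_iff]
      intro h
      obtain ⟨s', hs'⟩ := hmem.1 h
      refine vecMul_ne_classShift (hTS.mul_eq_zero n z hz) (hTS.zero_one n z hz) (hodd z hz) hm
        (s' - s) ?_
      rw [Matrix.sub_vecMul, hs', ← hs]
      simp [classShift]

/-! ### The leftover hash lemma for kernels of random matrices -/

section

theorem card_fiber_mul_card {M G : Type*} [AddGroup M] [AddGroup G] [Fintype M] [Fintype G]
    [DecidableEq G] (φ : M →+ G) (hφ : Function.Surjective φ) (g : G) :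
    (Finset.univ.filter fun a => φ a = g).card * Fintype.card G = Fintype.card M := by
  have h := Finset.card_eq_sum_card_fiberwise (s := (Finset.univ : Finset M)) (t := Finset.univ)
    (f := φ) fun a _ => Finset.mem_univ (φ a)
  rw [Finset.sum_congr rfl fun g' _ => AddMonoidHom.card_fiber_eq_of_mem_range φ (hφ g') (hφ g),
    Finset.sum_const, smul_eq_mul] at h
  exact (mul_comm _ _).trans h.symm

variable {ι J R : Type} [Fintype J] [CommRing R]

/-- For `e` with `e ⬝ t = 1`, the projection of the matrices onto those that annihilate `t`, along
those of the form `w eᵀ`. -/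
def annihilate (e t : J → R) (V : Matrix ι J R) : Matrix ι J R :=
  V - Matrix.vecMulVec (V.mulVec t) e

theorem annihilate_mulVec {e t : J → R} (h : e ⬝ᵥ t = 1) (V : Matrix ι J R) :
    (annihilate e t V).mulVec t = 0 := by
  rw [annihilate, Matrix.sub_mulVec, Matrix.vecMulVec_mulVec, h]
  simp

variable [Fintype ι] [DecidableEq ι] [DecidableEq J] [Fintype R] [DecidableEq R]

theorem card_annihilate_fiber {e t : J → R} (h : e ⬝ᵥ t = 1) (A : Matrix ι J R) :
    (Finset.univ.filter fun V => annihilate e t V = A).card =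
      if A.mulVec t = 0 then Fintype.card (ι → R) else 0 := by
  split_ifs with hA
  · refine Finset.card_bij' (t := Finset.univ) (fun V _ => V.mulVec t)
      (fun w _ => A + Matrix.vecMulVec w e) (by simp) (fun w _ => ?_) (fun V hV => ?_)
      fun w _ => ?_
    · rw [Finset.mem_filter, annihilate, Matrix.add_mulVec, Matrix.vecMulVec_mulVec, h, hA]
      simp
    · rw [← (Finset.mem_filter.1 hV).2, annihilate, sub_add_cancel]
    · rw [Matrix.add_mulVec, Matrix.vecMulVec_mulVec, h, hA]
      simp
  · rw [Finset.card_eq_zero, Finset.filter_false_of_mem]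
    rintro V - rfl
    exact hA (annihilate_mulVec h V)

theorem card_mulVec_eq_zero {e t : J → R} (h : e ⬝ᵥ t = 1) :
    (Finset.univ.filter fun A : Matrix ι J R => A.mulVec t = 0).card * Fintype.card (ι → R) =
      Fintype.card (Matrix ι J R) :=
  card_fiber_mul_card (Matrix.mulVec.addMonoidHomLeft t) (fun w => ⟨Matrix.vecMulVec w e, by
    simp [Matrix.mulVec.addMonoidHomLeft, Matrix.vecMulVec_mulVec, h]⟩) 0

/-- The events `A t = 0` and `A t' = 0` are independent. -/
theorem card_mulVec_eq_zero_and {e f t t' : J → R} (h : e ⬝ᵥ t = 1) (h' : e ⬝ᵥ t' = 1)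
    (hf : f ⬝ᵥ (t - t') = 1) :
    (Finset.univ.filter fun A : Matrix ι J R => A.mulVec t = 0 ∧ A.mulVec t' = 0).card *
      Fintype.card (ι → R) ^ 2 = Fintype.card (Matrix ι J R) := by
  have := card_fiber_mul_card
    ((Matrix.mulVec.addMonoidHomLeft t).prod (Matrix.mulVec.addMonoidHomLeft t') :
      Matrix ι J R →+ (ι → R) × (ι → R)) (fun w => ?_) 0
  · rw [Fintype.card_prod, ← sq] at this
    rw [← this]
    congr 3
    ext A
    simp [Matrix.mulVec.addMonoidHomLeft, Prod.ext_iff]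
  · refine ⟨Matrix.vecMulVec (w.2 - (f ⬝ᵥ t') • (w.1 - w.2)) e +
      Matrix.vecMulVec (w.1 - w.2) f, ?_⟩
    have hf' : f ⬝ᵥ t = 1 + f ⬝ᵥ t' := by rw [← hf, dotProduct_sub]; ring
    ext i
    · simp [Matrix.mulVec.addMonoidHomLeft, Matrix.vecMulVec_mulVec, Matrix.add_mulVec, h, hf']
      ring
    · simp [Matrix.mulVec.addMonoidHomLeft, Matrix.vecMulVec_mulVec, Matrix.add_mulVec, h']

/-- A random matrix that annihilates a random vector from a large family is close to uniform. The
second moment of its density counts pairs of vectors annihilated by the same matrix. -/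
theorem statDist_annihilate_sq_le {X : Type} [Fintype X] [Nonempty X] (e : J → R) (t : X → J → R)
    (he : ∀ x, e ⬝ᵥ t x = 1) (hf : ∀ x y, t x ≠ t y → ∃ f, f ⬝ᵥ (t x - t y) = 1) (C : ℕ)
    (hC : ∀ x, (Finset.univ.filter fun y => t x = t y).card ≤ C) :
    (2 * statDist ((PMF.uniformOfFintype (X × Matrix ι J R)).map fun z => annihilate e (t z.1) z.2)
      (PMF.uniformOfFintype (Matrix ι J R))) ^ 2 ≤
      C * Fintype.card (ι → R) / (Fintype.card X : ℝ) := by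
  set p := (PMF.uniformOfFintype (X × Matrix ι J R)).map fun z => annihilate e (t z.1) z.2
  set M : ℝ := (Fintype.card (Matrix ι J R) : ℝ) with hM
  set G : ℝ := (Fintype.card (ι → R) : ℝ) with hG
  set K : ℝ := (Fintype.card X : ℝ) with hK
  have hM0 : 0 < M := by rw [hM]; exact_mod_cast Fintype.card_pos (α := Matrix ι J R)
  have hG0 : 0 < G := by rw [hG]; exact_mod_cast Fintype.card_pos (α := ι → R)
  have hK0 : 0 < K := by rw [hK]; exact_mod_cast Fintype.card_pos (α := X)
  -- For fixed `x`, a matrix that annihilates `t x` has `G` preimages, and other matrices have none.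
  have hp : ∀ A, (p A).toReal = G / (K * M) * ∑ x, if A.mulVec (t x) = 0 then 1 else 0 := by
    intro A
    rw [map_uniform_toReal, Fintype.card_prod, Nat.cast_mul]
    have : (Finset.univ.filter fun z : X × Matrix ι J R => annihilate e (t z.1) z.2 = A).card =
        ∑ x, (Finset.univ.filter fun V => annihilate e (t x) V = A).card := by
      simp only [Finset.card_filter, Fintype.sum_prod_type]
    rw [this, Finset.sum_congr rfl fun x _ => card_annihilate_fiber (he x) A]
    push_cast
    rw [← hG, ← hM, ← hK, Finset.mul_sum, Finset.sum_div]
    exact Finset.sum_congr rfl fun x _ => by split_ifs <;> ring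
  have hpair : ∀ x y, (∑ A : Matrix ι J R, (if A.mulVec (t x) = 0 then (1 : ℝ) else 0) *
      if A.mulVec (t y) = 0 then 1 else 0) ≤ M / G ^ 2 + if t x = t y then M / G else 0 := by
    intro x y
    simp only [← ite_and, mul_ite, mul_one, mul_zero]
    rw [Finset.sum_boole]
    split_ifs with hxy
    · have := card_mulVec_eq_zero (ι := ι) (he x)
      rify at this
      rw [← hG, ← hM, ← eq_div_iff hG0.ne'] at this
      simp only [hxy, and_self] at this ⊢
      rw [this]
      have : 0 ≤ M / G ^ 2 := by positivity
      linarith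
    · obtain ⟨f, hf⟩ := hf x y hxy
      have := card_mulVec_eq_zero_and (ι := ι) (he x) (he y) hf
      rify at this
      rw [← hG, ← hM, ← eq_div_iff (by positivity)] at this
      simp only [and_comm] at this ⊢
      rw [this, add_zero]
  have hsq : ∑ A, (p A).toReal ^ 2 ≤ (1 + C * G / K) / M := by
    calc ∑ A, (p A).toReal ^ 2
        = (G / (K * M)) ^ 2 * ∑ x, ∑ y, ∑ A : Matrix ι J R,
            (if A.mulVec (t x) = 0 then (1 : ℝ) else 0) * if A.mulVec (t y) = 0 then 1 else 0 := by
          simp only [hp, mul_pow, ← Finset.mul_sum]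
          congr 1
          simp only [sq, Finset.sum_mul_sum]
          rw [Finset.sum_comm]
          exact Finset.sum_congr rfl fun x _ => Finset.sum_comm
      _ ≤ (G / (K * M)) ^ 2 * ∑ x : X, (K * (M / G ^ 2) + C * (M / G)) := by
          gcongr with x
          refine (Finset.sum_le_sum fun y _ => hpair x y).trans ?_
          rw [Finset.sum_add_distrib, Finset.sum_const, nsmul_eq_mul, Finset.card_univ,
            ← Finset.sum_filter, Finset.sum_const, nsmul_eq_mul]
          gcongr
          exact hC x
      _ = _ := by
          rw [Finset.sum_const, Finset.card_univ, nsmul_eq_mul, ← hK]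
          field_simp
  calc (2 * statDist p (PMF.uniformOfFintype (Matrix ι J R))) ^ 2
      = (∑ A, |(p A).toReal - M⁻¹|) ^ 2 := by
        simp only [statDist, uniformOfFintype_toReal]
        rw [mul_inv_cancel_left₀ two_ne_zero]
    _ ≤ M * ∑ A, |(p A).toReal - M⁻¹| ^ 2 := sq_sum_le_card_mul_sum_sq
    _ = M * ∑ A, (p A).toReal ^ 2 - 1 := by
        have : ∀ A, |(p A).toReal - M⁻¹| ^ 2 =
            (p A).toReal ^ 2 - 2 * M⁻¹ * (p A).toReal + M⁻¹ ^ 2 := fun A => by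
          rw [sq_abs]; ring
        simp only [this, Finset.sum_add_distrib, Finset.sum_sub_distrib, ← Finset.mul_sum,
          p.sum_toReal, Finset.sum_const, Finset.card_univ, nsmul_eq_mul, ← hM]
        field_simp
        ring
    _ ≤ M * ((1 + C * G / K) / M) - 1 := by gcongr
    _ = _ := by field_simp; ring

end

/-! ### A trapdoor sampler -/

/-- Entry `i` of a trapdoor vector: it begins with `1, 0, b`, where the bit `b` makes the number of
ones odd, and continues with the bits `c 3, c 4, …`. -/
def trapBit (n : ℕ) (c : ℕ → ℕ) (i : ℕ) : ℕ :=
  if i = 0 then 1 else if i = 1 then 0 else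
    if i = 2 then (∑ k ∈ Finset.range (dim n - 3), c (k + 3)) % 2 else c i

/-- Entry `(i, j)` of a random matrix, made of coins `r`. -/
def coinEntry (n : ℕ) (r : Data) (i j : ℕ) : ℕ :=
  residue n (fun l => r.ent ((j + dim n * i) * sampleBits n + l)) (sampleBits n)

/-- The bits of a trapdoor vector are taken from the coins that `coinEntry` does not use. -/
def coinTrap (n : ℕ) (r : Data) (i : ℕ) : ℕ :=
  trapBit n (fun i => r.ent (n * dim n * sampleBits n + i)) i

/-- The sampler chooses a trapdoor vector and a matrix, corrects the first column of the matrix so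
that the matrix annihilates the vector, and outputs a trapdoor all of whose columns are equal. -/
def trapdoorSample (n : ℕ) (r : Data) : Data :=
  .pair (.tab n fun i => .tab (dim n) fun j => .num ((coinEntry n r i j + if j = 0 then
      ∑ k ∈ Finset.range (dim n), (modulus n - coinEntry n r i k) * coinTrap n r k else 0) %
        modulus n))
    (.tab (dim n) fun i => .tab (trapCols n) fun _ => .num (coinTrap n r i % modulus n))

@[fun_prop]
theorem IsPolyTime.coinEntry {α : Type} [DataCoding α] {n i j : α → ℕ} {r : α → Data}
    (hn : IsPolyTime n) (hr : IsPolyTime r) (hi : IsPolyTime i) (hj : IsPolyTime j) :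
    IsPolyTime fun a => coinEntry (n a) (r a) (i a) (j a) := by
  unfold _root_.coinEntry
  fun_prop

@[fun_prop]
theorem IsPolyTime.coinTrap {α : Type} [DataCoding α] {n i : α → ℕ} {r : α → Data}
    (hn : IsPolyTime n) (hr : IsPolyTime r) (hi : IsPolyTime i) :
    IsPolyTime fun a => coinTrap (n a) (r a) (i a) := by
  unfold _root_.coinTrap trapBit
  fun_prop

theorem isPolyTime_trapdoorSample :
    IsPolyTime fun z : ℕ × Data => trapdoorSample z.1 z.2 := by
  unfold trapdoorSample
  fun_prop

/-- The trapdoor vector made of the bits `x`. -/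
def trapVec (n : ℕ) (x : Fin (dim n) → Bool) : Vec n :=
  fun j => trapBit n (Data.ofBits x).ent j

/-- The first unit vector. -/
def firstUnit (n : ℕ) : Vec n := fun j => if (j : ℕ) = 0 then 1 else 0

/-- The matrix made of blocks of coins. -/
def matrixOfBlocks (n : ℕ) (W : Fin (n * dim n) → Fin (sampleBits n) → Bool) : LatticeMatrix n :=
  fun i j => bitsVal (W (finProdFinEquiv (i, j)))

theorem trapBit_congr {n : ℕ} {c c' : ℕ → ℕ} (h : ∀ i < dim n, c i = c' i) {i : ℕ}
    (hi : i < dim n) : trapBit n c i = trapBit n c' i := by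
  unfold trapBit
  rw [h i hi, Finset.sum_congr rfl fun k hk => h (k + 3) (by rw [Finset.mem_range] at hk; omega)]

theorem trapBit_le_one {n : ℕ} (x : Fin (dim n) → Bool) (i : Fin (dim n)) :
    trapBit n (Data.ofBits x).ent i ≤ 1 := by
  unfold trapBit
  split_ifs
  · exact le_rfl
  · exact zero_le_one
  · omega
  · rw [Data.ent_ofBits]; exact Bool.toNat_le _

theorem trapVec_eq_zero_or_one {n : ℕ} (x : Fin (dim n) → Bool) (i : Fin (dim n)) :
    trapVec n x i = 0 ∨ trapVec n x i = 1 := by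
  have := trapBit_le_one x i
  unfold trapVec
  interval_cases trapBit n (Data.ofBits x).ent i <;> simp

theorem sum_range_trapBit {n : ℕ} (h : 3 ≤ dim n) (c : ℕ → ℕ) :
    Odd (∑ i ∈ Finset.range (dim n), trapBit n c i) := by
  rw [show dim n = 3 + (dim n - 3) by omega, Finset.sum_range_add]
  have : ∀ k ∈ Finset.range (dim n - 3), trapBit n c (3 + k) = c (k + 3) := fun k _ => by
    rw [trapBit, if_neg (by omega), if_neg (by omega), if_neg (by omega), add_comm]
  rw [Finset.sum_congr rfl this]
  simp [Finset.sum_range_succ, trapBit, Nat.odd_iff]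
  omega

theorem odd_card_trapVec {n : ℕ} (h : 3 ≤ dim n) (hq : 1 < modulus n)
    (x : Fin (dim n) → Bool) : Odd (Finset.univ.filter fun i => trapVec n x i = 1).card := by
  have := sum_range_trapBit h (Data.ofBits x).ent
  rw [Finset.sum_range] at this
  rw [Finset.card_filter]
  convert this using 2 with i
  have := trapBit_le_one x i
  have : Fact (1 < modulus n) := ⟨hq⟩
  unfold trapVec
  interval_cases trapBit n (Data.ofBits x).ent i <;> simp

theorem trapVec_one {n : ℕ} (h : 1 < dim n) (x : Fin (dim n) → Bool) : trapVec n x ⟨1, h⟩ = 0 := by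
  simp [trapVec, trapBit]

theorem firstUnit_dotProduct_trapVec {n : ℕ} (h : 0 < dim n) (x : Fin (dim n) → Bool) :
    firstUnit n ⬝ᵥ trapVec n x = 1 := by
  rw [dotProduct, Finset.sum_eq_single ⟨0, h⟩]
  · simp [firstUnit, trapVec, trapBit]
  · intro j _ hj
    rw [firstUnit, if_neg fun h => hj (Fin.ext h), zero_mul]
  · simp

/-- Vectors of zeros and ones that differ have a difference with an entry `±1`. -/
theorem exists_dotProduct_trapVec_sub {n : ℕ} {x y : Fin (dim n) → Bool}
    (h : trapVec n x ≠ trapVec n y) : ∃ f, f ⬝ᵥ (trapVec n x - trapVec n y) = 1 := by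
  obtain ⟨j, hj⟩ := Function.ne_iff.1 h
  refine ⟨Pi.single j (trapVec n x j - trapVec n y j), ?_⟩
  rw [single_dotProduct, Pi.sub_apply]
  rcases trapVec_eq_zero_or_one x j with h1 | h1 <;> rcases trapVec_eq_zero_or_one y j with h2 | h2 <;>
    simp_all

/-- A trapdoor vector determines all but the first three of the bits that it is made of. -/
theorem card_trapVec_eq_le {n : ℕ} (h : 3 ≤ dim n) (hq : 1 < modulus n) (x : Fin (dim n) → Bool) :
    (Finset.univ.filter fun y => trapVec n x = trapVec n y).card ≤ 8 := by
  have : Fact (1 < modulus n) := ⟨hq⟩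
  have hcard : (Finset.univ : Finset (Bool × Bool × Bool)).card = 8 := rfl
  rw [← hcard]
  refine Finset.card_le_card_of_injOn
    (fun y => (y ⟨0, by omega⟩, y ⟨1, by omega⟩, y ⟨2, by omega⟩)) (by simp) ?_
  intro y hy y' hy' hyy
  have hv : trapVec n y = trapVec n y' := by
    rw [← (Finset.mem_filter.1 (Finset.mem_coe.1 hy)).2,
      ← (Finset.mem_filter.1 (Finset.mem_coe.1 hy')).2]
  simp only [Prod.mk.injEq] at hyy
  ext j
  by_cases h0 : (j : ℕ) = 0
  · rw [show j = ⟨0, by omega⟩ from Fin.ext h0]; exact hyy.1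
  by_cases h1 : (j : ℕ) = 1
  · rw [show j = ⟨1, by omega⟩ from Fin.ext h1]; exact hyy.2.1
  by_cases h2 : (j : ℕ) = 2
  · rw [show j = ⟨2, by omega⟩ from Fin.ext h2]; exact hyy.2.2
  have := congrFun hv j
  simp only [trapVec, trapBit, if_neg h0, if_neg h1, if_neg h2, Data.ent_ofBits] at this
  cases hy : y j <;> cases hy' : y' j <;> simp_all

/-- The coins spent by the sampler. -/
noncomputable def trapdoorCoins : Polynomial ℕ :=
  Polynomial.X * dimPoly * (4 * Polynomial.X) + dimPoly

theorem le_trapdoorCoins (n : ℕ) :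
    n * dim n * sampleBits n + dim n ≤ trapdoorCoins.eval n := by
  have := dim_le_eval n
  simp only [trapdoorCoins, Polynomial.eval_add, Polynomial.eval_mul, Polynomial.eval_X,
    Polynomial.eval_ofNat, sampleBits]
  gcongr

/-- The coins for the trapdoor. -/
def trapPart {n N : ℕ} (hN : n * dim n * sampleBits n + dim n ≤ N) (r : Fin N → Bool) :
    Fin (dim n) → Bool :=
  fun i => r ⟨n * dim n * sampleBits n + i, by omega⟩

/-- The coins for the matrix. -/
def matrixPart {n N : ℕ} (hN : n * dim n * sampleBits n + dim n ≤ N) (r : Fin N → Bool) :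
    Fin (n * dim n) → Fin (sampleBits n) → Bool :=
  fun j i => r ⟨j * sampleBits n + i, by have := block_lt j.2 i.2; omega⟩

theorem map_uniform_parts {n N : ℕ} (hN : n * dim n * sampleBits n + dim n ≤ N) :
    (PMF.uniformOfFintype (Fin N → Bool)).map (fun r => (trapPart hN r, matrixPart hN r)) =
      PMF.uniformOfFintype
        ((Fin (dim n) → Bool) × (Fin (n * dim n) → Fin (sampleBits n) → Bool)) := by
  rw [← map_uniform_of_bijective (((Equiv.sumArrowEquivProdArrow _ _ _).trans
      (Equiv.prodCongr (Equiv.refl _) (Equiv.curry _ _ _))).bijective),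
    ← map_uniform_comp_injective
      (ι := Sum.elim (fun i : Fin (dim n) => (⟨n * dim n * sampleBits n + i, by omega⟩ : Fin N))
        fun z : Fin (n * dim n) × Fin (sampleBits n) =>
          ⟨z.1 * sampleBits n + z.2, by have := block_lt z.1.2 z.2.2; omega⟩), PMF.map_comp]
  · rfl
  · refine Function.Injective.sumElim (fun i i' h => ?_) (fun z z' h => ?_) fun i z h => ?_
    · exact Fin.ext (by simpa using Fin.mk.inj h)
    · have := block_inj z.2.2 z'.2.2 (Fin.mk.inj h)
      exact Prod.ext (Fin.ext this.1) (Fin.ext this.2)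
    · have := block_lt z.1.2 z.2.2
      have := Fin.mk.inj h
      omega

theorem trapdoorSample_eq {n N : ℕ} (hN : n * dim n * sampleBits n + dim n ≤ N)
    (r : Fin N → Bool) : trapdoorSample n (.ofBits r) =
      .pair (.ofMat (annihilate (firstUnit n) (trapVec n (trapPart hN r))
        (matrixOfBlocks n (matrixPart hN r))))
        (.ofMat (fun i _ => trapVec n (trapPart hN r) i : TrapdoorMatrix n)) := by
  have hent : ∀ (i : Fin n) (j : Fin (dim n)), coinEntry n (.ofBits r) i j =
      (matrixOfBlocks n (matrixPart hN r) i j).val := fun i j =>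
    residue_eq (u := matrixPart hN r (finProdFinEquiv (i, j))) fun l => Data.ent_ofBits r ⟨_, _⟩
  have htrap : ∀ i : Fin (dim n), coinTrap n (.ofBits r) i =
      trapBit n (Data.ofBits (trapPart hN r)).ent i := fun i =>
    trapBit_congr (fun i hi =>
      (Data.ent_ofBits r ⟨n * dim n * sampleBits n + i, by omega⟩).trans
        (Data.ent_ofBits (trapPart hN r) ⟨i, hi⟩).symm) i.2
  unfold trapdoorSample Data.ofMat
  congr 1
  · refine (Data.ofList_ofFn fun i => (ofVec_eq_tab fun j => ?_).symm).symm
    rw [← ZMod.val_natCast]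
    congr 1
    rw [annihilate, Matrix.sub_apply, Matrix.vecMulVec_apply, hent, firstUnit]
    push_cast
    rw [ZMod.natCast_zmod_val, sub_eq_add_neg]
    congr 1
    split_ifs
    · rw [Finset.sum_range, mul_one, Matrix.mulVec, dotProduct, ← Finset.sum_neg_distrib]
      refine Finset.sum_congr rfl fun k _ => ?_
      rw [hent, htrap, Nat.cast_sub (ZMod.val_lt _).le]
      simp [trapVec]
    · simp
  · refine (Data.ofList_ofFn fun i => (ofVec_eq_tab fun j => ?_).symm).symm
    rw [htrap, ← ZMod.val_natCast]
    rfl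

/-- The law of the sampled pair. -/
noncomputable def trapdoorSampler (n : ℕ) : PMF (LatticeMatrix n × TrapdoorMatrix n) :=
  (PMF.uniformOfFintype ((Fin (dim n) → Bool) × (Fin (n * dim n) → Fin (sampleBits n) → Bool))).map
    fun z => (annihilate (firstUnit n) (trapVec n z.1) (matrixOfBlocks n z.2),
      fun i _ => trapVec n z.1 i)

/-- The matrix of the sampler is close to one made of a uniform instead of a sampled matrix. -/
theorem statDist_trapdoorSampler_le (n : ℕ) :
    statDist ((trapdoorSampler n).map Prod.fst)
      ((PMF.uniformOfFintype ((Fin (dim n) → Bool) × LatticeMatrix n)).map fun z =>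
        annihilate (firstUnit n) (trapVec n z.1) z.2) ≤ (n * dim n : ℕ) * (2⁻¹ : ℝ) ^ n := by
  let F : (Fin (n * dim n) → ZMod (modulus n)) → LatticeMatrix n :=
    fun v i j => v (finProdFinEquiv (i, j))
  have hF : Function.Bijective F :=
    ((Equiv.arrowCongr finProdFinEquiv.symm (Equiv.refl _)).trans (Equiv.curry _ _ _)).bijective
  let H : (Fin (n * dim n) → ZMod (modulus n)) → PMF (LatticeMatrix n) := fun v =>
    (PMF.uniformOfFintype (Fin (dim n) → Bool)).map fun x =>
      annihilate (firstUnit n) (trapVec n x) (F v)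
  have h1 : (trapdoorSampler n).map Prod.fst = (iid ((PMF.uniformOfFintype
      (Fin (sampleBits n) → Bool)).map fun u => (bitsVal u : ZMod (modulus n))) (n * dim n)).bind
      H := by
    rw [iid_map, iid_uniform, PMF.bind_map, trapdoorSampler, PMF.map_comp, ← PMF.bind_pure_comp,
      uniform_prod_bind, PMF.bind_comm]
    rfl
  have h2 : (PMF.uniformOfFintype ((Fin (dim n) → Bool) × LatticeMatrix n)).map (fun z =>
      annihilate (firstUnit n) (trapVec n z.1) z.2) =
      (iid (PMF.uniformOfFintype (ZMod (modulus n))) (n * dim n)).bind H := by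
    rw [iid_uniform, ← PMF.bind_pure_comp, uniform_prod_bind, PMF.bind_comm,
      ← map_uniform_of_bijective hF, PMF.bind_map]
    rfl
  rw [h1, h2, statDist_comm]
  exact (statDist_bind_le _ _ _).trans (statDist_iid_le (by positivity)
    (pow_le_one₀ (by norm_num) (by norm_num)) _ (mul_uniform_le_map_bitsVal n))

/-- The dimension exceeds `n ⌈log₂ q⌉` by `2n`, so that there are at least `4ⁿ` times as many
sequences of bits as values of `A t`. -/
theorem statDist_annihilate_trapVec_le {n : ℕ} (h : 3 ≤ dim n) (hq : 1 < modulus n) :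
    statDist ((PMF.uniformOfFintype ((Fin (dim n) → Bool) × LatticeMatrix n)).map fun z =>
        annihilate (firstUnit n) (trapVec n z.1) z.2) (PMF.uniformOfFintype (LatticeMatrix n)) ≤
      2 * (2⁻¹ : ℝ) ^ n := by
  have h1 := statDist_annihilate_sq_le (ι := Fin n) (firstUnit n) (trapVec n)
    (firstUnit_dotProduct_trapVec (by omega)) (fun _ _ => exists_dotProduct_trapVec_sub) 8
    (card_trapVec_eq_le h hq)
  have h2 : (Fintype.card (Fin n → ZMod (modulus n)) : ℝ) * 4 ^ n ≤
      Fintype.card (Fin (dim n) → Bool) := by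
    have : Fintype.card (Fin n → ZMod (modulus n)) ≤ 2 ^ trapCols n := by
      rw [Fintype.card_fun, ZMod.card, Fintype.card_fin, trapCols, mul_comm, pow_mul]
      exact Nat.pow_le_pow_left (modulus_le_two_pow_clog n) n
    rw [Fintype.card_fun (β := Bool), Fintype.card_bool, Fintype.card_fin, dim, pow_add, pow_mul]
    exact_mod_cast Nat.mul_le_mul_right _ this
  have h3 : (8 : ℕ) * (Fintype.card (Fin n → ZMod (modulus n)) : ℝ) /
      Fintype.card (Fin (dim n) → Bool) ≤ (4 * (2⁻¹ : ℝ) ^ n) ^ 2 := by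
    rw [div_le_iff₀ (by exact_mod_cast Fintype.card_pos)]
    have h4 : (4 * (2⁻¹ : ℝ) ^ n) ^ 2 * 4 ^ n = 16 := by
      rw [mul_pow, ← pow_mul, mul_comm n, pow_mul, mul_assoc, ← mul_pow]; norm_num
    have h5 := mul_le_mul_of_nonneg_left h2 (sq_nonneg (4 * (2⁻¹ : ℝ) ^ n))
    have h6 : (0 : ℝ) ≤ Fintype.card (Fin n → ZMod (modulus n)) := by positivity
    rw [mul_left_comm, h4] at h5
    push_cast at *
    linarith
  linarith [(abs_le_of_sq_le_sq' (h1.trans h3) (by positivity)).2]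

theorem isTrapdoorSampler_trapdoorSampler : IsTrapdoorSampler trapdoorSampler where
  efficient := by
    obtain ⟨M, hM⟩ := isPolyTime_trapdoorSample.exists_ppt trapdoorCoins
    refine ⟨M, fun n => (hM n n).trans ?_⟩
    rw [trapdoorSampler, ← map_uniform_parts (le_trapdoorCoins n), PMF.map_comp, PMF.map_comp]
    congr 1
    ext1 r
    exact trapdoorSample_eq (le_trapdoorCoins n) r
  mul_eq_zero n z hz := by
    obtain ⟨⟨x, W⟩, -, rfl⟩ := (PMF.mem_support_map_iff _ _ _).1 hz
    ext i j
    have h : 0 < dim n := by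
      have := i.2
      unfold dim; omega
    exact congrFun (annihilate_mulVec (firstUnit_dotProduct_trapVec h x) _) i
  zero_one n z hz i j := by
    obtain ⟨⟨x, W⟩, -, rfl⟩ := (PMF.mem_support_map_iff _ _ _).1 hz
    exact trapVec_eq_zero_or_one x i
  close_to_uniform := by
    refine ⟨1 / 2, by norm_num, ?_⟩
    -- One factor `2 ^ (-n/2)` of `2 ^ (-n)` absorbs the polynomial factor in the distance.
    set s : ℝ := 2 ^ (-(1 / 2) : ℝ) with hs
    have hs0 : 0 < s := by positivity
    have hs1 : s < 1 := Real.rpow_lt_one_of_one_lt_of_neg one_lt_two (by norm_num)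
    have hss : s * s = 2⁻¹ := by
      rw [hs, ← Real.rpow_add two_pos]; norm_num [Real.rpow_neg_one]
    have hlim := ((negligible_pow hs0.le hs1).eval_mul (Polynomial.X * dimPoly + 2)) 0
    simp only [pow_zero, one_mul] at hlim
    filter_upwards [hlim.eventually_lt_const one_pos, eventually_ge_atTop 2] with n hlt hn
    have h3 : 3 ≤ dim n := by unfold dim; omega
    have hq : 1 < modulus n := by
      rw [modulus_of_pos (by omega)]; exact Nat.one_lt_pow (by norm_num) (by omega)
    have hsn : (2 : ℝ) ^ (-(1 / 2 * n) : ℝ) = s ^ n := by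
      rw [← neg_mul, Real.rpow_mul two_pos.le, Real.rpow_natCast]
    have hmul : (n * dim n : ℕ) + 2 ≤ (Polynomial.X * dimPoly + 2).eval n := by
      simp only [Polynomial.eval_add, Polynomial.eval_mul, Polynomial.eval_X, Polynomial.eval_ofNat]
      gcongr
      exact dim_le_eval n
    calc statDist ((trapdoorSampler n).map Prod.fst) (PMF.uniformOfFintype (LatticeMatrix n))
        ≤ (n * dim n : ℕ) * (2⁻¹ : ℝ) ^ n + 2 * (2⁻¹ : ℝ) ^ n :=
          (statDist_triangle _ _ _).trans (add_le_add (statDist_trapdoorSampler_le n)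
            (statDist_annihilate_trapVec_le h3 hq))
      _ ≤ ((Polynomial.X * dimPoly + 2).eval n : ℕ) * s ^ n * s ^ n := by
          rw [← add_mul, mul_assoc, ← mul_pow, hss]
          gcongr
          exact_mod_cast hmul
      _ < 1 * s ^ n := by gcongr
      _ = _ := by rw [one_mul, hsn]
  odd_column := by
    filter_upwards [eventually_ge_atTop 2] with n hn z hz
    obtain ⟨⟨x, W⟩, -, rfl⟩ := (PMF.mem_support_map_iff _ _ _).1 hz
    have h3 : 3 ≤ dim n := by unfold dim; omega
    have hq : 1 < modulus n := by
      rw [modulus_of_pos (by omega)]; exact Nat.one_lt_pow (by norm_num) (by omega)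
    have hcols : 0 < trapCols n := Nat.mul_pos (by omega) (Nat.clog_pos one_lt_two hq)
    exact ⟨⟨0, hcols⟩, odd_card_trapVec h3 hq x, ⟨1, by omega⟩, trapVec_one (by omega) x⟩

/-! ### Robust classifiers that cannot be learned -/

theorem mainTheorem5 :
    -- trapdoor samplers exist, and whichever one samples the task:
    (∃ TS, IsTrapdoorSampler TS) ∧
    ∀ TS, IsTrapdoorSampler TS →
      -- a classifier can be learned efficiently
      (∃ (k : Polynomial ℕ) (L : PPT) (R : Prog) (ν : ℕ → ℝ), R.PolyTime ∧ Negligible ν ∧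
        ∀ n, 1 - ν n ≤ prob (learningExperiment TS k L n) {p | ClassifiesWell R p.1 p.2}) ∧
      -- the trapdoor classifier is efficient and robust
      (∃ R : Prog, R.PolyTime ∧ ∀ (n : ℕ) (T : TrapdoorMatrix n) (y : Vec n),
        R.eval (.pair (.num n) (.pair (.ofMat T) (.ofVec y))) =
          .ofBool (trapdoorClassifier T y)) ∧
      (∀ᶠ n : ℕ in atTop, ∀ z ∈ (TS n).support,
        IsRobust (classDist z.1) ((modulus n : ℝ) / (4 * dim n)) (trapdoorClassifier z.2)) ∧
      -- under the noise, no efficiently learned classifier is better than chance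
      NoisePolynomialSize ∧
      (LWEAssumption → ∀ (k : Polynomial ℕ) (L R : PPT), ∃ ν : ℕ → ℝ, Negligible ν ∧
        ∀ n, prob (noisyExperiment TS k L R n) {true} ≤ 1 / 2 + ν n) := by
  refine ⟨⟨trapdoorSampler, isTrapdoorSampler_trapdoorSampler⟩, fun TS hTS => ⟨exists_learner hTS,
    exists_prog_trapdoorClassifier, eventually_isRobust hTS, noisePolynomialSize,
    fun hLWE k L R => noisyExperiment_le hTS hLWE k L R⟩⟩
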